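/- **Setting.** Let $n\ge 1$, $s\in(1/2,1)$, let $\mathcal H^n$ be the $n$-dimensional Hausdorff measure in $\mathbb R^{n+1}$, let $\Sigma\subset\mathbb R^{n+1}$ be $\mathcal H^n$-measurable with $\sigma:=\mathcal H^n\llcorner\Sigma$ $\sigma$-finite (for instance, of locally finite $\mathcal H^n$-measure), and let $\Omega\subseteq\mathbb R^{n+1}$ be open. Write $B_\rho(x)$ for open balls of $\mathbb R^{n+1}$ and $B_\rho=B_\rho(0)$. Let $R_0>0$, $\Lambda\ge1$, $C_\star\ge c_\star>0$, $b_*\ge0$, $d\ge0$. Assume $0\in\Sigma$, $\Sigma\cap B_{R_0}\subseteq\Omega$ and $$c_\star\rho^n\le\mathcal H^n(\Sigma\cap B_\rho(x))\le C_\star\rho^n\qquad\text{for every }x\in\Sigma\cap\Omega,\ \rho\in(0,R_0].$$ Let $K:\Sigma\times\Sigma\to[0,+\infty]$ be measurable with $K(x,y)=K(y,x)$ for a.e. $x,y\in\Sigma$, $$\frac{\Lambda^{-1}\chi_{B_{R_0}}(x-y)}{|x-y|^{n+2s}}\le K(x,y)\le\frac{\Lambda}{|x-y|^{n+2s}}\quad\text{for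 a.e. }x,y\in\Sigma\cap\Omega,\qquad K(x,y)=0\quad\text{for a.e. }x\in\Sigma\cap\Omega,\ y\in\Sigma\setminus\Omega .$$ Let $R\in(0,R_0/4)$, $U=\Sigma\cap B_{4R}$, and let $b,f:U\to\mathbb R$ be bounded and measurable with $b\le R_0^{-2s}b_*$ and $f\ge-d$ in $U$. For $x\in\Sigma\cap\Omega$ set $$\mathcal L_Kv(x)=\lim_{\delta\to0^+}\int_{(\Sigma\cap\Omega)\setminus B_\delta(x)}(v(y)-v(x))K(x,y)\,d\sigma(y).$$ **Supersolutions.** For $W\subseteq B_{4R}$ open, $\mathcal H^K(\Sigma\cap W)$ is the set of measurable $v:\Sigma\to\mathbb R$ with $v\in L^2(\Sigma\cap W)$ and $$\iint_{(\Sigma\times\Sigma)\setminus((\Sigma\setminus W)\times(\Sigma\setminus W))}|v(x)-v(y)|^2K(x,y)\,d\sigma(x)d\sigma(y)<+\infty .$$ * A *weak supersolution* of $-\mathcal L_Kv+bv=f$ in $U$ is a function $w$ that belongs to $\mathcal H^K(\Sigma\cap V)$ for every open $V$ with compact closure $\overline V\subset B_{4R}$ and satisfies $$\frac12\int_\Sigma\int_\Sigma(w(x)-w(y))(\varphi(x)-\varphi(y))K(x,y)\,d\sigma(x)d\sigma(y)+\int_\Sigma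 bw\varphi\,d\sigma\ge\int_\Sigma f\varphi\,d\sigma$$ for every non-negative $\varphi\in\mathcal H^K(U)$ vanishing on $\Sigma\setminus C$ for some compact $C\subset B_{4R}$. * A *generalized pointwise supersolution* in $U$ is a bounded measurable $w:\Sigma\cap\Omega\to\mathbb R$ for which there is a relatively closed set $S\subset U$, with $S=\varnothing$ if $n=1$ and $\mathrm{Cap}_{\Sigma\cap\Omega,s}(S)=0$ if $n\ge2$, such that: $\mathcal L_Kw(x)$ is well defined (that is, the truncated integrals converge absolutely and their limit exists and is finite) for every $x\in U\setminus S$; the limit defining it is uniform on $\Sigma\cap C$ for every compact $C\subset B_{4R}\setminus S$; and $-\mathcal L_Kw(x)+b(x)w(x)\ge f(x)$ for every $x\in U\setminus S$. Here $\mathrm{Cap}_{\Sigma\cap\Omega,s}(A)$ is the infimum of $$\int_{\Sigma\cap\Omega}v^2\,d\sigma+\int_{\Sigma\cap\Omega}\int_{\Sigma\cap\Omega}\frac{|v(x)-v(y)|^2}{|x-y|^{n+2s}}\,d\sigma(x)d\sigma(y)$$ over the measurable $v:\Sigma\cap\Omega\to\mathbb R$ with $v\ge1$ a.e. in (the intersection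 of $\Sigma\cap\Omega$ with) an open neighborhood of $A$. **Theorem (weak Harnack inequality).** Set $$\theta=\begin{cases}2&\text{if }n\le2,\text{ or }n=3\text{ and }s\in[3/4,1),\\ \dfrac{n}{n-2s}&\text{if }n=3\text{ and }s\in(1/2,3/4),\text{ or }n\ge4.\end{cases}$$ Then $\theta>1$, and for every $p\in(0,\theta)$ there is a constant $c\in(0,1]$ depending only on $n,s,c_\star,C_\star,\Lambda,b_*$ and $p$ with the following property. In the setting above, if $w$ is a weak supersolution or a generalized pointwise supersolution of $-\mathcal L_Kv+bv=f$ in $\Sigma\cap B_{4R}$ and $w\ge0$ a.e. in $\Sigma\cap\Omega$, then $$\inf_{\Sigma\cap B_R}w+R^{2s}d\ \ge\ c\left\{\left(\frac1{\mathcal H^n(\Sigma\cap B_R)}\int_{\Sigma\cap B_R}w^p\,d\sigma\right)^{\frac1p}+R^{2s}\inf_{x\in\Sigma\cap B_{R/2}}\int_{\Sigma\setminus B_R}w(y)K(x,y)\,d\sigma(y)\right\},$$ where both infima are essential infima with respect to $\mathcal H^n$; in particular, the right-hand side is finite. -/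

import Mathlib

open MeasureTheory Metric Set Filter Topology
open scoped ENNReal

namespace NonlocalHarnack

/-- The ambient Euclidean space `ℝ^{n+1}`. -/
abbrev Amb (n : ℕ) : Type := EuclideanSpace ℝ (Fin (n + 1))

/-- Surface measure `dσ`: the `n`-dimensional Hausdorff measure of `ℝ^{n+1}` (normalized so that it
agrees with Lebesgue measure on `n`-planes), restricted to `M`. -/
noncomputable def surf (n : ℕ) (M : Set (Amb n)) : Measure (Amb n) :=
  (μHE[n] : Measure (Amb n)).restrict M

/-- The exponent `θ`. -/
noncomputable def theta (n : ℕ) (s : ℝ) : ℝ :=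
  if n ≤ 2 ∨ (n = 3 ∧ 3 / 4 ≤ s) then 2 else (n : ℝ) / ((n : ℝ) - 2 * s)

/-- The density property
`c⋆ ρⁿ ≤ Hⁿ(M ∩ B_ρ(x)) ≤ C⋆ ρⁿ` for every `x ∈ M ∩ Ω` and `ρ ∈ (0, R₀]`. -/
def HasDensity (n : ℕ) (cs Cs R₀ : ℝ) (M Ω : Set (Amb n)) : Prop :=
  ∀ x ∈ M ∩ Ω, ∀ ρ : ℝ, 0 < ρ → ρ ≤ R₀ →
    ENNReal.ofReal (cs * ρ ^ n) ≤ (μHE[n] : Measure (Amb n)) (M ∩ ball x ρ) ∧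
      (μHE[n] : Measure (Amb n)) (M ∩ ball x ρ) ≤ ENNReal.ofReal (Cs * ρ ^ n)

/-- The structural conditions on the kernel `K : M × M → [0, ∞]`: measurability, symmetry,
two-sided comparison with `|x - y|^{-n-2s}` in `M ∩ Ω`, and truncation outside `Ω`.
(Only the values of `K` on `M × M` matter.) -/
structure IsTruncatedKernel (n : ℕ) (s Λ R₀ : ℝ) (M Ω : Set (Amb n))
    (K : Amb n → Amb n → ℝ≥0∞) : Prop where
  measurable : AEMeasurable (fun z : Amb n × Amb n => K z.1 z.2) ((surf n M).prod (surf n M))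
  symm : ∀ᵐ z ∂((surf n M).prod (surf n M)), K z.1 z.2 = K z.2 z.1
  lower : ∀ᵐ z ∂(((surf n M).restrict Ω).prod ((surf n M).restrict Ω)), dist z.1 z.2 < R₀ →
    ENNReal.ofReal Λ⁻¹ / edist z.1 z.2 ^ ((n : ℝ) + 2 * s) ≤ K z.1 z.2
  upper : ∀ᵐ z ∂(((surf n M).restrict Ω).prod ((surf n M).restrict Ω)),
    K z.1 z.2 ≤ ENNReal.ofReal Λ / edist z.1 z.2 ^ ((n : ℝ) + 2 * s)
  trunc : ∀ᵐ z ∂(((surf n M).restrict Ω).prod ((surf n M).restrict Ωᶜ)), K z.1 z.2 = 0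

/-- The square of the seminorm of `H^K(U)`, for `U = M ∩ W` with `W` open in `ℝ^{n+1}`:
the integral of `|v(x) - v(y)|² K(x,y)` over
`Q(U) = (M × M) \ ((M \ U) × (M \ U))`. -/
noncomputable def energy (n : ℕ) (M W : Set (Amb n)) (K : Amb n → Amb n → ℝ≥0∞)
    (v : Amb n → ℝ) : ℝ≥0∞ :=
  ∫⁻ z in {z : Amb n × Amb n | z.1 ∈ W ∨ z.2 ∈ W},
    ‖v z.1 - v z.2‖ₑ ^ 2 * K z.1 z.2 ∂((surf n M).prod (surf n M))

/-- `v ∈ H^K(U)`, for `U = M ∩ W` with `W` open in `ℝ^{n+1}`. -/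
def MemHK (n : ℕ) (M W : Set (Amb n)) (K : Amb n → Amb n → ℝ≥0∞) (v : Amb n → ℝ) : Prop :=
  AEMeasurable v (surf n M) ∧ MemLp v 2 ((surf n M).restrict W) ∧ energy n M W K v < ∞

/-- `v ∈ H^K_loc(U)`, for `U = M ∩ W` with `W` open in `ℝ^{n+1}`: `v ∈ H^K(M ∩ V)` for every open
`V` whose closure is a compact subset of `W`. -/
def MemHKLoc (n : ℕ) (M W : Set (Amb n)) (K : Amb n → Amb n → ℝ≥0∞) (v : Amb n → ℝ) : Prop :=
  ∀ V : Set (Amb n), IsOpen V → IsCompact (closure V) → closure V ⊆ W → MemHK n M V K v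

/-- `w` is a weak supersolution of `-L_K v + b v = f` in `U = M ∩ W`, with `W` open in `ℝ^{n+1}`.
All integrals converge absolutely when `K` is a truncated kernel and `b`, `f` are bounded. -/
def IsWeakSupersolution (n : ℕ) (M W : Set (Amb n)) (K : Amb n → Amb n → ℝ≥0∞)
    (b f w : Amb n → ℝ) : Prop :=
  MemHKLoc n M W K w ∧
    ∀ φ : Amb n → ℝ, MemHK n M W K φ → (∀ x ∈ M, 0 ≤ φ x) →
      (∃ C : Set (Amb n), IsCompact C ∧ C ⊆ W ∧ ∀ x ∈ M, x ∉ C → φ x = 0) →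
      ∫ x, f x * φ x ∂(surf n M) ≤
        (1 / 2) * ∫ z, (w z.1 - w z.2) * (φ z.1 - φ z.2) * (K z.1 z.2).toReal
            ∂((surf n M).prod (surf n M)) +
          ∫ x, b x * w x * φ x ∂(surf n M)

/-- The square of the norm of `H^s(M ∩ Ω)`. -/
noncomputable def hsNormSq (n : ℕ) (s : ℝ) (M Ω : Set (Amb n)) (v : Amb n → ℝ) : ℝ≥0∞ :=
  ∫⁻ x in Ω, ‖v x‖ₑ ^ 2 ∂(surf n M) +
    ∫⁻ x in Ω, ∫⁻ y in Ω, ‖v x - v y‖ₑ ^ 2 / edist x y ^ ((n : ℝ) + 2 * s)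
      ∂(surf n M) ∂(surf n M)

/-- The `s`-fractional capacity of `A` on `M ∩ Ω`: the infimum of the squared `H^s(M ∩ Ω)` norm
over the functions that are `≥ 1` almost everywhere in an open neighborhood of `A`. -/
noncomputable def fracCap (n : ℕ) (s : ℝ) (M Ω A : Set (Amb n)) : ℝ≥0∞ :=
  ⨅ (v : Amb n → ℝ) (_ : AEMeasurable v ((surf n M).restrict Ω))
    (_ : ∃ O : Set (Amb n), IsOpen O ∧ A ⊆ O ∧
      ∀ᵐ x ∂((surf n M).restrict (Ω ∩ O)), 1 ≤ v x),
    hsNormSq n s M Ω v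

/-- The integrand `(w(y) - w(x)) K(x, y)` of `L_K w(x)`. -/
noncomputable def integrandLK {n : ℕ} (K : Amb n → Amb n → ℝ≥0∞) (w : Amb n → ℝ)
    (x y : Amb n) : ℝ :=
  (w y - w x) * (K x y).toReal

/-- The truncated integral
`∫_{(M ∩ Ω) \ B_δ(x)} (w(y) - w(x)) K(x, y) dσ(y)`, whose limit as `δ → 0⁺` is `L_K w(x)`. -/
noncomputable def truncLK (n : ℕ) (M Ω : Set (Amb n)) (K : Amb n → Amb n → ℝ≥0∞)
    (w : Amb n → ℝ) (δ : ℝ) (x : Amb n) : ℝ :=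
  ∫ y in Ω \ ball x δ, integrandLK K w x y ∂(surf n M)

/-- `w : M ∩ Ω → ℝ` is a generalized pointwise supersolution of `-L_K v + b v = f` in `U = M ∩ W`,
with `W` open in `ℝ^{n+1}`. Here `Z` is the exceptional set and `L` is `L_K w`. -/
def IsGenPointwiseSupersolution (n : ℕ) (s : ℝ) (M Ω W : Set (Amb n))
    (K : Amb n → Amb n → ℝ≥0∞) (b f w : Amb n → ℝ) : Prop :=
  AEMeasurable w ((surf n M).restrict Ω) ∧
  (∃ B : ℝ, ∀ x ∈ M ∩ Ω, |w x| ≤ B) ∧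
  ∃ Z : Set (Amb n),
    (∃ F : Set (Amb n), IsClosed F ∧ Z = F ∩ (M ∩ W)) ∧
    (n = 1 → Z = ∅) ∧ (2 ≤ n → fracCap n s M Ω Z = 0) ∧
    ∃ L : Amb n → ℝ,
      (∀ x ∈ (M ∩ W) \ Z,
        (∀ δ : ℝ, 0 < δ → IntegrableOn (integrandLK K w x) (Ω \ ball x δ) (surf n M)) ∧
        Tendsto (fun δ : ℝ => truncLK n M Ω K w δ x) (𝓝[>] 0) (𝓝 (L x))) ∧
      (∀ C : Set (Amb n), IsCompact C → C ⊆ W \ Z →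
        TendstoUniformlyOn (fun δ : ℝ => truncLK n M Ω K w δ) L (𝓝[>] 0) (M ∩ C)) ∧
      ∀ x ∈ (M ∩ W) \ Z, f x ≤ -L x + b x * w x

end NonlocalHarnack

/-! ### Ball growth and dyadic sums of the model kernel. -/

namespace NonlocalHarnack

/-! Both notions of supersolution are reduced to one class, `IsSuper`, of functions satisfying an
energy inequality against the symmetric measure `K(x,y) dμ(x) dμ(y)`, where `μ` is the surface
measure on `M ∩ Ω`. For this class the inequality follows from energy methods in which the only
functional inequality is a Faber-Krahn inequality; no logarithmic estimate is needed.

The central tool is `growth_lemma`. Testing with `(kη - w)₊` produces, besides an energy, the good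
term `∫ φ(x) ∫ (w(y) - k)₊ K(x,y)`. If the mass `∫ (w(y) - k)₊ K(x,y)` is large compared with `k
r^{-2s}` and with the lower order terms, the good term forces `{w < k}` to have small density, and a
De Giorgi iteration driven by `faber_krahn` gives `w ≥ k/2` in a smaller ball. Nonlocality makes
this sufficient: on `B_{2R} × B_{2R}` the kernel is at least a multiple of `R^{-n-2s}`, so the
average of `w` is itself such a mass. Hence `mean_le`, the case `p = 1`; the mass outside `B_R`
gives `tail_le`.

For larger `p`, testing with `η² (w + δ)^{-ε}` bounds the energy of `η (w + δ)^{(1-ε)/2}`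
(`power_energy`). Faber-Krahn on superlevel sets converts an energy bound into a weak-type bound of
exponent `2/(1 - γ)`, with `γ = min (2s/n) (1/2)` (`weak_type`). A suitably small `ε` then reaches
any `p < 1/(1 - γ)`, and `1/(1 - γ)` is `θ`.

The condition `s > 1/2` enters through the tails: above scale `R₀` the measure only has the growth
`ρ^{n+1}` of the ambient space, against which `|x - y|^{-n-2s}` is summable because `2s > 1`.

Generalized pointwise supersolutions are not assumed to have finite energy. Their truncated
operators are integrated and symmetrized against test functions multiplied by factors `ψ_j` that
vanish near the exceptional set. Zero capacity provides `ψ_j → 1` with energy tending to zero;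
boundedness of `w` gives a Caccioppoli bound uniform in `j`, and the factors are then removed in the
limit. -/

/-- Admissibility of the numerical parameters. -/
structure Admissible (n : ℕ) (s cs Cs Λ : ℝ) : Prop where
  one_le : 1 ≤ n
  half_lt : 1 / 2 < s
  lt_one : s < 1
  cs_pos : 0 < cs
  cs_le : cs ≤ Cs
  one_le_Λ : 1 ≤ Λ

/-- A measure with the density property at scales at most `R₀`, and a measurable symmetric kernel
comparable with `|x - y|^{-n-2s}` at these scales. -/
structure IsJumpSpace (n : ℕ) (s cs Cs Λ R₀ : ℝ) (μ : Measure (Amb n))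
    (K : Amb n → Amb n → ℝ≥0∞) : Prop where
  upper_ball : ∀ᵐ x ∂μ, ∀ ρ : ℝ, 0 < ρ → ρ ≤ R₀ → μ (ball x ρ) ≤ ENNReal.ofReal (Cs * ρ ^ n)
  lower_ball : ∀ᵐ x ∂μ, ∀ ρ : ℝ, 0 < ρ → ‖x‖ + ρ ≤ R₀ →
    ENNReal.ofReal (cs * ρ ^ n) ≤ μ (ball x ρ)
  upper_zero : ∀ ρ : ℝ, 0 < ρ → ρ ≤ R₀ → μ (ball 0 ρ) ≤ ENNReal.ofReal (Cs * ρ ^ n)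
  lower_zero : ∀ ρ : ℝ, 0 < ρ → ρ ≤ R₀ → ENNReal.ofReal (cs * ρ ^ n) ≤ μ (ball 0 ρ)
  measurable : Measurable (fun z : Amb n × Amb n => K z.1 z.2)
  symm : ∀ᵐ z ∂(μ.prod μ), K z.1 z.2 = K z.2 z.1
  lower : ∀ᵐ z ∂(μ.prod μ), dist z.1 z.2 < R₀ →
    ENNReal.ofReal Λ⁻¹ / edist z.1 z.2 ^ ((n : ℝ) + 2 * s) ≤ K z.1 z.2
  upper : ∀ᵐ z ∂(μ.prod μ), K z.1 z.2 ≤ ENNReal.ofReal Λ / edist z.1 z.2 ^ ((n : ℝ) + 2 * s)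

/-- The measure `K(x,y) dμ(x) dμ(y)`. -/
noncomputable def jump {n : ℕ} (μ : Measure (Amb n)) (K : Amb n → Amb n → ℝ≥0∞) :
    Measure (Amb n × Amb n) :=
  (μ.prod μ).withDensity (fun z => K z.1 z.2)

variable {n : ℕ} {s cs Cs Λ R₀ : ℝ} {μ : Measure (Amb n)} {K : Amb n → Amb n → ℝ≥0∞}

/-- A measure whose balls of radius `r` have measure at most `A` has growth `ρ^{n+1}`. -/
theorem measure_ball_le_of_uniform [SFinite μ] {A : ℝ≥0∞} {r : ℝ} (hr : 0 < r)
    (h : ∀ z, μ (ball z r) ≤ A) (x : Amb n) {ρ : ℝ} (hρ : r ≤ ρ) :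
    μ (ball x ρ) ≤ A * ENNReal.ofReal ((2 * ρ / r) ^ (n + 1)) := by
  have hρ0 : 0 < ρ := hr.trans_le hρ
  -- Double counting of the pairs with `dist y z < r` and `y` in the ball, by Fubini for `μ` and
  -- Lebesgue measure: each `y` sees volume `|B_r|`, each `z` sees mass at most `A`, and `z` stays
  -- in `B_{2ρ}(x)`.
  have key : ∫⁻ y, (ball x ρ).indicator (fun y => volume (ball y r)) y ∂μ
      ≤ ∫⁻ z, (ball x (2 * ρ)).indicator (fun _ => A) z := by
    have h1 : ∀ y, (ball x ρ).indicator (fun y => volume (ball y r)) y =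
        ∫⁻ z, (ball x ρ).indicator 1 y * ({p : Amb n × Amb n | dist p.1 p.2 < r}.indicator
          (1 : Amb n × Amb n → ℝ≥0∞)) (y, z) := by
      intro y
      by_cases hy : y ∈ ball x ρ
      · simp only [hy, indicator_of_mem, Pi.one_apply, one_mul]
        rw [← lintegral_indicator_one measurableSet_ball]
        congr 1; ext z
        simp only [indicator, mem_ball, mem_ofPred_eq, dist_comm z y, Pi.one_apply]
      · simp [hy]
    simp_rw [h1]
    rw [lintegral_lintegral_swap]
    · refine lintegral_mono fun z => ?_
      by_cases hz : z ∈ ball x (2 * ρ)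
      · simp only [hz, indicator_of_mem]
        refine le_trans ?_ (h z)
        rw [← lintegral_indicator_one measurableSet_ball]
        refine lintegral_mono fun y => ?_
        by_cases hy : y ∈ ball x ρ
        · simp only [hy, indicator_of_mem, Pi.one_apply, one_mul]
          simp [indicator, mem_ball]
        · simp [hy]
      · simp only [hz, not_false_eq_true, indicator_of_notMem, nonpos_iff_eq_zero]
        rw [← lintegral_zero (μ := μ)]
        congr 1; ext y
        by_cases hy : y ∈ ball x ρ
        · have : ¬ dist y z < r := by
            intro hyz
            apply hz
            rw [mem_ball] at hy ⊢
            have := dist_triangle z y x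
            rw [dist_comm z y] at this
            linarith
          simp [indicator, this]
        · simp [hy]
    · apply Measurable.aemeasurable
      apply Measurable.mul
      · exact (measurable_one.indicator measurableSet_ball).comp measurable_fst
      · exact measurable_one.indicator
          (measurableSet_lt (measurable_fst.dist measurable_snd) measurable_const)
  rw [lintegral_indicator measurableSet_ball, lintegral_indicator measurableSet_ball] at key
  simp only [lintegral_const, Measure.restrict_apply, MeasurableSet.univ, univ_inter] at key
  have hv : ∀ y : Amb n, volume (ball y r) = ENNReal.ofReal (r ^ (n + 1)) *
      volume (ball (0 : Amb n) 1) := fun y => by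
    simpa using Measure.addHaar_ball (volume : Measure (Amb n)) y hr.le
  simp_rw [hv] at key
  rw [Measure.addHaar_ball (volume : Measure (Amb n)) x (by positivity : (0:ℝ) ≤ 2 * ρ)] at key
  simp only [finrank_euclideanSpace, Fintype.card_fin, lintegral_const, Measure.restrict_apply,
    MeasurableSet.univ, univ_inter] at key
  have hω0 : volume (ball (0 : Amb n) 1) ≠ 0 := (measure_ball_pos _ _ one_pos).ne'
  have hω1 : volume (ball (0 : Amb n) 1) ≠ ∞ := measure_ball_lt_top.ne
  have hr0 : ENNReal.ofReal (r ^ (n + 1)) ≠ 0 := by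
    simpa using pow_pos hr _
  rw [div_pow, ENNReal.ofReal_div_of_pos (by positivity), ← mul_div_assoc,
    ENNReal.le_div_iff_mul_le (Or.inl hr0) (Or.inl ENNReal.ofReal_ne_top)]
  refine (ENNReal.mul_le_mul_iff_left hω0 hω1).1 ?_
  calc _ = _ := by ring
    _ ≤ _ := key
    _ = _ := by ring

/-- Above `R₀` the density bound is silent. A ball of radius `R₀/2` that has positive mass contains
a point where the density bound holds, so its mass is at most `Cs R₀ⁿ`; packing such balls in the
ambient space costs the exponent `n + 1`. -/
theorem ball_growth [SFinite μ] (hP : Admissible n s cs Cs Λ) (h : IsJumpSpace n s cs Cs Λ R₀ μ K) :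
    ∀ᵐ x ∂μ, ∀ r ρ : ℝ, 0 < r → r ≤ R₀ → r ≤ ρ →
      μ (ball x ρ) ≤ ENNReal.ofReal (4 ^ (n + 1) * Cs * ρ ^ (n + 1) / r) := by
  filter_upwards [h.upper_ball] with x hx r ρ hr hrR hrρ
  have hCs : 0 < Cs := hP.cs_pos.trans_le hP.cs_le
  have hρ : 0 < ρ := hr.trans_le hrρ
  have hR : 0 < R₀ := hr.trans_le hrR
  rcases le_or_gt ρ R₀ with hρR | hρR
  · refine (hx ρ hρ hρR).trans (ENNReal.ofReal_le_ofReal ?_)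
    rw [le_div_iff₀ hr, pow_succ ρ n]
    have : (1 : ℝ) ≤ 4 ^ (n + 1) := one_le_pow₀ (by norm_num)
    calc Cs * ρ ^ n * r = 1 * (Cs * ρ ^ n * r) := by ring
      _ ≤ 4 ^ (n + 1) * (Cs * ρ ^ n * ρ) := by gcongr
      _ = _ := by ring
  · have hu : ∀ z, μ (ball z (R₀ / 2)) ≤ ENNReal.ofReal (Cs * R₀ ^ n) := by
      intro z
      by_cases hz : μ (ball z (R₀ / 2)) = 0
      · simp [hz]
      · obtain ⟨y, hy, hy'⟩ := ((frequently_ae_mem_iff.2 hz).and_eventually h.upper_ball).exists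
        refine le_trans (measure_mono ?_) (hy' R₀ hR le_rfl)
        intro u hu
        rw [mem_ball] at *
        have := dist_triangle u z y
        rw [dist_comm z y] at this
        linarith
    refine (measure_ball_le_of_uniform (half_pos hR) hu x (by linarith : R₀ / 2 ≤ ρ)).trans ?_
    rw [← ENNReal.ofReal_mul (by positivity)]
    refine ENNReal.ofReal_le_ofReal ?_
    have : Cs * R₀ ^ n * (2 * ρ / (R₀ / 2)) ^ (n + 1) = 4 ^ (n + 1) * Cs * ρ ^ (n + 1) / R₀ := by
      have h4 : 2 * ρ / (R₀ / 2) = 4 * ρ / R₀ := by field_simp; ring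
      rw [h4, div_pow, mul_pow, pow_succ R₀ n]
      field_simp
    rw [this]
    gcongr

/-- Dyadic shells going outwards. With growth `ρ^{n+1}` the `i`-th shell contributes a multiple of
`r^{-2s} (2^{1-2s})^i`, a convergent geometric series because `s > 1/2`. -/
theorem lintegral_tail_le [SFinite μ] (hP : Admissible n s cs Cs Λ)
    (h : IsJumpSpace n s cs Cs Λ R₀ μ K) :
    ∀ᵐ x ∂μ, ∀ r : ℝ, 0 < r → r ≤ R₀ →
      ∫⁻ y in (ball x r)ᶜ, (edist x y ^ ((n : ℝ) + 2 * s))⁻¹ ∂μ ≤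
        ENNReal.ofReal (8 ^ (n + 1) * Cs * (1 - 2 ^ (1 - 2 * s))⁻¹ * r ^ (-(2 * s))) := by
  have hCs : 0 < Cs := hP.cs_pos.trans_le hP.cs_le
  have ha : 0 < (n : ℝ) + 2 * s := by have := hP.half_lt; positivity
  have hq1 : (2 : ℝ) ^ (1 - 2 * s) < 1 :=
    Real.rpow_lt_one_of_one_lt_of_neg (by norm_num) (by linarith [hP.half_lt])
  have hq0 : (0 : ℝ) < 2 ^ (1 - 2 * s) := by positivity
  filter_upwards [ball_growth hP h] with x hx r hr hrR
  have hpt : ∀ y ∈ (ball x r)ᶜ, (edist x y ^ ((n : ℝ) + 2 * s))⁻¹ ≤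
      ∑' i : ℕ, (ball x (2 ^ (i + 1) * r)).indicator
        (fun _ => ENNReal.ofReal ((2 ^ i * r) ^ (-((n : ℝ) + 2 * s)))) y := by
    intro y hy
    rw [mem_compl_iff, mem_ball, not_lt, dist_comm] at hy
    obtain ⟨i, hi1, hi2⟩ := exists_nat_pow_near ((one_le_div hr).2 hy) (one_lt_two)
    rw [le_div_iff₀ hr] at hi1
    rw [div_lt_iff₀ hr] at hi2
    refine le_trans ?_ (ENNReal.le_tsum i)
    rw [indicator_of_mem (by rwa [mem_ball, dist_comm]), edist_dist,
      ENNReal.ofReal_rpow_of_pos (by linarith), ← ENNReal.ofReal_inv_of_pos (by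
        apply Real.rpow_pos_of_pos; linarith), Real.rpow_neg (by positivity)]
    apply ENNReal.ofReal_le_ofReal
    gcongr
  calc _ ≤ ∫⁻ y in (ball x r)ᶜ, ∑' i : ℕ, (ball x (2 ^ (i + 1) * r)).indicator
        (fun _ => ENNReal.ofReal ((2 ^ i * r) ^ (-((n : ℝ) + 2 * s)))) y ∂μ :=
        setLIntegral_mono' measurableSet_ball.compl hpt
    _ ≤ ∫⁻ y, ∑' i : ℕ, (ball x (2 ^ (i + 1) * r)).indicator
        (fun _ => ENNReal.ofReal ((2 ^ i * r) ^ (-((n : ℝ) + 2 * s)))) y ∂μ :=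
        setLIntegral_le_lintegral _ _
    _ = ∑' i : ℕ, ENNReal.ofReal ((2 ^ i * r) ^ (-((n : ℝ) + 2 * s))) *
          μ (ball x (2 ^ (i + 1) * r)) := by
        rw [lintegral_tsum fun i => (measurable_const.indicator measurableSet_ball).aemeasurable]
        congr 1; ext i
        rw [lintegral_indicator measurableSet_ball, setLIntegral_const]
    _ ≤ ∑' i : ℕ, ENNReal.ofReal (8 ^ (n + 1) * Cs * r ^ (-(2 * s)) * (2 ^ (1 - 2 * s)) ^ i) := by
        refine ENNReal.tsum_le_tsum fun i => ?_
        have h2 : (1 : ℝ) ≤ 2 ^ (i + 1) := one_le_pow₀ (by norm_num)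
        refine (mul_le_mul_right (hx r (2 ^ (i + 1) * r) hr hrR (by nlinarith)) _).trans ?_
        rw [← ENNReal.ofReal_mul (by positivity)]
        refine ENNReal.ofReal_le_ofReal (le_of_eq ?_)
        have e1 : (2 ^ i * r) ^ (-((n : ℝ) + 2 * s)) =
            ((2 ^ i * r) ^ (n + 1))⁻¹ * (2 ^ i) ^ (1 - 2 * s) * (r * r ^ (-(2 * s))) := by
          have : -((n : ℝ) + 2 * s) = -((n + 1 : ℕ) : ℝ) + (1 - 2 * s) := by push_cast; ring
          rw [this, Real.rpow_add (by positivity), Real.rpow_neg (by positivity),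
            Real.rpow_natCast, Real.mul_rpow (by positivity) hr.le,
            sub_eq_add_neg, Real.rpow_add hr 1, Real.rpow_one]
          ring
        have e2 : ((2 : ℝ) ^ i) ^ (1 - 2 * s) = (2 ^ (1 - 2 * s)) ^ i := by
          rw [← Real.rpow_natCast, ← Real.rpow_natCast, ← Real.rpow_mul (by norm_num),
            ← Real.rpow_mul (by norm_num), mul_comm]
        have e3 : (2 ^ (i + 1) * r) ^ (n + 1) = 2 ^ (n + 1) * (2 ^ i * r) ^ (n + 1) := by
          rw [← mul_pow]; ring
        have e4 : (8 : ℝ) ^ (n + 1) = 4 ^ (n + 1) * 2 ^ (n + 1) := by rw [← mul_pow]; norm_num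
        rw [e1, e2, e3, e4]
        field_simp
    _ = _ := by
        rw [← ENNReal.ofReal_tsum_of_nonneg (fun i => by positivity)
          ((summable_geometric_of_lt_one hq0.le hq1).mul_left _), tsum_mul_left,
          tsum_geometric_of_lt_one hq0.le hq1]
        congr 1; ring

theorem measure_singleton_zero (hP : Admissible n s cs Cs Λ) (hR : 0 < R₀)
    (h : IsJumpSpace n s cs Cs Λ R₀ μ K) : ∀ᵐ x ∂μ, μ {x} = 0 := by
  filter_upwards [h.upper_ball] with x hx
  have : Tendsto (fun ρ : ℝ => ENNReal.ofReal (Cs * ρ ^ n)) (𝓝[>] 0) (𝓝 0) := by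
    have hc : Continuous (fun ρ : ℝ => ENNReal.ofReal (Cs * ρ ^ n)) :=
      ENNReal.continuous_ofReal.comp (by fun_prop)
    have := (hc.tendsto 0).mono_left (nhdsWithin_le_nhds (s := Ioi 0))
    simpa [zero_pow (Nat.one_le_iff_ne_zero.1 hP.one_le)] using this
  refine le_antisymm (ge_of_tendsto this ?_) bot_le
  filter_upwards [Ioc_mem_nhdsGT hR] with ρ hρ
  exact (measure_mono (singleton_subset_iff.2 (mem_ball_self hρ.1))).trans (hx ρ hρ.1 hρ.2)

/-- Dyadic shells shrinking to `x`. The quadratic factor, which comes from Lipschitz cutoffs, leaves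
the ratio `2^{2s-2}`, and this is below `1` because `s < 1`. -/
theorem lintegral_near_le (hP : Admissible n s cs Cs Λ) (h : IsJumpSpace n s cs Cs Λ R₀ μ K) :
    ∀ᵐ x ∂μ, ∀ r : ℝ, 0 < r → r ≤ R₀ →
      ∫⁻ y in ball x r, ENNReal.ofReal ((dist x y / r) ^ 2) *
        (edist x y ^ ((n : ℝ) + 2 * s))⁻¹ ∂μ ≤
        ENNReal.ofReal (2 ^ ((n : ℝ) + 2 * s) * Cs * (1 - 2 ^ (2 * s - 2))⁻¹ * r ^ (-(2 * s))) := by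
  have hCs : 0 < Cs := hP.cs_pos.trans_le hP.cs_le
  have ha : 0 < (n : ℝ) + 2 * s := by have := hP.half_lt; positivity
  have hq1 : (2 : ℝ) ^ (2 * s - 2) < 1 :=
    Real.rpow_lt_one_of_one_lt_of_neg (by norm_num) (by linarith [hP.lt_one])
  have hq0 : (0 : ℝ) < 2 ^ (2 * s - 2) := by positivity
  filter_upwards [h.upper_ball] with x hx r hr hrR
  have hpt : ∀ y ∈ ball x r, ENNReal.ofReal ((dist x y / r) ^ 2) *
      (edist x y ^ ((n : ℝ) + 2 * s))⁻¹ ≤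
      ∑' i : ℕ, (ball x (2 * ((1 / 2) ^ (i + 1) * r))).indicator
        (fun _ => ENNReal.ofReal (((1 / 2) ^ i) ^ 2 *
          ((1 / 2) ^ (i + 1) * r) ^ (-((n : ℝ) + 2 * s)))) y := by
    intro y hy
    rw [mem_ball, dist_comm] at hy
    rcases eq_or_ne x y with rfl | hxy
    · simp
    have hd : 0 < dist x y := dist_pos.2 hxy
    obtain ⟨i, hi1, hi2⟩ := exists_nat_pow_near ((one_le_div hd).2 hy.le) one_lt_two
    rw [le_div_iff₀ hd] at hi1
    rw [div_lt_iff₀ hd] at hi2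
    have hp : (0 : ℝ) < 2 ^ i := by positivity
    have hi1' : dist x y ≤ (1 / 2) ^ i * r := by
      rw [one_div, inv_pow, inv_mul_eq_div, le_div_iff₀ hp]; linarith
    have hi2' : (1 / 2) ^ (i + 1) * r < dist x y := by
      rw [one_div, inv_pow, inv_mul_eq_div, div_lt_iff₀ (by positivity)]; linarith
    have key : ∀ j : ℕ, y ∈ ball x (2 * ((1 / 2) ^ (j + 1) * r)) → dist x y / r ≤ (1 / 2) ^ j →
        (1 / 2) ^ (j + 1) * r ≤ dist x y →
        ENNReal.ofReal ((dist x y / r) ^ 2) * (edist x y ^ ((n : ℝ) + 2 * s))⁻¹ ≤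
        ∑' i : ℕ, (ball x (2 * ((1 / 2) ^ (i + 1) * r))).indicator
        (fun _ => ENNReal.ofReal (((1 / 2) ^ i) ^ 2 *
          ((1 / 2) ^ (i + 1) * r) ^ (-((n : ℝ) + 2 * s)))) y := by
      intro j h1 h2 h3
      refine le_trans ?_ (ENNReal.le_tsum j)
      rw [indicator_of_mem h1, edist_dist, ENNReal.ofReal_rpow_of_pos hd,
        ← ENNReal.ofReal_inv_of_pos (Real.rpow_pos_of_pos hd _),
        ← ENNReal.ofReal_mul (by positivity), Real.rpow_neg (by positivity)]
      apply ENNReal.ofReal_le_ofReal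
      gcongr
    rcases hi1'.lt_or_eq with hlt | heq
    · refine key i ?_ ?_ hi2'.le
      · rw [mem_ball, dist_comm, pow_succ]; linarith
      · rwa [div_le_iff₀ hr]
    -- The balls are open, so a point lying exactly on a dyadic sphere is charged to the next larger
    -- shell. Index `0` would mean `dist x y = r`, which is excluded.
    · rcases i with _ | i
      · simp at heq; linarith
      · refine key i ?_ ?_ heq.ge
        · rw [mem_ball, dist_comm, heq]
          have : 0 < (1 / 2 : ℝ) ^ (i + 1) * r := by positivity
          linarith
        · rw [div_le_iff₀ hr, heq]
          gcongr (?_ : ℝ) * r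
          exact pow_le_pow_of_le_one (by norm_num) (by norm_num) (Nat.le_succ i)
  calc _ ≤ ∫⁻ y in ball x r, ∑' i : ℕ, (ball x (2 * ((1 / 2) ^ (i + 1) * r))).indicator
        (fun _ => ENNReal.ofReal (((1 / 2) ^ i) ^ 2 *
          ((1 / 2) ^ (i + 1) * r) ^ (-((n : ℝ) + 2 * s)))) y ∂μ :=
        setLIntegral_mono' measurableSet_ball hpt
    _ ≤ ∫⁻ y, ∑' i : ℕ, (ball x (2 * ((1 / 2) ^ (i + 1) * r))).indicator
        (fun _ => ENNReal.ofReal (((1 / 2) ^ i) ^ 2 *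
          ((1 / 2) ^ (i + 1) * r) ^ (-((n : ℝ) + 2 * s)))) y ∂μ :=
        setLIntegral_le_lintegral _ _
    _ = ∑' i : ℕ, ENNReal.ofReal (((1 / 2) ^ i) ^ 2 *
          ((1 / 2) ^ (i + 1) * r) ^ (-((n : ℝ) + 2 * s))) *
          μ (ball x (2 * ((1 / 2) ^ (i + 1) * r))) := by
        rw [lintegral_tsum fun i => (measurable_const.indicator measurableSet_ball).aemeasurable]
        congr 1; ext i
        rw [lintegral_indicator measurableSet_ball, setLIntegral_const]
    _ ≤ ∑' i : ℕ, ENNReal.ofReal (2 ^ ((n : ℝ) + 2 * s) * Cs * r ^ (-(2 * s)) *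
          (2 ^ (2 * s - 2)) ^ i) := by
        refine ENNReal.tsum_le_tsum fun i => ?_
        have e0 : 2 * ((1 / 2 : ℝ) ^ (i + 1) * r) = (1 / 2) ^ i * r := by rw [pow_succ]; ring
        rw [e0]
        have h2 : (1 / 2 : ℝ) ^ i ≤ 1 := pow_le_one₀ (by norm_num) (by norm_num)
        refine (mul_le_mul_right (hx ((1 / 2) ^ i * r) (by positivity) (by nlinarith)) _).trans ?_
        rw [← ENNReal.ofReal_mul (by positivity)]
        refine ENNReal.ofReal_le_ofReal (le_of_eq ?_)
        set t : ℝ := (1 / 2) ^ i with ht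
        have ht0 : 0 < t := by positivity
        have e1 : (1 / 2 : ℝ) ^ (i + 1) * r = (t * r) / 2 := by rw [pow_succ]; ring
        have e2 : (t * r / 2) ^ (-((n : ℝ) + 2 * s)) =
            ((t * r) ^ n)⁻¹ * t ^ (-(2 * s)) * r ^ (-(2 * s)) * 2 ^ ((n : ℝ) + 2 * s) := by
          rw [Real.div_rpow (by positivity) (by norm_num), Real.rpow_neg (by norm_num : (0:ℝ) ≤ 2),
            neg_add, Real.rpow_add (by positivity), Real.rpow_neg (by positivity : 0 ≤ t * r),
            Real.rpow_natCast, Real.mul_rpow (z := -(2 * s)) ht0.le hr.le]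
          field_simp
        have e3 : (2 ^ (2 * s - 2) : ℝ) ^ i = t ^ 2 * t ^ (-(2 * s)) := by
          have : t = 2 ^ (-(i : ℝ)) := by
            rw [ht, Real.rpow_neg (by norm_num), Real.rpow_natCast, one_div, inv_pow]
          rw [← Real.rpow_natCast t 2, ← Real.rpow_add ht0, this, ← Real.rpow_natCast,
            ← Real.rpow_mul (by norm_num), ← Real.rpow_mul (by norm_num)]
          congr 1; push_cast; ring
        rw [e1, e2, e3]
        field_simp
    _ = _ := by
        rw [← ENNReal.ofReal_tsum_of_nonneg (fun i => by positivity)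
          ((summable_geometric_of_lt_one hq0.le hq1).mul_left _), tsum_mul_left,
          tsum_geometric_of_lt_one hq0.le hq1]
        congr 1; ring

end NonlocalHarnack

/-! ### The jump measure, energies of cutoffs, and the Faber-Krahn inequality. -/

namespace NonlocalHarnack

variable {n : ℕ} {s cs Cs Λ R₀ : ℝ} {μ : Measure (Amb n)} {K : Amb n → Amb n → ℝ≥0∞}

/-- The upper bound for `K` is infinite only on the diagonal, which is a null set because almost
every point has no mass. -/
theorem kernel_lt_top [SFinite μ] (hP : Admissible n s cs Cs Λ) (hR : 0 < R₀)
    (h : IsJumpSpace n s cs Cs Λ R₀ μ K) : ∀ᵐ z ∂(μ.prod μ), K z.1 z.2 < ∞ := by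
  have hd : ∀ᵐ z ∂(μ.prod μ), z.1 ≠ z.2 := by
    have hm : MeasurableSet {z : Amb n × Amb n | z.1 ≠ z.2} :=
      (measurableSet_eq_fun measurable_fst measurable_snd).compl
    rw [Measure.ae_prod_iff_ae_ae hm]
    filter_upwards [measure_singleton_zero hP hR h] with x hx
    rw [ae_iff]
    simpa [eq_comm] using hx
  filter_upwards [h.upper, hd] with z hz hne
  refine hz.trans_lt (ENNReal.div_lt_top ENNReal.ofReal_ne_top ?_)
  exact (ENNReal.rpow_pos (edist_pos.2 hne) (edist_ne_top _ _)).ne'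

theorem lintegral_jump [SFinite μ] (h : Measurable (fun z : Amb n × Amb n => K z.1 z.2))
    {F : Amb n × Amb n → ℝ≥0∞} (hF : Measurable F) :
    ∫⁻ z, F z ∂(jump μ K) = ∫⁻ x, ∫⁻ y, K x y * F (x, y) ∂μ ∂μ := by
  rw [jump, lintegral_withDensity_eq_lintegral_mul _ h hF,
    lintegral_prod _ (h.mul hF).aemeasurable]
  rfl

/-- Almost everywhere symmetry of `K` becomes invariance under exchange of the two variables. This
is what allows a term concentrated at `y` to be replaced by the same term at `x`. -/
theorem measurePreserving_swap_jump [SFinite μ] (h : IsJumpSpace n s cs Cs Λ R₀ μ K) :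
    MeasurePreserving Prod.swap (jump μ K) (jump μ K) := by
  refine ⟨measurable_swap, ?_⟩
  ext A hA
  rw [Measure.map_apply measurable_swap hA, jump,
    withDensity_apply _ (measurable_swap hA), withDensity_apply _ hA,
    ← (Measure.measurePreserving_swap (μ := μ) (ν := μ)).setLIntegral_comp_preimage hA h.measurable]
  refine lintegral_congr_ae (ae_restrict_of_ae ?_)
  filter_upwards [h.symm] with z hz using hz

theorem ae_jump_of_ae [SFinite μ] {p : Amb n → Prop} (hp : ∀ᵐ x ∂μ, p x) :
    ∀ᵐ z ∂(jump μ K), p z.1 ∧ p z.2 := by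
  refine (withDensity_absolutelyContinuous (μ.prod μ) _).ae_le ?_
  exact (Measure.quasiMeasurePreserving_fst.ae hp).and (Measure.quasiMeasurePreserving_snd.ae hp)

theorem ae_ae_upper [SFinite μ] (h : IsJumpSpace n s cs Cs Λ R₀ μ K) :
    ∀ᵐ x ∂μ, ∀ᵐ y ∂μ, K x y ≤ ENNReal.ofReal Λ * (edist x y ^ ((n : ℝ) + 2 * s))⁻¹ :=
  Measure.ae_ae_of_ae_prod h.upper

/-- The constant in the upper bounds for integrals of the kernel. -/
noncomputable def upConst (n : ℕ) (s Cs Λ : ℝ) : ℝ :=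
  Λ * (8 ^ (n + 1) * Cs * (1 - 2 ^ (1 - 2 * s))⁻¹ +
    2 ^ ((n : ℝ) + 2 * s) * Cs * (1 - 2 ^ (2 * s - 2))⁻¹)

theorem upConst_aux (hP : Admissible n s cs Cs Λ) :
    0 < 8 ^ (n + 1) * Cs * (1 - (2 : ℝ) ^ (1 - 2 * s))⁻¹ ∧
    0 < 2 ^ ((n : ℝ) + 2 * s) * Cs * (1 - (2 : ℝ) ^ (2 * s - 2))⁻¹ := by
  have hCs : 0 < Cs := hP.cs_pos.trans_le hP.cs_le
  have h1 : (2 : ℝ) ^ (1 - 2 * s) < 1 :=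
    Real.rpow_lt_one_of_one_lt_of_neg (by norm_num) (by linarith [hP.half_lt])
  have h2 : (2 : ℝ) ^ (2 * s - 2) < 1 :=
    Real.rpow_lt_one_of_one_lt_of_neg (by norm_num) (by linarith [hP.lt_one])
  have h1' := sub_pos.2 h1
  have h2' := sub_pos.2 h2
  constructor <;> positivity

theorem upConst_pos (hP : Admissible n s cs Cs Λ) : 0 < upConst n s Cs Λ :=
  mul_pos (by linarith [hP.one_le_Λ]) (add_pos (upConst_aux hP).1 (upConst_aux hP).2)

theorem lintegral_kernel_tail_le [SFinite μ] (hP : Admissible n s cs Cs Λ)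
    (h : IsJumpSpace n s cs Cs Λ R₀ μ K) :
    ∀ᵐ x ∂μ, ∀ r : ℝ, 0 < r → r ≤ R₀ →
      ∫⁻ y in (ball x r)ᶜ, K x y ∂μ ≤ ENNReal.ofReal (upConst n s Cs Λ * r ^ (-(2 * s))) := by
  filter_upwards [ae_ae_upper h, lintegral_tail_le hP h] with x hx hx' r hr hrR
  have hΛ : 0 < Λ := by linarith [hP.one_le_Λ]
  calc ∫⁻ y in (ball x r)ᶜ, K x y ∂μ
      ≤ ∫⁻ y in (ball x r)ᶜ, ENNReal.ofReal Λ * (edist x y ^ ((n : ℝ) + 2 * s))⁻¹ ∂μ :=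
        lintegral_mono_ae (ae_restrict_of_ae hx)
    _ = ENNReal.ofReal Λ * ∫⁻ y in (ball x r)ᶜ, (edist x y ^ ((n : ℝ) + 2 * s))⁻¹ ∂μ :=
        lintegral_const_mul' _ _ ENNReal.ofReal_ne_top
    _ ≤ ENNReal.ofReal Λ * _ := mul_le_mul_right (hx' r hr hrR) _
    _ ≤ _ := by
        rw [← ENNReal.ofReal_mul hΛ.le]
        refine ENNReal.ofReal_le_ofReal ?_
        rw [upConst, mul_assoc Λ]
        gcongr
        exact le_add_of_nonneg_right (upConst_aux hP).2.le

/-- The integral is split at radius `r`: the Lipschitz bound and `lintegral_near_le` inside, the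
trivial bound `1` and `lintegral_tail_le` outside. -/
theorem lintegral_kernel_sq_le [SFinite μ] (hP : Admissible n s cs Cs Λ)
    (h : IsJumpSpace n s cs Cs Λ R₀ μ K) {η : Amb n → ℝ}
    {r : ℝ} (hr : 0 < r) (hrR : r ≤ R₀) (hη : ∀ x y, |η x - η y| ≤ dist x y / r)
    (hη' : ∀ x y, |η x - η y| ≤ 1) :
    ∀ᵐ x ∂μ, ∫⁻ y, K x y * ENNReal.ofReal ((η x - η y) ^ 2) ∂μ ≤
      ENNReal.ofReal (upConst n s Cs Λ * r ^ (-(2 * s))) := by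
  filter_upwards [ae_ae_upper h, lintegral_tail_le hP h, lintegral_near_le hP h] with x hx h1 h2
  have hΛ : 0 < Λ := by linarith [hP.one_le_Λ]
  have hm : Measurable fun y => (edist x y ^ ((n : ℝ) + 2 * s))⁻¹ :=
    ((measurable_const.edist measurable_id).pow_const _).inv
  have hpt : ∀ᵐ y ∂μ, K x y * ENNReal.ofReal ((η x - η y) ^ 2) ≤ ENNReal.ofReal Λ *
      ((ball x r).indicator (fun y => ENNReal.ofReal ((dist x y / r) ^ 2) *
        (edist x y ^ ((n : ℝ) + 2 * s))⁻¹) y +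
        (ball x r)ᶜ.indicator (fun y => (edist x y ^ ((n : ℝ) + 2 * s))⁻¹) y) := by
    filter_upwards [hx] with y hy
    by_cases hb : y ∈ ball x r
    · rw [indicator_of_mem hb, indicator_of_notMem (by simpa using hb), add_zero,
        mul_comm (ENNReal.ofReal ((dist x y / r) ^ 2)), ← mul_assoc]
      refine mul_le_mul' hy (ENNReal.ofReal_le_ofReal ?_)
      exact sq_le_sq' (by linarith [neg_abs_le (η x - η y), hη x y]) ((le_abs_self _).trans (hη x y))
    · rw [indicator_of_notMem hb, indicator_of_mem (by simpa using hb), zero_add]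
      refine (mul_le_mul' hy (ENNReal.ofReal_le_ofReal (?_ : _ ≤ (1 : ℝ)))).trans (by simp)
      rw [← sq_abs]
      exact pow_le_one₀ (abs_nonneg _) (hη' x y)
  refine (lintegral_mono_ae hpt).trans ?_
  rw [lintegral_const_mul' _ _ ENNReal.ofReal_ne_top, lintegral_add_right _
    (hm.indicator measurableSet_ball.compl), lintegral_indicator measurableSet_ball,
    lintegral_indicator measurableSet_ball.compl]
  refine (mul_le_mul_right (add_le_add (h2 r hr hrR) (h1 r hr hrR)) _).trans ?_
  have hc1 := (upConst_aux hP).1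
  have hc2 := (upConst_aux hP).2
  rw [← ENNReal.ofReal_add (by positivity) (by positivity), ← ENNReal.ofReal_mul hΛ.le, upConst]
  exact ENNReal.ofReal_le_ofReal (le_of_eq (by ring))

/-- Energy of Lipschitz cutoffs, with a weight. -/
theorem lintegral_jump_sq_le [SFinite μ] (hP : Admissible n s cs Cs Λ)
    (h : IsJumpSpace n s cs Cs Λ R₀ μ K) {η : Amb n → ℝ} (hηm : Measurable η)
    {r : ℝ} (hr : 0 < r) (hrR : r ≤ R₀) (hη : ∀ x y, |η x - η y| ≤ dist x y / r)
    (hη' : ∀ x y, |η x - η y| ≤ 1) {g : Amb n → ℝ≥0∞} (hg : Measurable g) :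
    ∫⁻ z, g z.1 * ENNReal.ofReal ((η z.1 - η z.2) ^ 2) ∂(jump μ K) ≤
      ENNReal.ofReal (upConst n s Cs Λ * r ^ (-(2 * s))) * ∫⁻ x, g x ∂μ := by
  rw [lintegral_jump h.measurable (by fun_prop), ← lintegral_const_mul _ hg]
  refine lintegral_mono_ae ?_
  filter_upwards [lintegral_kernel_sq_le hP h hr hrR hη hη'] with x hx
  have hKx : Measurable (K x) := h.measurable.comp measurable_prodMk_left
  calc ∫⁻ y, K x y * (g x * ENNReal.ofReal ((η x - η y) ^ 2)) ∂μ
      = ∫⁻ y, g x * (K x y * ENNReal.ofReal ((η x - η y) ^ 2)) ∂μ := by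
        congr 1; ext y; ring
    _ = g x * ∫⁻ y, K x y * ENNReal.ofReal ((η x - η y) ^ 2) ∂μ :=
        lintegral_const_mul _ (by fun_prop)
    _ ≤ _ := by rw [mul_comm]; exact mul_le_mul_left hx _

/-- A nonlocal Faber-Krahn inequality. -/
theorem faber_krahn [SFinite μ] (hP : Admissible n s cs Cs Λ)
    (h : IsJumpSpace n s cs Cs Λ R₀ μ K) {γ : ℝ} (hγ' : γ ≤ 2 * s / n)
    {R : ℝ} (hR : 0 < R) (hRR : 3 * R ≤ R₀) {A : Set (Amb n)} (hA : MeasurableSet A)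
    (hAb : A ⊆ ball 0 (2 * R)) (hAs : μ A ≤ ENNReal.ofReal (cs / 2 * R ^ n))
    {g : Amb n → ℝ≥0∞} (hg : Measurable g) :
    ∫⁻ x in A, g x ∂μ ≤
      ENNReal.ofReal (2 * Λ / cs * R ^ (2 * s) * (2 * μ.real A / (cs * R ^ n)) ^ γ) *
        ∫⁻ z in A ×ˢ Aᶜ, g z.1 ∂(jump μ K) := by
  have hcs := hP.cs_pos
  have hΛ : 0 < Λ := by linarith [hP.one_le_Λ]
  have hn : 0 < (n : ℝ) := by exact_mod_cast hP.one_le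
  have hs : 0 < s := by linarith [hP.half_lt]
  have hAfin : μ A ≠ ∞ := (hAs.trans_lt ENNReal.ofReal_lt_top).ne
  rcases eq_or_ne (μ A) 0 with h0 | h0
  · rw [setLIntegral_measure_zero _ _ h0]; exact bot_le
  set a := μ.real A with ha
  have ha0 : 0 < a := ENNReal.toReal_pos h0 hAfin
  have hμa : μ A = ENNReal.ofReal a := (ENNReal.ofReal_toReal hAfin).symm
  have hale : a ≤ cs / 2 * R ^ n := by
    rw [hμa] at hAs
    exact (ENNReal.ofReal_le_ofReal_iff (by positivity)).1 hAs
  set t := 2 * a / (cs * R ^ n) with ht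
  have ht0 : 0 < t := by positivity
  have ht1 : t ≤ 1 := by rw [ht, div_le_one (by positivity)]; linarith
  -- The radius is fixed by `cs * ρ ^ n = 2 * a`: every ball `B_ρ(x)` with `x ∈ A` then has at least
  -- the mass `a` outside `A`. Since `ρ ≤ R` and `A ⊆ B_{2R}`, these balls stay inside `B_{3R}`,
  -- where the lower density bound is available.
  set ρ := R * t ^ (1 / (n : ℝ)) with hρ
  have hρ0 : 0 < ρ := by positivity
  have hρR : ρ ≤ R := by
    rw [hρ]; exact mul_le_of_le_one_right hR.le (Real.rpow_le_one ht0.le ht1 (by positivity))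
  have hρn : ρ ^ n = 2 * a / cs := by
    rw [hρ, mul_pow, ← Real.rpow_natCast (t ^ (1 / (n : ℝ))), ← Real.rpow_mul ht0.le,
      one_div_mul_cancel hn.ne', Real.rpow_one, ht]
    field_simp
  have hlow : ∀ᵐ x ∂μ, x ∈ A →
      ENNReal.ofReal (Λ⁻¹ * ρ ^ (-((n : ℝ) + 2 * s)) * a) ≤ ∫⁻ y in Aᶜ, K x y ∂μ := by
    filter_upwards [h.lower_ball, Measure.ae_ae_of_ae_prod h.lower] with x hx hx' hxA
    have hxn : ‖x‖ < 2 * R := by simpa using hAb hxA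
    have hb := hx ρ hρ0 (by linarith)
    rw [hρn, mul_div_cancel₀ _ hcs.ne'] at hb
    have hd : ENNReal.ofReal a ≤ μ (ball x ρ ∩ Aᶜ) := by
      have h1 : μ (ball x ρ) ≤ μ A + μ (ball x ρ ∩ Aᶜ) := by
        refine (measure_mono ?_).trans (measure_union_le _ _)
        intro y hy
        by_cases hyA : y ∈ A
        · exact Or.inl hyA
        · exact Or.inr ⟨hy, hyA⟩
      have h2 := hb.trans h1
      rw [hμa, two_mul, ENNReal.ofReal_add ha0.le ha0.le] at h2
      exact (ENNReal.add_le_add_iff_left ENNReal.ofReal_ne_top).1 h2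
    calc ENNReal.ofReal (Λ⁻¹ * ρ ^ (-((n : ℝ) + 2 * s)) * a)
        = ENNReal.ofReal (Λ⁻¹ * ρ ^ (-((n : ℝ) + 2 * s))) * ENNReal.ofReal a :=
          ENNReal.ofReal_mul (by positivity)
      _ ≤ ENNReal.ofReal (Λ⁻¹ * ρ ^ (-((n : ℝ) + 2 * s))) * μ (ball x ρ ∩ Aᶜ) :=
          mul_le_mul_right hd _
      _ = ∫⁻ y in ball x ρ ∩ Aᶜ, ENNReal.ofReal (Λ⁻¹ * ρ ^ (-((n : ℝ) + 2 * s))) ∂μ :=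
          (setLIntegral_const _ _).symm
      _ ≤ ∫⁻ y in ball x ρ ∩ Aᶜ, K x y ∂μ := by
          refine setLIntegral_mono_ae' (measurableSet_ball.inter hA.compl) ?_
          filter_upwards [hx'] with y hy hyb
          have hd : dist x y < ρ := by rw [dist_comm]; exact hyb.1
          refine le_trans ?_ (hy (by linarith))
          rw [ENNReal.ofReal_mul (by positivity), Real.rpow_neg hρ0.le, div_eq_mul_inv,
            ENNReal.ofReal_inv_of_pos (by positivity : 0 < ρ ^ ((n : ℝ) + 2 * s)),
            ← ENNReal.ofReal_rpow_of_pos hρ0]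
          gcongr
          rw [edist_dist]
          exact ENNReal.ofReal_le_ofReal hd.le
      _ ≤ ∫⁻ y in Aᶜ, K x y ∂μ := lintegral_mono_set inter_subset_right
  have hmain : ENNReal.ofReal (Λ⁻¹ * ρ ^ (-((n : ℝ) + 2 * s)) * a) * ∫⁻ x in A, g x ∂μ ≤
      ∫⁻ z in A ×ˢ Aᶜ, g z.1 ∂(jump μ K) := by
    rw [← lintegral_indicator (hA.prod hA.compl), lintegral_jump h.measurable
      (Measurable.indicator (f := fun z : Amb n × Amb n => g z.1) (by fun_prop)
        (hA.prod hA.compl)), ← lintegral_indicator hA,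
      ← lintegral_const_mul _ (hg.indicator hA)]
    refine lintegral_mono_ae ?_
    filter_upwards [hlow] with x hx
    by_cases hxA : x ∈ A
    · rw [indicator_of_mem hxA, mul_comm]
      have : ∀ y, K x y * (A ×ˢ Aᶜ).indicator (fun z : Amb n × Amb n => g z.1) (x, y) =
          Aᶜ.indicator (fun y => g x * K x y) y := by
        intro y
        by_cases hy : y ∈ Aᶜ
        · rw [indicator_of_mem hy, indicator_of_mem (mk_mem_prod hxA hy), mul_comm]
        · rw [indicator_of_notMem hy, indicator_of_notMem (fun hh => hy hh.2), mul_zero]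
      simp_rw [this]
      have hKx : Measurable (K x) := h.measurable.comp measurable_prodMk_left
      rw [lintegral_indicator hA.compl, lintegral_const_mul _ hKx]
      exact mul_le_mul_right (hx hxA) _
    · simp [hxA]
  have hc : 0 < Λ⁻¹ * ρ ^ (-((n : ℝ) + 2 * s)) * a := by positivity
  have hinv : (Λ⁻¹ * ρ ^ (-((n : ℝ) + 2 * s)) * a)⁻¹ ≤ 2 * Λ / cs * R ^ (2 * s) * t ^ γ := by
    have e1 : ρ ^ ((n : ℝ) + 2 * s) = 2 * a / cs * (R ^ (2 * s) * t ^ (2 * s / n)) := by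
      rw [Real.rpow_add hρ0, Real.rpow_natCast, hρn, hρ, Real.mul_rpow hR.le (by positivity),
        ← Real.rpow_mul ht0.le]
      congr 3; ring
    rw [Real.rpow_neg hρ0.le, e1]
    -- The natural exponent is `2s/n`; as `t ≤ 1` it may be lowered to `γ`.
    have : t ^ (2 * s / n) ≤ t ^ γ := Real.rpow_le_rpow_of_exponent_ge ht0 ht1 hγ'
    calc _ = 2 * Λ / cs * R ^ (2 * s) * t ^ (2 * s / n) := by field_simp
      _ ≤ _ := by gcongr
  calc ∫⁻ x in A, g x ∂μ = ENNReal.ofReal (Λ⁻¹ * ρ ^ (-((n : ℝ) + 2 * s)) * a)⁻¹ *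
        (ENNReal.ofReal (Λ⁻¹ * ρ ^ (-((n : ℝ) + 2 * s)) * a) * ∫⁻ x in A, g x ∂μ) := by
        rw [← mul_assoc, ← ENNReal.ofReal_mul (by positivity), inv_mul_cancel₀ hc.ne']
        simp
    _ ≤ _ := mul_le_mul' (ENNReal.ofReal_le_ofReal hinv) hmain

/-- A Lipschitz radial cutoff, equal to `1` in the ball of radius `a` and to `0` outside the ball
of radius `b`. -/
noncomputable def cutoff {n : ℕ} (a b : ℝ) (x : Amb n) : ℝ := max 0 (min 1 ((b - ‖x‖) / (b - a)))

theorem cutoff_nonneg (a b : ℝ) (x : Amb n) : 0 ≤ cutoff a b x := le_max_left _ _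

theorem cutoff_le_one (a b : ℝ) (x : Amb n) : cutoff a b x ≤ 1 :=
  max_le zero_le_one (min_le_left _ _)

theorem continuous_cutoff (a b : ℝ) : Continuous (cutoff (n := n) a b) := by
  unfold cutoff; fun_prop

theorem cutoff_eq_one {a b : ℝ} (hab : a < b) {x : Amb n} (hx : ‖x‖ ≤ a) : cutoff a b x = 1 := by
  have : 1 ≤ (b - ‖x‖) / (b - a) := by rw [le_div_iff₀ (by linarith)]; linarith
  simp [cutoff, this]

theorem cutoff_eq_zero {a b : ℝ} (hab : a < b) {x : Amb n} (hx : b ≤ ‖x‖) : cutoff a b x = 0 := by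
  have : (b - ‖x‖) / (b - a) ≤ 0 := div_nonpos_of_nonpos_of_nonneg (by linarith) (by linarith)
  simp [cutoff, this]

theorem abs_cutoff_sub_le_one (a b : ℝ) (x y : Amb n) : |cutoff a b x - cutoff a b y| ≤ 1 := by
  rw [abs_le]
  constructor <;>
    linarith [cutoff_nonneg a b x, cutoff_nonneg a b y, cutoff_le_one a b x, cutoff_le_one a b y]

theorem abs_cutoff_sub_le {a b : ℝ} (hab : a < b) (x y : Amb n) :
    |cutoff a b x - cutoff a b y| ≤ dist x y / (b - a) := by
  have h0 : 0 < b - a := by linarith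
  unfold cutoff
  refine (abs_max_sub_max_le_max 0 _ 0 _).trans ?_
  rw [sub_self, abs_zero, max_eq_right (abs_nonneg _)]
  refine (abs_min_sub_min_le_max _ _ _ _).trans ?_
  rw [sub_self, abs_zero, max_eq_right (abs_nonneg _), ← sub_div, abs_div, abs_of_pos h0]
  gcongr
  rw [dist_comm, dist_eq_norm, show b - ‖x‖ - (b - ‖y‖) = ‖y‖ - ‖x‖ by ring]
  exact abs_norm_sub_norm_le y x

end NonlocalHarnack

/-! ### The energy class of supersolutions and its truncation estimate. -/

namespace NonlocalHarnack

variable {n : ℕ} {s cs Cs Λ R₀ : ℝ} {μ : Measure (Amb n)} {K : Amb n → Amb n → ℝ≥0∞}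

/-- Non-negative functions satisfying the energy form of `-L w + b₀ w ≥ -d` in the ball of radius
`4R`, tested against bounded functions. -/
structure IsSuper (μ : Measure (Amb n)) (K : Amb n → Amb n → ℝ≥0∞) (R d b₀ : ℝ)
    (w : Amb n → ℝ) : Prop where
  measurable : Measurable w
  nonneg : ∀ x, 0 ≤ w x
  sq_lt_top : ∀ ρ < 4 * R, ∫⁻ x in ball 0 ρ, ENNReal.ofReal (w x ^ 2) ∂μ < ∞
  energy_lt_top : ∀ ρ < 4 * R, ∫⁻ z, (ball 0 ρ).indicator 1 z.1 *
    ENNReal.ofReal ((w z.1 - w z.2) ^ 2) ∂(jump μ K) < ∞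
  le_form : ∀ (φ : Amb n → ℝ) (ρ B : ℝ), ρ < 4 * R → Measurable φ → (∀ x, 0 ≤ φ x) →
    (∀ x, φ x ≤ B) → (∀ x ∉ ball 0 ρ, φ x = 0) →
    ∫⁻ z, ENNReal.ofReal ((φ z.1 - φ z.2) ^ 2) ∂(jump μ K) < ∞ →
    -d * ∫ x, φ x ∂μ ≤
      (1 / 2) * ∫ z, (w z.1 - w z.2) * (φ z.1 - φ z.2) ∂(jump μ K) + b₀ * ∫ x, w x * φ x ∂μ

theorem integrable_of_lintegral_ofReal_lt_top {α : Type*} [MeasurableSpace α] {ν : Measure α}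
    {f : α → ℝ} (hf : Measurable f) (h0 : ∀ x, 0 ≤ f x) (h : ∫⁻ x, ENNReal.ofReal (f x) ∂ν < ∞) :
    Integrable f ν :=
  ⟨hf.aestronglyMeasurable, (hasFiniteIntegral_iff_ofReal (ae_of_all _ h0)).2 h⟩

theorem lintegral_jump_swap [SFinite μ] (h : IsJumpSpace n s cs Cs Λ R₀ μ K)
    {F : Amb n × Amb n → ℝ≥0∞} (hF : Measurable F) :
    ∫⁻ z, F z.swap ∂(jump μ K) = ∫⁻ z, F z ∂(jump μ K) :=
  (measurePreserving_swap_jump h).lintegral_comp hF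

/-- Functions of finite energy near the support of the test function have an absolutely convergent
bilinear form. -/
theorem integrable_form [SFinite μ] (h : IsJumpSpace n s cs Cs Λ R₀ μ K) {w φ : Amb n → ℝ}
    (hw : Measurable w) (hφ : Measurable φ) {B : Set (Amb n)} (hB : MeasurableSet B)
    (hwE : ∫⁻ z, B.indicator 1 z.1 * ENNReal.ofReal ((w z.1 - w z.2) ^ 2) ∂(jump μ K) < ∞)
    (hφB : ∀ x ∉ B, φ x = 0)
    (hφE : ∫⁻ z, ENNReal.ofReal ((φ z.1 - φ z.2) ^ 2) ∂(jump μ K) < ∞) :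
    Integrable (fun z : Amb n × Amb n => (w z.1 - w z.2) * (φ z.1 - φ z.2)) (jump μ K) := by
  have i1 : Integrable (fun z : Amb n × Amb n => (φ z.1 - φ z.2) ^ 2) (jump μ K) :=
    integrable_of_lintegral_ofReal_lt_top (by fun_prop) (fun _ => sq_nonneg _) hφE
  have hBm : Measurable (B.indicator (1 : Amb n → ℝ)) := measurable_one.indicator hB
  have i2 : Integrable (fun z : Amb n × Amb n =>
      B.indicator (1 : Amb n → ℝ) z.1 * (w z.1 - w z.2) ^ 2) (jump μ K) := by
    refine integrable_of_lintegral_ofReal_lt_top (by fun_prop)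
      (fun z => mul_nonneg (indicator_nonneg (fun _ _ => zero_le_one) _) (sq_nonneg _)) ?_
    convert hwE using 3 with z
    by_cases hz : z.1 ∈ B <;> simp [hz]
  have i3 := (measurePreserving_swap_jump h).integrable_comp_of_integrable i2
  refine ((i1.add i2).add i3).mono' (by fun_prop) (ae_of_all _ fun z => ?_)
  simp only [Pi.add_apply, Function.comp_apply, Prod.fst_swap, Prod.snd_swap, Real.norm_eq_abs]
  have hab : ∀ a b : ℝ, |a * b| ≤ a ^ 2 + b ^ 2 := by
    intro a b
    rw [abs_le]
    constructor <;> nlinarith [sq_nonneg (a + b), sq_nonneg (a - b), sq_nonneg a, sq_nonneg b]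
  have h0 : ∀ x, 0 ≤ B.indicator (1 : Amb n → ℝ) x :=
    fun x => indicator_nonneg (fun _ _ => zero_le_one) _
  by_cases h1 : z.1 ∈ B
  · rw [indicator_of_mem h1]
    have := mul_nonneg (h0 z.2) (sq_nonneg (w z.2 - w z.1))
    have := hab (w z.1 - w z.2) (φ z.1 - φ z.2)
    simp only [Pi.one_apply]
    linarith
  · by_cases h2 : z.2 ∈ B
    · rw [indicator_of_mem h2]
      have := mul_nonneg (h0 z.1) (sq_nonneg (w z.1 - w z.2))
      have := hab (w z.1 - w z.2) (φ z.1 - φ z.2)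
      have e : (w z.2 - w z.1) ^ 2 = (w z.1 - w z.2) ^ 2 := by ring
      simp only [Pi.one_apply, e]
      linarith
    · simp [h1, h2, hφB]

/-- Energy of a function on pairs meeting `B`, from the pairs whose first entry is in `B`. -/
theorem lintegral_sq_le_two_mul [SFinite μ] (h : IsJumpSpace n s cs Cs Λ R₀ μ K) {φ : Amb n → ℝ}
    (hφ : Measurable φ) {B : Set (Amb n)} (hB : MeasurableSet B) (hφB : ∀ x ∉ B, φ x = 0) :
    ∫⁻ z, ENNReal.ofReal ((φ z.1 - φ z.2) ^ 2) ∂(jump μ K) ≤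
      2 * ∫⁻ z, B.indicator 1 z.1 * ENNReal.ofReal ((φ z.1 - φ z.2) ^ 2) ∂(jump μ K) := by
  have hBm : Measurable (B.indicator (1 : Amb n → ℝ≥0∞)) := measurable_one.indicator hB
  have hF : Measurable fun z : Amb n × Amb n =>
      B.indicator (1 : Amb n → ℝ≥0∞) z.1 * ENNReal.ofReal ((φ z.1 - φ z.2) ^ 2) := by fun_prop
  rw [two_mul]
  nth_rewrite 2 [← lintegral_jump_swap h hF]
  rw [← lintegral_add_left hF]
  refine lintegral_mono fun z => ?_
  simp only [Prod.fst_swap, Prod.snd_swap]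
  by_cases h1 : z.1 ∈ B
  · simp [h1]
  · by_cases h2 : z.2 ∈ B
    · have e : (φ z.2 - φ z.1) ^ 2 = (φ z.1 - φ z.2) ^ 2 := by ring
      simp [h2, e]
    · simp [h1, h2, hφB]

theorem ball_lt_top (h : IsJumpSpace n s cs Cs Λ R₀ μ K) {ρ : ℝ} (hρ : ρ ≤ R₀) :
    μ (ball 0 ρ) < ∞ := by
  rcases le_or_gt ρ 0 with h0 | h0
  · simp [ball_eq_empty.2 h0]
  · exact (h.upper_zero ρ h0 hρ).trans_lt ENNReal.ofReal_lt_top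

/-- Used with `a = w x`, `b = w y`, `p = k η(x)`, `q = k η(y)`. Where both truncations are positive,
`a - b` equals `p - q` minus their difference, and a square is completed. Where `w` lies above the
barrier at one point only, the surplus times the truncation at the other point is kept: it is the
nonlocal good term. -/
theorem truncation_pointwise {a b p q k : ℝ} (hp : p ≤ k) (hq : q ≤ k) :
    (a - b) * (max 0 (p - a) - max 0 (q - b)) + (1 / 2) * (max 0 (p - a) - max 0 (q - b)) ^ 2 +
      (max 0 (a - k) * max 0 (q - b) + max 0 (b - k) * max 0 (p - a)) ≤ (1 / 2) * (p - q) ^ 2 := by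
  have ha : max 0 (a - k) ≤ max 0 (a - p) := max_le_max le_rfl (by linarith)
  have hb : max 0 (b - k) ≤ max 0 (b - q) := max_le_max le_rfl (by linarith)
  have h1 := mul_le_mul_of_nonneg_right ha (le_max_left 0 (q - b))
  have h2 := mul_le_mul_of_nonneg_right hb (le_max_left 0 (p - a))
  rcases le_total 0 (p - a) with hpa | hpa <;> rcases le_total 0 (q - b) with hqb | hqb
  · rw [max_eq_left (by linarith : a - p ≤ 0)] at h1
    rw [max_eq_left (by linarith : b - q ≤ 0)] at h2
    rw [max_eq_right hpa, max_eq_right hqb] at *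
    nlinarith [sq_nonneg ((p - q) - ((p - a) - (q - b)))]
  · rw [max_eq_right (by linarith : 0 ≤ b - q)] at h2
    rw [max_eq_right hpa, max_eq_left hqb] at *
    nlinarith [sq_nonneg ((p - q) - (p - a))]
  · rw [max_eq_right (by linarith : 0 ≤ a - p)] at h1
    rw [max_eq_left hpa, max_eq_right hqb] at *
    nlinarith [sq_nonneg ((p - q) + (q - b))]
  · rw [max_eq_left hpa, max_eq_left hqb] at *
    nlinarith [sq_nonneg (p - q)]

section Level

variable {R d b₀ : ℝ} {w : Amb n → ℝ}

/-- This makes `(kη - w)₊` an admissible test function. The positive part is 1-Lipschitz, so only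
the energies of `kη` and of `w` on pairs starting in the ball intervene. -/
theorem energy_truncation_lt_top [SFinite μ] (hP : Admissible n s cs Cs Λ)
    (h : IsJumpSpace n s cs Cs Λ R₀ μ K) (hw : IsSuper μ K R d b₀ w) {η : Amb n → ℝ}
    (hηm : Measurable η) {ℓ : ℝ} (hℓ : 0 < ℓ) (hℓR : ℓ ≤ R₀)
    (hη : ∀ x y, |η x - η y| ≤ dist x y / ℓ)
    (hη' : ∀ x y, |η x - η y| ≤ 1) {ρ : ℝ} (hρ : ρ < 4 * R) (hρR : ρ ≤ R₀)
    (hηρ : ∀ x ∉ ball 0 ρ, η x = 0) (k : ℝ) :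
    ∫⁻ z, ENNReal.ofReal ((max 0 (k * η z.1 - w z.1) - max 0 (k * η z.2 - w z.2)) ^ 2)
      ∂(jump μ K) < ∞ := by
  have hwm := hw.measurable
  have hB : Measurable ((ball 0 ρ).indicator (1 : Amb n → ℝ≥0∞)) :=
    measurable_one.indicator measurableSet_ball
  refine (lintegral_sq_le_two_mul h (φ := fun x => max 0 (k * η x - w x)) (by fun_prop)
    (measurableSet_ball (x := (0 : Amb n)) (ε := ρ)) ?_).trans_lt ?_
  · intro x hx
    simp only [hηρ x hx, mul_zero, zero_sub]
    exact max_eq_left (by linarith [hw.nonneg x])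
  refine ENNReal.mul_lt_top (by simp) ?_
  have hpt : ∀ z : Amb n × Amb n, (ball 0 ρ).indicator (1 : Amb n → ℝ≥0∞) z.1 *
      ENNReal.ofReal ((max 0 (k * η z.1 - w z.1) - max 0 (k * η z.2 - w z.2)) ^ 2) ≤
      ENNReal.ofReal (2 * k ^ 2) * ((ball 0 ρ).indicator (1 : Amb n → ℝ≥0∞) z.1 *
        ENNReal.ofReal ((η z.1 - η z.2) ^ 2)) + 2 * ((ball 0 ρ).indicator 1 z.1 *
        ENNReal.ofReal ((w z.1 - w z.2) ^ 2)) := by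
    intro z
    by_cases hz : z.1 ∈ ball 0 ρ
    · simp only [hz, indicator_of_mem, Pi.one_apply, one_mul]
      rw [← ENNReal.ofReal_mul (by positivity), ← ENNReal.ofReal_ofNat 2,
        ← ENNReal.ofReal_mul (by positivity), ← ENNReal.ofReal_add (by positivity) (by positivity)]
      refine ENNReal.ofReal_le_ofReal ?_
      have h1 := abs_max_sub_max_le_max 0 (k * η z.1 - w z.1) 0 (k * η z.2 - w z.2)
      rw [sub_self, abs_zero, max_eq_right
        (abs_nonneg (k * η z.1 - w z.1 - (k * η z.2 - w z.2)))] at h1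
      have h2 := sq_le_sq.2 h1
      nlinarith [sq_nonneg (k * (η z.1 - η z.2) + (w z.1 - w z.2))]
    · simp [hz]
  refine (lintegral_mono hpt).trans_lt ?_
  rw [lintegral_add_left (by fun_prop), lintegral_const_mul _ (by fun_prop),
    lintegral_const_mul _ (by fun_prop)]
  refine ENNReal.add_lt_top.2 ⟨ENNReal.mul_lt_top ENNReal.ofReal_lt_top ?_,
    ENNReal.mul_lt_top (by simp) (hw.energy_lt_top ρ hρ)⟩
  refine (lintegral_jump_sq_le hP h hηm hℓ hℓR hη hη' hB).trans_lt
    (ENNReal.mul_lt_top ENNReal.ofReal_lt_top ?_)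
  rw [lintegral_indicator_one measurableSet_ball]
  exact ball_lt_top h hρR

set_option maxHeartbeats 1000000 in
/-- The energy estimate for the truncations `(kη - w)₊`. -/
theorem level_estimate [SFinite μ] (hP : Admissible n s cs Cs Λ)
    (h : IsJumpSpace n s cs Cs Λ R₀ μ K) (hw : IsSuper μ K R d b₀ w) (hd : 0 ≤ d) (hb : 0 ≤ b₀)
    {η : Amb n → ℝ} (hηm : Measurable η) {ℓ : ℝ} (hℓ : 0 < ℓ) (hℓR : ℓ ≤ R₀)
    (hη : ∀ x y, |η x - η y| ≤ dist x y / ℓ) (hη' : ∀ x y, |η x - η y| ≤ 1)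
    (hη1 : ∀ x, η x ≤ 1) {ρ : ℝ} (hρ : ρ < 4 * R) (hρR : ρ ≤ R₀)
    (hηρ : ∀ x ∉ ball 0 ρ, η x = 0) {k : ℝ} (hk : 0 ≤ k) {T : ℝ}
    (hT : ∀ᵐ x ∂μ, x ∈ ball 0 ρ →
      ENNReal.ofReal T ≤ ∫⁻ y, K x y * ENNReal.ofReal (w y - k) ∂μ) :
    ENNReal.ofReal (1 / 4) * ∫⁻ z, ENNReal.ofReal
        ((max 0 (k * η z.1 - w z.1) - max 0 (k * η z.2 - w z.2)) ^ 2) ∂(jump μ K) +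
      ENNReal.ofReal T * ∫⁻ x, ENNReal.ofReal (k * η x - w x) ∂μ ≤
    ENNReal.ofReal (d + b₀ * k) * ∫⁻ x, ENNReal.ofReal (k * η x - w x) ∂μ +
      ENNReal.ofReal (upConst n s Cs Λ * k ^ 2 * ℓ ^ (-(2 * s))) *
        μ ({x | w x < k} ∩ ball 0 ρ) := by
  have hwm := hw.measurable
  have hUC := upConst_pos hP
  set A : Set (Amb n) := {x | w x < k} ∩ ball 0 ρ with hA
  have hAm : MeasurableSet A := (measurableSet_lt hwm measurable_const).inter measurableSet_ball
  have hAfin : μ A < ∞ := (measure_mono inter_subset_right).trans_lt (ball_lt_top h hρR)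
  have hAi : Measurable (A.indicator (1 : Amb n → ℝ)) := measurable_one.indicator hAm
  set φ : Amb n → ℝ := fun x => max 0 (k * η x - w x) with hφ
  have hφm : Measurable φ := by fun_prop
  have hφ0 : ∀ x, 0 ≤ φ x := fun x => le_max_left _ _
  have hφk : ∀ x, φ x ≤ k := fun x =>
    max_le hk (by nlinarith [hw.nonneg x, hη1 x])
  have hkη : ∀ x, k * η x ≤ k := fun x => by nlinarith [hη1 x]
  have hφA : ∀ x ∉ A, φ x = 0 := by
    intro x hx
    refine max_eq_left ?_
    by_contra hcon
    push Not at hcon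
    refine hx ⟨show w x < k by linarith [hkη x], ?_⟩
    by_contra hxb
    rw [hηρ x hxb] at hcon
    linarith [hw.nonneg x]
  have hφρ : ∀ x ∉ ball 0 ρ, φ x = 0 := fun x hx => hφA x fun hh => hx hh.2
  have hφE : ∫⁻ z, ENNReal.ofReal ((φ z.1 - φ z.2) ^ 2) ∂(jump μ K) < ∞ :=
    energy_truncation_lt_top hP h hw hηm hℓ hℓR hη hη' hρ hρR hηρ k
  have hle := hw.le_form φ ρ k hρ hφm hφ0 hφk hφρ hφE
  have hF := integrable_form h hwm hφm measurableSet_ball (hw.energy_lt_top ρ hρ) hφρ hφE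
  have hφe : ∀ x, ENNReal.ofReal (k * η x - w x) = ENNReal.ofReal (φ x) := fun x => by
    simp [hφ, ENNReal.ofReal_max]
  simp_rw [hφe]
  have hφi : Integrable φ μ := by
    refine Integrable.mono' (g := A.indicator fun _ => k)
      ?_ hφm.aestronglyMeasurable
      (ae_of_all _ fun x => ?_)
    · rw [integrable_indicator_iff hAm]; exact integrableOn_const hAfin.ne
    · by_cases hx : x ∈ A
      · simp only [hx, indicator_of_mem, Real.norm_eq_abs, abs_of_nonneg (hφ0 x)]; exact hφk x
      · simp [hx, hφA x hx]
  -- The support of `φ` lies in `{w < k}`.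
  have hwφ : ∫ x, w x * φ x ∂μ ≤ k * ∫ x, φ x ∂μ := by
    rw [← integral_const_mul]
    refine integral_mono_of_nonneg (ae_of_all _ fun x => mul_nonneg (hw.nonneg x) (hφ0 x))
      (hφi.const_mul k) (ae_of_all _ fun x => ?_)
    by_cases hx : x ∈ A
    · exact mul_le_mul_of_nonneg_right hx.1.le (hφ0 x)
    · simp [hφA x hx]
  -- the right-hand side
  set Q : Amb n × Amb n → ℝ := fun z => A.indicator 1 z.1 * (η z.1 - η z.2) ^ 2 with hQ
  have hQm : Measurable Q := by fun_prop
  have hQ0 : ∀ z, 0 ≤ Q z := fun z =>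
    mul_nonneg (indicator_nonneg (fun _ _ => zero_le_one) _) (sq_nonneg _)
  have hQl : ∫⁻ z, ENNReal.ofReal (Q z) ∂(jump μ K) ≤
      ENNReal.ofReal (upConst n s Cs Λ * ℓ ^ (-(2 * s))) * μ A := by
    have := lintegral_jump_sq_le hP h hηm hℓ hℓR hη hη'
      (g := A.indicator 1) (measurable_one.indicator hAm)
    rw [lintegral_indicator_one hAm] at this
    refine le_trans (le_of_eq ?_) this
    congr 1; ext z
    by_cases hz : z.1 ∈ A <;> simp [hQ, hz]
  have hQi : Integrable Q (jump μ K) := integrable_of_lintegral_ofReal_lt_top hQm hQ0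
    (hQl.trans_lt (ENNReal.mul_lt_top ENNReal.ofReal_lt_top hAfin))
  have hQs : Integrable (fun z => Q z.swap) (jump μ K) :=
    (measurePreserving_swap_jump h).integrable_comp_of_integrable hQi
  have hQse : ∫ z, Q z.swap ∂(jump μ K) = ∫ z, Q z ∂(jump μ K) :=
    (measurePreserving_swap_jump h).integral_comp' (f := MeasurableEquiv.prodComm) Q
  set g : Amb n → ℝ := fun x => max 0 (w x - k) with hg
  have hgm : Measurable g := by fun_prop
  have hg0 : ∀ x, 0 ≤ g x := fun x => le_max_left _ _
  -- One half of `truncation_pointwise`. When neither point is in `A` both truncations vanish, so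
  -- the cutoff differences are paid only on pairs meeting `A`; this is why the error is
  -- proportional to `μ A`.
  have hpt : ∀ z : Amb n × Amb n, (1 / 4) * (φ z.1 - φ z.2) ^ 2 +
      ((1 / 2) * (φ z.1 * g z.2) + (1 / 2) * (φ z.2 * g z.1)) ≤
      (k ^ 2 / 4 * Q z + k ^ 2 / 4 * Q z.swap) -
        (1 / 2) * ((w z.1 - w z.2) * (φ z.1 - φ z.2)) := by
    intro z
    have h1 := truncation_pointwise (a := w z.1) (b := w z.2) (hkη z.1) (hkη z.2)
    by_cases hz : z.1 ∈ A ∨ z.2 ∈ A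
    · have hQz : (η z.1 - η z.2) ^ 2 ≤ Q z + Q z.swap := by
        rcases hz with hz | hz
        · have : Q z = (η z.1 - η z.2) ^ 2 := by simp [hQ, hz]
          linarith [hQ0 z.swap]
        · have : Q z.swap = (η z.1 - η z.2) ^ 2 := by simp [hQ, hz]; ring
          linarith [hQ0 z]
      have := mul_le_mul_of_nonneg_left hQz (sq_nonneg k)
      simp only [hφ, hg]
      nlinarith
    · push Not at hz
      have h3 := hQ0 z
      have h4 := hQ0 z.swap
      rw [hφA _ hz.1, hφA _ hz.2]
      have : 0 ≤ k ^ 2 / 4 * Q z + k ^ 2 / 4 * Q z.swap := by positivity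
      simpa using this
  have hlhs : ENNReal.ofReal (1 / 4) * ∫⁻ z, ENNReal.ofReal ((φ z.1 - φ z.2) ^ 2) ∂(jump μ K) +
      ENNReal.ofReal T * ∫⁻ x, ENNReal.ofReal (φ x) ∂μ ≤
      ∫⁻ z, ENNReal.ofReal ((1 / 4) * (φ z.1 - φ z.2) ^ 2 +
      ((1 / 2) * (φ z.1 * g z.2) + (1 / 2) * (φ z.2 * g z.1))) ∂(jump μ K) := by
    have e1 : ∀ z : Amb n × Amb n, ENNReal.ofReal ((1 / 4) * (φ z.1 - φ z.2) ^ 2 +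
      ((1 / 2) * (φ z.1 * g z.2) + (1 / 2) * (φ z.2 * g z.1))) =
      ENNReal.ofReal (1 / 4) * ENNReal.ofReal ((φ z.1 - φ z.2) ^ 2) +
      (ENNReal.ofReal (1 / 2 * (φ z.1 * g z.2)) + ENNReal.ofReal (1 / 2 * (φ z.2 * g z.1))) := by
      intro z
      have := mul_nonneg (hφ0 z.1) (hg0 z.2)
      have := mul_nonneg (hφ0 z.2) (hg0 z.1)
      rw [ENNReal.ofReal_add (by positivity) (by positivity),
        ENNReal.ofReal_add (by positivity) (by positivity), ENNReal.ofReal_mul (by norm_num)]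
    simp_rw [e1]
    rw [lintegral_add_left (by fun_prop), lintegral_add_left (by fun_prop),
      lintegral_const_mul _ (by fun_prop)]
    refine add_le_add le_rfl ?_
    have e2 : ∫⁻ z : Amb n × Amb n, ENNReal.ofReal (1 / 2 * (φ z.2 * g z.1)) ∂(jump μ K) =
        ∫⁻ z : Amb n × Amb n, ENNReal.ofReal (1 / 2 * (φ z.1 * g z.2)) ∂(jump μ K) :=
      lintegral_jump_swap h (F := fun z => ENNReal.ofReal (1 / 2 * (φ z.1 * g z.2)))
        (by fun_prop)
    rw [e2, ← two_mul, ← lintegral_const_mul' (ENNReal.ofReal T) _ ENNReal.ofReal_ne_top,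
      ← lintegral_const_mul' 2 _ (by simp), lintegral_jump h.measurable (by fun_prop)]
    refine lintegral_mono_ae ?_
    filter_upwards [hT] with x hx
    by_cases hxρ : x ∈ ball 0 ρ
    · have hKx : Measurable (K x) := h.measurable.comp measurable_prodMk_left
      have e3 : ∀ y, K x y * (2 * ENNReal.ofReal (1 / 2 * (φ x * g y))) =
          ENNReal.ofReal (φ x) * (K x y * ENNReal.ofReal (w y - k)) := by
        intro y
        have e4 : ENNReal.ofReal (w y - k) = ENNReal.ofReal (g y) := by
          simp [hg, ENNReal.ofReal_max]
        rw [e4, ← ENNReal.ofReal_ofNat 2, ← ENNReal.ofReal_mul (by norm_num), ← mul_assoc 2,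
          mul_one_div_cancel two_ne_zero, one_mul, ENNReal.ofReal_mul (hφ0 x)]
        ring
      simp_rw [e3]
      rw [lintegral_const_mul _ (by fun_prop), mul_comm]
      exact mul_le_mul_right (hx hxρ) _
    · simp [hφρ x hxρ]
  refine hlhs.trans ((lintegral_mono fun z => ENNReal.ofReal_le_ofReal (hpt z)).trans ?_)
  have hint : Integrable (fun z : Amb n × Amb n => (k ^ 2 / 4 * Q z + k ^ 2 / 4 * Q z.swap) -
        (1 / 2) * ((w z.1 - w z.2) * (φ z.1 - φ z.2))) (jump μ K) :=
    ((hQi.const_mul _).add (hQs.const_mul _)).sub (hF.const_mul _)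
  rw [← ofReal_integral_eq_lintegral_ofReal hint (ae_of_all _ fun z => le_trans ?_ (hpt z))]
  swap
  · have := mul_nonneg (hφ0 z.1) (hg0 z.2)
    have := mul_nonneg (hφ0 z.2) (hg0 z.1)
    simp only [Pi.zero_apply]
    positivity
  have hsum : Integrable (fun z => k ^ 2 / 4 * Q z + k ^ 2 / 4 * Q z.swap) (jump μ K) :=
    (hQi.const_mul _).add (hQs.const_mul _)
  rw [integral_sub hsum (hF.const_mul _),
    integral_add (hQi.const_mul _) (hQs.const_mul _), integral_const_mul, integral_const_mul,
    integral_const_mul, hQse]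
  have hI : ENNReal.ofReal (∫ x, φ x ∂μ) = ∫⁻ x, ENNReal.ofReal (φ x) ∂μ :=
    ofReal_integral_eq_lintegral_ofReal hφi (ae_of_all _ hφ0)
  have hI0 : 0 ≤ ∫ x, φ x ∂μ := integral_nonneg hφ0
  have hJ : ENNReal.ofReal (∫ z, Q z ∂(jump μ K)) = ∫⁻ z, ENNReal.ofReal (Q z) ∂(jump μ K) :=
    ofReal_integral_eq_lintegral_ofReal hQi (ae_of_all _ hQ0)
  have hJ0 : 0 ≤ ∫ z, Q z ∂(jump μ K) := integral_nonneg hQ0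
  calc _ ≤ ENNReal.ofReal ((d + b₀ * k) * ∫ x, φ x ∂μ + k ^ 2 * ∫ z, Q z ∂(jump μ K)) := by
        refine ENNReal.ofReal_le_ofReal ?_
        have h5 := mul_le_mul_of_nonneg_left hwφ hb
        have h6 : 0 ≤ k ^ 2 * ∫ z, Q z ∂(jump μ K) := by positivity
        nlinarith
    _ = ENNReal.ofReal (d + b₀ * k) * ∫⁻ x, ENNReal.ofReal (φ x) ∂μ +
        ENNReal.ofReal (k ^ 2) * ∫⁻ z, ENNReal.ofReal (Q z) ∂(jump μ K) := by
        rw [ENNReal.ofReal_add (by positivity) (by positivity),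
          ENNReal.ofReal_mul (by positivity), ENNReal.ofReal_mul (by positivity), hI, hJ]
    _ ≤ _ := by
        refine add_le_add le_rfl ((mul_le_mul_right hQl _).trans (le_of_eq ?_))
        rw [← mul_assoc, ← ENNReal.ofReal_mul (by positivity)]
        congr 2; ring

end Level

end NonlocalHarnack

/-! ### De Giorgi iteration and the growth lemma. -/

namespace NonlocalHarnack

variable {n : ℕ} {s cs Cs Λ R₀ : ℝ} {μ : Measure (Amb n)} {K : Amb n → Amb n → ℝ≥0∞}

section Level

variable {R d b₀ : ℝ} {w : Amb n → ℝ}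

/-- The energy estimate between two levels and two balls. -/
theorem level_step [SFinite μ] (hP : Admissible n s cs Cs Λ)
    (h : IsJumpSpace n s cs Cs Λ R₀ μ K) (hw : IsSuper μ K R d b₀ w) (hd : 0 ≤ d) (hb : 0 ≤ b₀)
    {a b : ℝ} (ha : 0 < a) (hab : a < b) (hbR : b < 4 * R) (hbR₀ : b ≤ R₀)
    {k : ℝ} (hk : 0 ≤ k) {T : ℝ} (hTk : 2 * (d + b₀ * k) ≤ T)
    (hT : ∀ᵐ x ∂μ, x ∈ ball 0 b →
      ENNReal.ofReal T ≤ ∫⁻ y, K x y * ENNReal.ofReal (w y - k) ∂μ) :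
    ENNReal.ofReal (1 / 4) * ∫⁻ z, ENNReal.ofReal ((max 0 (k * cutoff a b z.1 - w z.1) -
        max 0 (k * cutoff a b z.2 - w z.2)) ^ 2) ∂(jump μ K) +
      ENNReal.ofReal (T / 2) * ∫⁻ x, ENNReal.ofReal (k * cutoff a b x - w x) ∂μ ≤
      ENNReal.ofReal (upConst n s Cs Λ * k ^ 2 * (b - a) ^ (-(2 * s))) *
        μ ({x | w x < k} ∩ ball 0 b) := by
  have hwm := hw.measurable
  have hη0 : ∀ x ∉ ball (0 : Amb n) b, cutoff a b x = 0 := fun x hx =>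
    cutoff_eq_zero hab (by simpa using hx)
  have hT0 : 0 ≤ T := le_trans (by positivity) hTk
  have key := level_estimate hP h hw hd hb (continuous_cutoff a b).measurable
    (sub_pos.2 hab) (by linarith) (abs_cutoff_sub_le hab) (abs_cutoff_sub_le_one a b)
    (cutoff_le_one a b) hbR hbR₀ hη0 hk hT
  set I := ∫⁻ x, ENNReal.ofReal (k * cutoff a b x - w x) ∂μ with hI
  have hIfin : I < ∞ := by
    have : ∀ x : Amb n, ENNReal.ofReal (k * cutoff a b x - w x) ≤
        (ball 0 b).indicator (fun _ => ENNReal.ofReal k) x := by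
      intro x
      by_cases hx : x ∈ ball 0 b
      · rw [indicator_of_mem hx]
        refine ENNReal.ofReal_le_ofReal ?_
        nlinarith [hw.nonneg x, cutoff_le_one a b x]
      · rw [indicator_of_notMem hx, hη0 x hx]
        simpa using hw.nonneg x
    refine (lintegral_mono this).trans_lt ?_
    rw [lintegral_indicator measurableSet_ball, setLIntegral_const]
    exact ENNReal.mul_lt_top ENNReal.ofReal_lt_top (ball_lt_top h hbR₀)
  -- Half of the `T` term absorbs the lower order terms. Cancelling it on both sides in `ℝ≥0∞`
  -- requires it to be finite.
  have hfin : ENNReal.ofReal (T / 2) * I ≠ ∞ := (ENNReal.mul_lt_top ENNReal.ofReal_lt_top hIfin).ne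
  have e : ENNReal.ofReal T * I = ENNReal.ofReal (T / 2) * I + ENNReal.ofReal (T / 2) * I := by
    rw [← add_mul, ← ENNReal.ofReal_add (by positivity) (by positivity), add_halves]
  rw [e, ← add_assoc, add_comm (ENNReal.ofReal (d + b₀ * k) * I)] at key
  have h2 : ENNReal.ofReal (d + b₀ * k) * I ≤ ENNReal.ofReal (T / 2) * I :=
    mul_le_mul_left (ENNReal.ofReal_le_ofReal (by linarith)) _
  exact (ENNReal.add_le_add_iff_right hfin).1 (key.trans (add_le_add le_rfl h2))

/-- Only the zero-order term of `level_step` is kept, with the truncation bounded below by `k - k'`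
on the inner sublevel set. The gain is a factor `1/T`, which makes the first density in the
iteration small. -/
theorem level_linear [SFinite μ] (hP : Admissible n s cs Cs Λ)
    (h : IsJumpSpace n s cs Cs Λ R₀ μ K) (hw : IsSuper μ K R d b₀ w) (hd : 0 ≤ d) (hb : 0 ≤ b₀)
    {a b : ℝ} (ha : 0 < a) (hab : a < b) (hbR : b < 4 * R) (hbR₀ : b ≤ R₀)
    {k k' : ℝ} (hk : 0 ≤ k) {T : ℝ} (hT0 : 0 ≤ T) (hTk : 2 * (d + b₀ * k) ≤ T)
    (hT : ∀ᵐ x ∂μ, x ∈ ball 0 b →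
      ENNReal.ofReal T ≤ ∫⁻ y, K x y * ENNReal.ofReal (w y - k) ∂μ) :
    ENNReal.ofReal (T / 2 * (k - k')) * μ ({x | w x < k'} ∩ ball 0 a) ≤
      ENNReal.ofReal (upConst n s Cs Λ * k ^ 2 * (b - a) ^ (-(2 * s))) *
        μ ({x | w x < k} ∩ ball 0 b) := by
  refine le_trans ?_ (level_step hP h hw hd hb ha hab hbR hbR₀ hk hTk hT)
  refine le_trans ?_ le_add_self
  rw [ENNReal.ofReal_mul (by positivity), mul_assoc]
  refine mul_le_mul_right ?_ _
  have hwm := hw.measurable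
  have hm : MeasurableSet ({x | w x < k'} ∩ ball (0 : Amb n) a) :=
    (measurableSet_lt hwm measurable_const).inter measurableSet_ball
  rw [← setLIntegral_const]
  refine (setLIntegral_mono' hm fun x hx => ENNReal.ofReal_le_ofReal ?_).trans
    (setLIntegral_le_lintegral _ _)
  rw [cutoff_eq_one hab (by simpa using (mem_ball_zero_iff.1 hx.2).le)]
  have : w x < k' := hx.1
  linarith

/-- Only the energy term of `level_step` is kept. The truncation vanishes off `A`, so Faber-Krahn
with weight `φ²` applies and raises the measure of the larger sublevel set to the power `1 + γ`. -/
theorem level_superlinear [SFinite μ] (hP : Admissible n s cs Cs Λ)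
    (h : IsJumpSpace n s cs Cs Λ R₀ μ K) (hw : IsSuper μ K R d b₀ w) (hd : 0 ≤ d) (hb : 0 ≤ b₀)
    {γ : ℝ} (hγ : γ ≤ 2 * s / n)
    {a b r : ℝ} (ha : 0 < a) (hab : a < b) (hbR : b < 4 * R) (hr : 0 < r) (hrR₀ : 3 * r ≤ R₀)
    (hbr : b ≤ 2 * r) {k k' : ℝ} (hk : 0 ≤ k) (hkk : k' ≤ k) {T : ℝ} (hTk : 2 * (d + b₀ * k) ≤ T)
    (hT : ∀ᵐ x ∂μ, x ∈ ball 0 b →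
      ENNReal.ofReal T ≤ ∫⁻ y, K x y * ENNReal.ofReal (w y - k) ∂μ)
    (hsmall : μ ({x | w x < k} ∩ ball 0 b) ≤ ENNReal.ofReal (cs / 2 * r ^ n)) :
    ENNReal.ofReal ((k - k') ^ 2) * μ ({x | w x < k'} ∩ ball 0 a) ≤
      ENNReal.ofReal (2 * Λ / cs * r ^ (2 * s) *
        (2 * μ.real ({x | w x < k} ∩ ball 0 b) / (cs * r ^ n)) ^ γ) *
      (4 * (ENNReal.ofReal (upConst n s Cs Λ * k ^ 2 * (b - a) ^ (-(2 * s))) *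
        μ ({x | w x < k} ∩ ball 0 b))) := by
  have hwm := hw.measurable
  have hcm : Measurable (cutoff (n := n) a b) := (continuous_cutoff a b).measurable
  set A : Set (Amb n) := {x | w x < k} ∩ ball 0 b with hA
  have hAm : MeasurableSet A := (measurableSet_lt hwm measurable_const).inter measurableSet_ball
  have hm : MeasurableSet ({x | w x < k'} ∩ ball (0 : Amb n) a) :=
    (measurableSet_lt hwm measurable_const).inter measurableSet_ball
  set φ : Amb n → ℝ := fun x => max 0 (k * cutoff a b x - w x) with hφ
  have hφm : Measurable φ := by fun_prop
  have hφA : ∀ x ∉ A, φ x = 0 := by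
    intro x hx
    refine max_eq_left ?_
    by_contra hcon
    push Not at hcon
    refine hx ⟨show w x < k by nlinarith [cutoff_le_one a b x], ?_⟩
    by_contra hxb
    rw [cutoff_eq_zero hab (by simpa using hxb)] at hcon
    linarith [hw.nonneg x]
  have hE := le_self_add.trans
    (level_step hP h hw hd hb ha hab hbR (by linarith) hk hTk hT)
  have hFK := faber_krahn hP h hγ hr hrR₀ hAm
    (inter_subset_right.trans (ball_subset_ball hbr)) hsmall
    (g := fun x => ENNReal.ofReal (φ x ^ 2)) (by fun_prop)
  have h1 : ENNReal.ofReal ((k - k') ^ 2) * μ ({x | w x < k'} ∩ ball 0 a) ≤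
      ∫⁻ x in A, ENNReal.ofReal (φ x ^ 2) ∂μ := by
    rw [← setLIntegral_const]
    refine (setLIntegral_mono' hm fun x hx => ENNReal.ofReal_le_ofReal ?_).trans
      (lintegral_mono_set ?_)
    · have h1 : cutoff a b x = 1 := cutoff_eq_one hab (by simpa using (mem_ball_zero_iff.1 hx.2).le)
      have h2 : w x < k' := hx.1
      have h3 : k - w x ≤ φ x := by simp only [hφ, h1, mul_one]; exact le_max_right _ _
      exact pow_le_pow_left₀ (by linarith) (by linarith) 2
    · intro x hx
      have h2 : w x < k' := hx.1
      exact ⟨show w x < k by linarith, ball_subset_ball hab.le hx.2⟩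
  refine h1.trans (hFK.trans (mul_le_mul_right ?_ _))
  have h2 : ∫⁻ z in A ×ˢ Aᶜ, ENNReal.ofReal (φ z.1 ^ 2) ∂(jump μ K) ≤
      ∫⁻ z, ENNReal.ofReal ((φ z.1 - φ z.2) ^ 2) ∂(jump μ K) := by
    refine (setLIntegral_mono' (hAm.prod hAm.compl) fun z hz => ?_).trans
      (setLIntegral_le_lintegral _ _)
    rw [hφA z.2 hz.2, sub_zero]
  refine h2.trans ?_
  calc _ = 4 * (ENNReal.ofReal (1 / 4) *
        ∫⁻ z, ENNReal.ofReal ((φ z.1 - φ z.2) ^ 2) ∂(jump μ K)) := by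
        rw [← mul_assoc, ← ENNReal.ofReal_ofNat 4, ← ENNReal.ofReal_mul (by norm_num)]
        norm_num
    _ ≤ _ := mul_le_mul_right hE _

end Level

/-- Fast geometric convergence. -/
theorem geometric_decay {y : ℕ → ℝ} {C γ Y : ℝ} (hC : 0 < C) (hγ : 0 < γ) (hY : 0 < Y)
    (hy0 : ∀ j, 0 ≤ y j) (hy : y 0 ≤ Y)
    (hstep : ∀ j, y j ≤ Y → y (j + 1) ≤ C * 16 ^ j * y j ^ (1 + γ))
    (hCY : C * Y ^ γ ≤ 16 ^ (-(1 / γ))) (j : ℕ) : y j ≤ Y * (16 ^ (-(1 / γ))) ^ j := by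
  set q : ℝ := 16 ^ (-(1 / γ)) with hq
  have hq0 : 0 < q := by positivity
  have hq1 : q ≤ 1 := Real.rpow_le_one_of_one_le_of_nonpos (by norm_num)
    (by rw [neg_nonpos]; positivity)
  -- The ratio `q` is chosen so that the extra power `γ` cancels the factor `16 ^ j`.
  have hqγ : q ^ γ = 16⁻¹ := by
    rw [hq, ← Real.rpow_mul (by norm_num), neg_mul, one_div_mul_cancel hγ.ne', Real.rpow_neg_one]
  induction j with
  | zero => simpa using hy
  | succ j ih =>
    have hle : y j ≤ Y := ih.trans (mul_le_of_le_one_right hY.le (pow_le_one₀ hq0.le hq1))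
    calc y (j + 1) ≤ C * 16 ^ j * y j ^ (1 + γ) := hstep j hle
      _ ≤ C * 16 ^ j * (Y * q ^ j) ^ (1 + γ) := by
          gcongr
          exact hy0 j
      _ = C * Y ^ γ * (Y * q ^ j) := by
          have e1 : (q ^ j) ^ γ = (16⁻¹) ^ j := by
            rw [← hqγ, ← Real.rpow_natCast, ← Real.rpow_natCast, ← Real.rpow_mul hq0.le,
              ← Real.rpow_mul hq0.le, mul_comm]
          rw [Real.rpow_add (by positivity), Real.rpow_one, Real.mul_rpow (by positivity)
            (by positivity), e1, inv_pow]
          field_simp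
      _ ≤ q * (Y * q ^ j) := by gcongr
      _ = Y * q ^ (j + 1) := by ring

/-- The exponent gained in the Faber-Krahn inequality. -/
noncomputable def gam (n : ℕ) (s : ℝ) : ℝ := min (2 * s / n) (1 / 2)

theorem gam_pos (hP : Admissible n s cs Cs Λ) : 0 < gam n s := by
  have hn : 0 < (n : ℝ) := by exact_mod_cast hP.one_le
  have := hP.half_lt
  exact lt_min (by positivity) (by norm_num)

/-- The growth lemma: if the nonlocal mass above level `k` seen from the ball of radius `2r` is
large with respect to `k`, then `w ≥ k / 2` in the ball of radius `r`. -/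
theorem growth_lemma (hP : Admissible n s cs Cs Λ) : ∃ A₀ : ℝ, 0 < A₀ ∧
    ∀ (R₀ : ℝ) (μ : Measure (Amb n)) (K : Amb n → Amb n → ℝ≥0∞) (R d b₀ : ℝ) (w : Amb n → ℝ)
      (r k T : ℝ), SFinite μ → IsJumpSpace n s cs Cs Λ R₀ μ K → IsSuper μ K R d b₀ w →
      0 ≤ d → 0 ≤ b₀ → 0 < r → 2 * r < 4 * R → 3 * r ≤ R₀ → 0 < k →
      A₀ * k * r ^ (-(2 * s)) ≤ T → 2 * (d + b₀ * k) ≤ T →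
      (∀ᵐ x ∂μ, x ∈ ball 0 (2 * r) →
        ENNReal.ofReal T ≤ ∫⁻ y, K x y * ENNReal.ofReal (w y - k) ∂μ) →
      ∀ᵐ x ∂μ, x ∈ ball 0 r → k / 2 ≤ w x := by
  have hγ := gam_pos hP
  set γ := gam n s with hγdef
  have hγn : γ ≤ 2 * s / n := min_le_left _ _
  have hUC := upConst_pos hP
  have hcs := hP.cs_pos
  have hCs : 0 < Cs := hcs.trans_le hP.cs_le
  have hΛ : 0 < Λ := by linarith [hP.one_le_Λ]
  set U := upConst n s Cs Λ with hU
  -- Here `2 ^ 12 = 64 * 4 * 16`: the squared level gap contributes `64`, the coefficient `1/4` of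
  -- the energy contributes `4`, and the radius gap at index `j + 1` contributes `16`, apart from
  -- the powers of `j`.
  set C₁ : ℝ := 2 ^ 12 * (2 * Λ / cs) * (2 / cs) ^ γ * U with hC₁
  have hC₁0 : 0 < C₁ := by positivity
  -- The first bound is the density condition of `faber_krahn`, the second the starting smallness
  -- required by `geometric_decay`.
  set Y : ℝ := min (cs / 2) ((16 ^ (-(1 / γ)) / C₁) ^ (1 / γ)) with hYdef
  have hY : 0 < Y := lt_min (by positivity) (by positivity)
  have hCY : C₁ * Y ^ γ ≤ 16 ^ (-(1 / γ)) := by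
    have h1 : Y ^ γ ≤ ((16 ^ (-(1 / γ)) / C₁) ^ (1 / γ)) ^ γ :=
      Real.rpow_le_rpow hY.le (min_le_right _ _) hγ.le
    rw [← Real.rpow_mul (by positivity), one_div_mul_cancel hγ.ne', Real.rpow_one,
      le_div_iff₀ hC₁0] at h1
    linarith
  -- This is the size of `T` at which `level_linear`, from `A 0` to `A 1`, brings the density down
  -- to `Y`.
  refine ⟨32 * 2 ^ n * U * Cs / Y, by positivity, ?_⟩
  intro R₀ μ K R d b₀ w r k T _ h hw hd hb hr hrR hrR₀ hk hAT hTk hT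
  have hwm := hw.measurable
  have hT0 : 0 < T := lt_of_lt_of_le (by positivity) hAT
  set kk : ℕ → ℝ := fun j => k / 2 * (1 + (1 / 2) ^ j) with hkk
  set rr : ℕ → ℝ := fun j => r * (1 + (1 / 2) ^ j) with hrr
  set A : ℕ → Set (Amb n) := fun j => {x | w x < kk j} ∩ ball 0 (rr j) with hA
  have hp0 : ∀ j : ℕ, (0 : ℝ) < (1 / 2) ^ j := fun j => by positivity
  have hp1 : ∀ j : ℕ, (1 / 2 : ℝ) ^ j ≤ 1 := fun j => pow_le_one₀ (by norm_num) (by norm_num)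
  have hkk0 : ∀ j, 0 ≤ kk j := fun j => by have := hp0 j; simp only [hkk]; positivity
  have hkkk : ∀ j, kk j ≤ k := fun j => by have := hp1 j; simp only [hkk]; nlinarith
  have hrr0 : ∀ j, 0 < rr j := fun j => by have := hp0 j; simp only [hrr]; positivity
  have hrr2 : ∀ j, rr j ≤ 2 * r := fun j => by have := hp1 j; simp only [hrr]; nlinarith
  have hkd : ∀ j, kk j - kk (j + 1) = k / 4 * (1 / 2) ^ j := fun j => by
    simp only [hkk, pow_succ]; ring
  have hrd : ∀ j, rr j - rr (j + 1) = r / 2 * (1 / 2) ^ j := fun j => by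
    simp only [hrr, pow_succ]; ring
  have hrlt : ∀ j, rr (j + 1) < rr j := fun j => by
    have := hrd j; have := hp0 j; nlinarith [mul_pos hr (hp0 j)]
  have hTj : ∀ j, ∀ᵐ x ∂μ, x ∈ ball 0 (rr j) →
      ENNReal.ofReal T ≤ ∫⁻ y, K x y * ENNReal.ofReal (w y - kk j) ∂μ := by
    intro j
    filter_upwards [hT] with x hx hxb
    refine (hx (ball_subset_ball (hrr2 j) hxb)).trans (lintegral_mono fun y => ?_)
    exact mul_le_mul_right (ENNReal.ofReal_le_ofReal (by linarith [hkkk j])) _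
  have hTkj : ∀ j, 2 * (d + b₀ * kk j) ≤ T := fun j => by
    have := mul_le_mul_of_nonneg_left (hkkk j) hb
    linarith
  have hfin : ∀ j, μ (A j) < ∞ := fun j => (measure_mono inter_subset_right).trans_lt
    (ball_lt_top h ((hrr2 j).trans (by linarith)))
  have hreal : ∀ j, μ (A j) = ENNReal.ofReal (μ.real (A j)) := fun j =>
    (ENNReal.ofReal_toReal (hfin j).ne).symm
  have hpow : ∀ j, U * kk j ^ 2 * (rr j - rr (j + 1)) ^ (-(2 * s)) ≤
      U * k ^ 2 * r ^ (-(2 * s)) * 4 ^ (j + 1) := by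
    intro j
    have e1 : (rr j - rr (j + 1)) = r * (2 ^ (j + 1))⁻¹ := by
      rw [hrd, pow_succ, one_div, inv_pow]; field_simp
    have e2 : ((2 : ℝ) ^ (j + 1))⁻¹ ^ (-(2 * s)) ≤ 4 ^ (j + 1) := by
      rw [Real.inv_rpow (by positivity), Real.rpow_neg (by positivity), inv_inv]
      calc ((2 : ℝ) ^ (j + 1)) ^ (2 * s) ≤ ((2 : ℝ) ^ (j + 1)) ^ (2 : ℝ) :=
            Real.rpow_le_rpow_of_exponent_le (one_le_pow₀ (by norm_num)) (by linarith [hP.lt_one])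
        _ = 4 ^ (j + 1) := by rw [Real.rpow_two, ← pow_mul, mul_comm, pow_mul]; norm_num
    rw [e1, Real.mul_rpow hr.le (by positivity), ← mul_assoc]
    have := hkk0 j
    gcongr
    exact hkkk j
  have hrs : r ^ (-(2 * s)) * r ^ (2 * s) = 1 := by
    rw [← Real.rpow_add hr]; simp
  -- The index is shifted by one: the linear step from `A 0` to `A 1` supplies `y 0 ≤ Y`, and all
  -- later steps are superlinear.
  set y : ℕ → ℝ := fun j => μ.real (A (j + 1)) / r ^ n with hy
  have hrn : 0 < r ^ n := by positivity
  have hy0 : y 0 ≤ Y := by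
    have h1 := level_linear hP h hw hd hb (hrr0 1) (hrlt 0) ((hrr2 0).trans_lt hrR)
      ((hrr2 0).trans (by linarith)) (hkk0 0) (k' := kk 1) hT0.le (hTkj 0) (hTj 0)
    have h2 : μ ({x | w x < kk 0} ∩ ball 0 (rr 0)) ≤ ENNReal.ofReal (Cs * (2 * r) ^ n) :=
      (measure_mono (inter_subset_right.trans (ball_subset_ball (hrr2 0)))).trans
        (h.upper_zero _ (by positivity) (by linarith))
    have h3 := h1.trans (mul_le_mul' (ENNReal.ofReal_le_ofReal (hpow 0)) h2)
    rw [show ({x | w x < kk 1} ∩ ball 0 (rr 1)) = A 1 from rfl, hreal 1, hkd 0,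
      ← ENNReal.ofReal_mul (by positivity), ← ENNReal.ofReal_mul (by positivity),
      ENNReal.ofReal_le_ofReal_iff (by positivity), mul_pow] at h3
    simp only [hy]
    rw [div_le_iff₀ hrn]
    have h4 : 32 * 2 ^ n * U * Cs * k * r ^ (-(2 * s)) ≤ T * Y := by
      rw [div_mul_eq_mul_div, div_mul_eq_mul_div, div_le_iff₀ hY] at hAT
      exact hAT
    have h5 : T * k * μ.real (A 1) ≤ T * k * (Y * r ^ n) := by
      have := mul_le_mul_of_nonneg_right h4 (by positivity : 0 ≤ k * r ^ n)
      simp only [pow_zero, mul_one, zero_add, pow_one] at h3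
      nlinarith
    exact le_of_mul_le_mul_left h5 (by positivity)
  have hstep : ∀ j, y j ≤ Y → y (j + 1) ≤ C₁ * 16 ^ j * y j ^ (1 + γ) := by
    intro j hj
    have hmr : μ.real (A (j + 1)) = y j * r ^ n := by simp only [hy]; field_simp
    have hmr' : μ.real (A (j + 2)) = y (j + 1) * r ^ n := by simp only [hy]; field_simp
    have hyj : 0 ≤ y j := by simp only [hy]; positivity
    have hsm : μ (A (j + 1)) ≤ ENNReal.ofReal (cs / 2 * r ^ n) := by
      rw [hreal, hmr]
      refine ENNReal.ofReal_le_ofReal ?_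
      gcongr
      exact hj.trans (min_le_left _ _)
    have h1 := level_superlinear hP h hw hd hb hγn (hrr0 (j + 2)) (hrlt (j + 1))
      ((hrr2 (j + 1)).trans_lt hrR) hr hrR₀ (hrr2 (j + 1)) (hkk0 (j + 1)) (k' := kk (j + 2))
      (by have := hkd (j + 1); have := hp0 (j + 1); nlinarith [mul_pos hk (hp0 (j + 1))])
      (hTkj (j + 1)) (hTj (j + 1)) hsm
    rw [show ({x | w x < kk (j + 1)} ∩ ball 0 (rr (j + 1))) = A (j + 1) from rfl,
      show ({x | w x < kk (j + 2)} ∩ ball 0 (rr (j + 2))) = A (j + 2) from rfl] at h1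
    have h2 := h1.trans (mul_le_mul_right (mul_le_mul_right (mul_le_mul_left
      (ENNReal.ofReal_le_ofReal (hpow (j + 1))) _) _) _)
    rw [hreal (j + 1), hreal (j + 2), hkd (j + 1), hmr, hmr', ← ENNReal.ofReal_ofNat 4,
      ← ENNReal.ofReal_mul (by positivity), ← ENNReal.ofReal_mul (by positivity),
      ← ENNReal.ofReal_mul (by positivity), ← ENNReal.ofReal_mul (by positivity),
      ENNReal.ofReal_le_ofReal_iff (by positivity)] at h2
    have e1 : 2 * (y j * r ^ n) / (cs * r ^ n) = 2 / cs * y j := by field_simp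
    rw [e1, Real.mul_rpow (by positivity) hyj] at h2
    rw [Real.rpow_add' hyj (by positivity), Real.rpow_one]
    have e2 : (k / 4 * (1 / 2) ^ (j + 1)) ^ 2 = k ^ 2 / 64 / 4 ^ j := by
      have : ((1 / 2 : ℝ) ^ (j + 1)) ^ 2 = 1 / 4 / 4 ^ j := by
        rw [← pow_mul, mul_comm (j + 1) 2, pow_mul, pow_succ, div_pow, one_div, div_pow, one_pow]
        norm_num
        ring
      rw [mul_pow, this]
      ring
    rw [e2] at h2
    -- One factor `4 ^ j` comes from the squared level gaps, the other from the radius gaps.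
    have e3 : (16 : ℝ) ^ j = 4 ^ j * 4 ^ j := by rw [← mul_pow]; norm_num
    have h3 : (k ^ 2 / 64 / 4 ^ j * r ^ n) * y (j + 1) ≤
        (k ^ 2 / 64 / 4 ^ j * r ^ n) * (C₁ * 16 ^ j * (y j * y j ^ γ)) := by
      calc _ = k ^ 2 / 64 / 4 ^ j * (y (j + 1) * r ^ n) := by ring
        _ ≤ _ := h2
        _ = (r ^ (-(2 * s)) * r ^ (2 * s)) * (2 * Λ / cs * ((2 / cs) ^ γ * y j ^ γ) *
            (4 * (U * k ^ 2 * 4 ^ (j + 1 + 1) * (y j * r ^ n)))) := by ring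
        _ = _ := by
          rw [hrs, e3, hC₁, pow_succ, pow_succ]
          field_simp
          ring
    exact le_of_mul_le_mul_left h3 (by positivity)
  have hdecay := geometric_decay hC₁0 hγ hY (fun j => by simp only [hy]; positivity) hy0 hstep hCY
  have hq1 : (16 : ℝ) ^ (-(1 / γ)) < 1 := Real.rpow_lt_one_of_one_lt_of_neg (by norm_num)
    (by rw [neg_lt_zero]; positivity)
  have hlim : Tendsto (fun j : ℕ => ENNReal.ofReal (Y * (16 ^ (-(1 / γ))) ^ j * r ^ n)) atTop
      (𝓝 0) := by
    have h1 := ((tendsto_pow_atTop_nhds_zero_of_lt_one (by positivity) hq1).const_mul Y).mul_const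
      (r ^ n)
    have := (ENNReal.continuous_ofReal.tendsto _).comp h1
    simpa [Function.comp_def] using this
  have hzero : μ ({x | w x < k / 2} ∩ ball 0 r) = 0 := by
    refine le_antisymm (ge_of_tendsto' hlim fun j => ?_) bot_le
    calc μ ({x | w x < k / 2} ∩ ball 0 r) ≤ μ (A (j + 1)) := by
          refine measure_mono ?_
          intro x hx
          have h1 : w x < k / 2 := hx.1
          have := hp0 (j + 1)
          refine ⟨show w x < k / 2 * (1 + (1 / 2) ^ (j + 1)) by nlinarith, ?_⟩
          refine ball_subset_ball ?_ hx.2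
          simp only [hrr]
          nlinarith
      _ = ENNReal.ofReal (μ.real (A (j + 1))) := hreal _
      _ ≤ _ := by
          refine ENNReal.ofReal_le_ofReal ?_
          rw [← div_le_iff₀ hrn]
          exact hdecay j
  rw [ae_iff]
  refine measure_mono_null ?_ hzero
  intro x hx
  have hx' : ¬ (x ∈ ball 0 r → k / 2 ≤ w x) := hx
  push Not at hx'
  exact ⟨hx'.2, hx'.1⟩

end NonlocalHarnack

/-! ### Lower bounds from local and from distant mass. -/

namespace NonlocalHarnack

variable {n : ℕ} {s cs Cs Λ : ℝ}

theorem le_essInf_of_ae_le' {α : Type*} [MeasurableSpace α] {ν : Measure α} {f : α → ℝ≥0∞}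
    {c : ℝ≥0∞} (h : ∀ᵐ x ∂ν, c ≤ f x) : c ≤ essInf f ν :=
  le_sSup_of_le (b := c) (by simpa using h) le_rfl

/-- Subtracting a level `k` from `w` costs at most `k D r^{-2s}` of the mass `J`, so a level
proportional to `r^{2s} J` keeps half of it and `growth_lemma` applies. The source of the mass is
left open: `mean_le` takes it from `B_{2R}`, `tail_le` from the complement of `B_R`. -/
theorem growth_of_mass (hP : Admissible n s cs Cs Λ) {D bs : ℝ} (hD : 0 ≤ D) (hbs : 0 ≤ bs) :
    ∃ c : ℝ, 0 < c ∧
    ∀ (R₀ : ℝ) (μ : Measure (Amb n)) (K : Amb n → Amb n → ℝ≥0∞) (R d b₀ : ℝ) (w : Amb n → ℝ)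
      (r J : ℝ), SFinite μ → IsJumpSpace n s cs Cs Λ R₀ μ K → IsSuper μ K R d b₀ w →
      0 ≤ d → 0 ≤ b₀ → 0 < r → 2 * r < 4 * R → 3 * r ≤ R₀ → b₀ ≤ bs * r ^ (-(2 * s)) → 0 ≤ J →
      (∀ k : ℝ, 0 < k → ∀ᵐ x ∂μ, x ∈ ball 0 (2 * r) →
        ENNReal.ofReal (J - k * D * r ^ (-(2 * s))) ≤
          ∫⁻ y, K x y * ENNReal.ofReal (w y - k) ∂μ) →
      ENNReal.ofReal (c * r ^ (2 * s) * J) ≤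
        essInf (fun x => ENNReal.ofReal (w x)) (μ.restrict (ball 0 r)) +
          ENNReal.ofReal (r ^ (2 * s) * d) := by
  obtain ⟨A₀, hA₀, hgrow⟩ := growth_lemma hP
  -- In order: the loss of mass is at most `J / 2`, the threshold of `growth_lemma` is at most `J /
  -- 2`, and `b₀ * k ≤ J / 8`.
  set c : ℝ := min (1 / (2 * (D + 1))) (min (1 / (2 * A₀)) (1 / (8 * (bs + 1)))) with hc
  have hc0 : 0 < c := lt_min (by positivity) (lt_min (by positivity) (by positivity))
  have hc1 : c * (2 * (D + 1)) ≤ 1 := (le_div_iff₀ (by positivity)).1 (min_le_left _ _)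
  have hc2 : c * (2 * A₀) ≤ 1 :=
    (le_div_iff₀ (by positivity)).1 ((min_le_right _ _).trans (min_le_left _ _))
  have hc3 : c * (8 * (bs + 1)) ≤ 1 :=
    (le_div_iff₀ (by positivity)).1 ((min_le_right _ _).trans (min_le_right _ _))
  refine ⟨min (c / 2) (1 / 8), lt_min (by positivity) (by norm_num), ?_⟩
  intro R₀ μ K R d b₀ w r J _ h hw hd hb hr hrR hrR₀ hbb hJ hmass
  have hr2 : 0 < r ^ (2 * s) := by positivity
  have hrm : 0 < r ^ (-(2 * s)) := by positivity
  have hrr : r ^ (2 * s) * r ^ (-(2 * s)) = 1 := by rw [← Real.rpow_add hr]; simp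
  rcases hJ.eq_or_lt with hJ0 | hJ0
  · simp [← hJ0]
  -- When `d` exceeds `J / 8`, the term `r ^ (2 * s) * d` alone is large enough.
  rcases lt_or_ge (J / 8) d with hdJ | hdJ
  · refine le_trans (ENNReal.ofReal_le_ofReal ?_) le_add_self
    have : min (c / 2) (1 / 8) ≤ 1 / 8 := min_le_right _ _
    calc min (c / 2) (1 / 8) * r ^ (2 * s) * J ≤ 1 / 8 * r ^ (2 * s) * J := by gcongr
      _ = r ^ (2 * s) * (J / 8) := by ring
      _ ≤ _ := by gcongr
  · refine le_trans ?_ le_self_add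
    set k : ℝ := c * r ^ (2 * s) * J with hk
    have hk0 : 0 < k := by positivity
    have hkr : k * r ^ (-(2 * s)) = c * J := by
      rw [hk]; linear_combination c * J * hrr
    have hbk : b₀ * k ≤ J / 8 := by
      calc b₀ * k ≤ bs * r ^ (-(2 * s)) * k := by gcongr
        _ = bs * (k * r ^ (-(2 * s))) := by ring
        _ ≤ J / 8 := by rw [hkr]; nlinarith
    have := hgrow R₀ μ K R d b₀ w r k (J / 2) inferInstance h hw hd hb hr hrR hrR₀ hk0
      (by rw [mul_assoc, hkr]; nlinarith) (by linarith) (by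
        filter_upwards [hmass k hk0] with x hx hxb
        refine le_trans (ENNReal.ofReal_le_ofReal ?_) (hx hxb)
        have : k * D * r ^ (-(2 * s)) = D * (k * r ^ (-(2 * s))) := by ring
        rw [this, hkr]
        nlinarith)
    refine le_essInf_of_ae_le' ?_
    rw [ae_restrict_iff' measurableSet_ball]
    filter_upwards [this] with x hx hxb
    refine ENNReal.ofReal_le_ofReal (le_trans ?_ (hx hxb))
    have : min (c / 2) (1 / 8) ≤ c / 2 := min_le_left _ _
    calc min (c / 2) (1 / 8) * r ^ (2 * s) * J ≤ c / 2 * r ^ (2 * s) * J := by gcongr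
      _ = k / 2 := by rw [hk]; ring

theorem ofReal_sub_le_lintegral {α : Type*} [MeasurableSpace α] {ν : Measure α} {S : Set α}
    {F : α → ℝ≥0∞} {w : α → ℝ} (hF : Measurable F) (hw : Measurable w)
    {J k D : ℝ} (hk : 0 ≤ k) (hD : 0 ≤ D)
    (h1 : ENNReal.ofReal J ≤ ∫⁻ y in S, F y * ENNReal.ofReal (w y) ∂ν)
    (h2 : ∫⁻ y in S, F y ∂ν ≤ ENNReal.ofReal D) :
    ENNReal.ofReal (J - k * D) ≤ ∫⁻ y in S, F y * ENNReal.ofReal (w y - k) ∂ν := by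
  rw [ENNReal.ofReal_sub _ (by positivity), tsub_le_iff_right]
  refine h1.trans ?_
  calc ∫⁻ y in S, F y * ENNReal.ofReal (w y) ∂ν
      ≤ ∫⁻ y in S, (F y * ENNReal.ofReal (w y - k) + ENNReal.ofReal k * F y) ∂ν := by
        refine lintegral_mono fun y => ?_
        rw [mul_comm (ENNReal.ofReal k), ← mul_add]
        refine mul_le_mul_right ?_ _
        refine (ENNReal.ofReal_le_ofReal (by linarith : w y ≤ (w y - k) + k)).trans
          ENNReal.ofReal_add_le
    _ = ∫⁻ y in S, F y * ENNReal.ofReal (w y - k) ∂ν + ENNReal.ofReal k * ∫⁻ y in S, F y ∂ν := by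
        rw [lintegral_add_left (by fun_prop), lintegral_const_mul _ hF]
    _ ≤ _ := by
        rw [ENNReal.ofReal_mul hk]
        gcongr

/-- The weak Harnack inequality for the mean value. -/
theorem mean_le (hP : Admissible n s cs Cs Λ) {bs : ℝ} (hbs : 0 ≤ bs) :
    ∃ C : ℝ, 0 < C ∧
    ∀ (R₀ : ℝ) (μ : Measure (Amb n)) (K : Amb n → Amb n → ℝ≥0∞) (R d b₀ : ℝ) (w : Amb n → ℝ),
      SFinite μ → IsJumpSpace n s cs Cs Λ R₀ μ K → IsSuper μ K R d b₀ w →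
      0 ≤ d → 0 ≤ b₀ → 0 < R → 4 * R ≤ R₀ → b₀ ≤ bs * R ^ (-(2 * s)) →
      ∫⁻ x in ball 0 (2 * R), ENNReal.ofReal (w x) ∂μ ≤ ENNReal.ofReal (C * R ^ n) *
        (essInf (fun x => ENNReal.ofReal (w x)) (μ.restrict (ball 0 R)) +
          ENNReal.ofReal (R ^ (2 * s) * d)) := by
  have hΛ : 0 < Λ := by linarith [hP.one_le_Λ]
  have hCs : 0 < Cs := hP.cs_pos.trans_le hP.cs_le
  have hs : 0 < s := by linarith [hP.half_lt]
  -- Points of `B_{2R}` are less than `4R ≤ R₀` apart, so the kernel between them is at least `κ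
  -- R^{-n-2s}`. The integral of `w` over `B_{2R}` is therefore a mass seen from every point of that
  -- ball.
  set κ : ℝ := Λ⁻¹ * 4 ^ (-((n : ℝ) + 2 * s)) with hκ
  have hκ0 : 0 < κ := by positivity
  obtain ⟨c, hc, hgrow⟩ := growth_of_mass hP (D := κ * (Cs * 2 ^ n)) (bs := bs)
    (by positivity) hbs
  refine ⟨1 / (c * κ), by positivity, ?_⟩
  intro R₀ μ K R d b₀ w _ h hw hd hb hR hRR hbb
  have hwm := hw.measurable
  have hR2 : 2 * R ≤ R₀ := by linarith
  set I := ∫⁻ x in ball 0 (2 * R), ENNReal.ofReal (w x) ∂μ with hI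
  have hIfin : I < ∞ := by
    calc I ≤ ∫⁻ x in ball 0 (2 * R), (1 + ENNReal.ofReal (w x ^ 2)) ∂μ := by
          refine lintegral_mono fun x => ?_
          rw [← ENNReal.ofReal_one, ← ENNReal.ofReal_add zero_le_one (sq_nonneg _)]
          exact ENNReal.ofReal_le_ofReal (by nlinarith [sq_nonneg (w x - 1)])
      _ < ∞ := by
          rw [lintegral_add_left measurable_const, setLIntegral_const, one_mul]
          exact ENNReal.add_lt_top.2 ⟨ball_lt_top h hR2, hw.sq_lt_top _ (by linarith)⟩
  have hIr : I = ENNReal.ofReal I.toReal := (ENNReal.ofReal_toReal hIfin.ne).symm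
  have hI0 : 0 ≤ I.toReal := ENNReal.toReal_nonneg
  have hRn : (4 * R) ^ (-((n : ℝ) + 2 * s)) =
      4 ^ (-((n : ℝ) + 2 * s)) * (R ^ n)⁻¹ * R ^ (-(2 * s)) := by
    rw [Real.mul_rpow (by norm_num) hR.le, neg_add, Real.rpow_add hR, Real.rpow_neg hR.le n,
      Real.rpow_natCast, mul_assoc]
  have key := hgrow R₀ μ K R d b₀ w R (κ * (R ^ n)⁻¹ * R ^ (-(2 * s)) * I.toReal) inferInstance
    h hw hd hb hR (by linarith) (by linarith) hbb (by positivity) ?_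
  · have hrr : R ^ (2 * s) * R ^ (-(2 * s)) = 1 := by rw [← Real.rpow_add hR]; simp
    have e : c * R ^ (2 * s) * (κ * (R ^ n)⁻¹ * R ^ (-(2 * s)) * I.toReal) =
        c * κ * (R ^ n)⁻¹ * I.toReal := by
      linear_combination c * κ * (R ^ n)⁻¹ * I.toReal * hrr
    rw [e] at key
    refine le_trans (le_of_eq ?_) (mul_le_mul_right key _)
    rw [← ENNReal.ofReal_mul (by positivity), hIr]
    congr 1
    rw [ENNReal.toReal_ofReal hI0]
    field_simp
  · intro k hk
    filter_upwards [Measure.ae_ae_of_ae_prod h.lower] with x hx hxb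
    set m : ℝ := κ * (R ^ n)⁻¹ * R ^ (-(2 * s)) with hm
    have hm0 : 0 < m := by positivity
    have hK : ∀ᵐ y ∂(μ.restrict (ball 0 (2 * R))), ENNReal.ofReal m ≤ K x y := by
      rw [ae_restrict_iff' measurableSet_ball]
      filter_upwards [hx] with y hy hyb
      rw [mem_ball_zero_iff] at hxb hyb
      have hd : dist x y < 4 * R := by
        rw [dist_eq_norm]; have := norm_sub_le x y; linarith
      refine le_trans ?_ (hy (by linarith))
      rw [hm, hκ, mul_assoc, mul_assoc, ← mul_assoc (4 ^ (-((n : ℝ) + 2 * s)) : ℝ), ← hRn,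
        ENNReal.ofReal_mul (by positivity), Real.rpow_neg (by positivity), div_eq_mul_inv,
        ENNReal.ofReal_inv_of_pos (by positivity : 0 < (4 * R) ^ ((n : ℝ) + 2 * s)),
        ← ENNReal.ofReal_rpow_of_pos (by positivity)]
      gcongr
      rw [edist_dist]
      exact ENNReal.ofReal_le_ofReal hd.le
    have hsub := ofReal_sub_le_lintegral (ν := μ) (S := ball 0 (2 * R))
      (F := fun _ => ENNReal.ofReal m) measurable_const hwm (J := m * I.toReal) (k := k)
      (D := m * (Cs * (2 * R) ^ n)) hk.le (by positivity)
      (by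
        rw [lintegral_const_mul _ (by fun_prop), ENNReal.ofReal_mul hm0.le,
          ENNReal.ofReal_toReal hIfin.ne])
      (by
        rw [setLIntegral_const, ENNReal.ofReal_mul hm0.le]
        gcongr
        exact h.upper_zero _ (by positivity) hR2)
    have e2 : k * (m * (Cs * (2 * R) ^ n)) = k * (κ * (Cs * 2 ^ n)) * R ^ (-(2 * s)) := by
      rw [hm, mul_pow]; field_simp
    rw [e2] at hsub
    refine hsub.trans (le_trans ?_ (setLIntegral_le_lintegral (ball 0 (2 * R)) _))
    refine lintegral_mono_ae ?_
    filter_upwards [hK] with y hy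
    exact mul_le_mul_left hy _

/-- The tail estimate. -/
theorem tail_le (hP : Admissible n s cs Cs Λ) {bs : ℝ} (hbs : 0 ≤ bs) :
    ∃ C : ℝ, 0 < C ∧
    ∀ (R₀ : ℝ) (μ : Measure (Amb n)) (K : Amb n → Amb n → ℝ≥0∞) (R d b₀ : ℝ) (w : Amb n → ℝ),
      SFinite μ → IsJumpSpace n s cs Cs Λ R₀ μ K → IsSuper μ K R d b₀ w →
      0 ≤ d → 0 ≤ b₀ → 0 < R → 4 * R ≤ R₀ → b₀ ≤ bs * R ^ (-(2 * s)) →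
      ENNReal.ofReal (R ^ (2 * s)) *
        essInf (fun x => ∫⁻ y in (ball 0 R)ᶜ, ENNReal.ofReal (w y) * K x y ∂μ)
          (μ.restrict (ball 0 (R / 2))) ≤ ENNReal.ofReal C *
        (essInf (fun x => ENNReal.ofReal (w x)) (μ.restrict (ball 0 R)) +
          ENNReal.ofReal (R ^ (2 * s) * d)) := by
  have hU := upConst_pos hP
  have hs : 0 < s := by linarith [hP.half_lt]
  have hcs := hP.cs_pos
  obtain ⟨c, hc, hgrow⟩ := growth_of_mass hP (D := upConst n s Cs Λ) (bs := bs) hU.le hbs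
  obtain ⟨C₁, hC₁, hmean⟩ := mean_le hP hbs
  set C₂ : ℝ := 4 ^ n * C₁ / cs + 1 with hC₂
  refine ⟨4 ^ (2 * s) / c * C₂, by positivity, ?_⟩
  intro R₀ μ K R d b₀ w _ h hw hd hb hR hRR hbb
  have hwm := hw.measurable
  set T := essInf (fun x => ∫⁻ y in (ball 0 R)ᶜ, ENNReal.ofReal (w y) * K x y ∂μ)
          (μ.restrict (ball 0 (R / 2))) with hT
  set m := essInf (fun x => ENNReal.ofReal (w x)) (μ.restrict (ball 0 R)) with hm
  set m' := essInf (fun x => ENNReal.ofReal (w x)) (μ.restrict (ball 0 (R / 4))) with hm'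
  set δ := ENNReal.ofReal (R ^ (2 * s) * d) with hδ
  -- The growth estimate bounds the tail by the infimum over the small ball `B_{R/4}`. That infimum
  -- is at most an average of `w`, which `mean_le` compares with the infimum over `B_R`.
  have hm'm : m' + δ ≤ ENNReal.ofReal C₂ * (m + δ) := by
    have h1 : m' * ENNReal.ofReal (cs * (R / 4) ^ n) ≤ ENNReal.ofReal (C₁ * R ^ n) * (m + δ) := by
      calc m' * ENNReal.ofReal (cs * (R / 4) ^ n) ≤ m' * μ (ball 0 (R / 4)) :=
            mul_le_mul_right (h.lower_zero _ (by positivity) (by linarith)) _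
        _ = ∫⁻ x in ball 0 (R / 4), m' ∂μ := (setLIntegral_const _ _).symm
        _ ≤ ∫⁻ x in ball 0 (R / 4), ENNReal.ofReal (w x) ∂μ :=
            lintegral_mono_ae (ae_essInf_le (μ := μ.restrict (ball 0 (R / 4)))
              (f := fun x => ENNReal.ofReal (w x)))
        _ ≤ ∫⁻ x in ball 0 (2 * R), ENNReal.ofReal (w x) ∂μ :=
            lintegral_mono_set (ball_subset_ball (by linarith))
        _ ≤ _ := hmean R₀ μ K R d b₀ w inferInstance h hw hd hb hR hRR hbb
    have hpos : 0 < cs * (R / 4) ^ n := by positivity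
    have h2 : m' ≤ ENNReal.ofReal (4 ^ n * C₁ / cs) * (m + δ) := by
      have e : ENNReal.ofReal (C₁ * R ^ n) =
          ENNReal.ofReal (4 ^ n * C₁ / cs) * ENNReal.ofReal (cs * (R / 4) ^ n) := by
        rw [← ENNReal.ofReal_mul (by positivity), div_pow]
        congr 1; field_simp
      rw [e, mul_right_comm] at h1
      exact (ENNReal.mul_le_mul_iff_left (by simpa using hpos) ENNReal.ofReal_ne_top).1 h1
    rw [hC₂, ENNReal.ofReal_add (by positivity) zero_le_one, add_mul, ENNReal.ofReal_one, one_mul]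
    exact add_le_add h2 le_add_self
  have hR4 : (R / 4) ^ (2 * s) = R ^ (2 * s) / 4 ^ (2 * s) := Real.div_rpow hR.le (by norm_num) _
  have hmain : ∀ J : ℝ, 0 ≤ J → ENNReal.ofReal J ≤ T →
      ENNReal.ofReal (c * (R / 4) ^ (2 * s) * J) ≤ m' + δ := by
    intro J hJ hJT
    have hmono : R ^ (-(2 * s)) ≤ (R / 4) ^ (-(2 * s)) :=
      Real.rpow_le_rpow_of_nonpos (by positivity) (by linarith) (by linarith)
    refine (hgrow R₀ μ K R d b₀ w (R / 4) J inferInstance h hw hd hb (by positivity)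
      (by linarith) (by linarith) (hbb.trans (by gcongr)) hJ ?_).trans ?_
    · intro k hk
      have hTae := ae_essInf_le (μ := μ.restrict (ball 0 (R / 2)))
        (f := fun x => ∫⁻ y in (ball 0 R)ᶜ, ENNReal.ofReal (w y) * K x y ∂μ)
      rw [ae_restrict_iff' measurableSet_ball] at hTae
      filter_upwards [hTae, lintegral_kernel_tail_le hP h] with x hx htail hxb
      rw [show 2 * (R / 4) = R / 2 by ring] at hxb
      have hKx : Measurable (K x) := h.measurable.comp measurable_prodMk_left
      have hx1 := hJT.trans (hx hxb)
      simp_rw [mul_comm (ENNReal.ofReal _) (K x _)] at hx1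
      -- From `B_{R/2}` the complement of `B_R` lies beyond distance `R/4`, so the loss caused by
      -- subtracting a level is bounded by a kernel tail.
      have hx2 : ∫⁻ y in (ball 0 R)ᶜ, K x y ∂μ ≤
          ENNReal.ofReal (upConst n s Cs Λ * (R / 4) ^ (-(2 * s))) := by
        refine le_trans (lintegral_mono_set ?_) (htail (R / 4) (by positivity) (by linarith))
        refine compl_subset_compl.2 (ball_subset_ball' ?_)
        rw [mem_ball] at hxb
        linarith
      have := ofReal_sub_le_lintegral hKx hwm hk.le (by positivity) hx1 hx2
      rw [← mul_assoc] at this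
      exact this.trans (setLIntegral_le_lintegral _ _)
    · refine add_le_add le_rfl (ENNReal.ofReal_le_ofReal ?_)
      gcongr
      linarith
  have hfac : ∀ J : ℝ, 0 ≤ J → ENNReal.ofReal (R ^ (2 * s)) * ENNReal.ofReal J =
      ENNReal.ofReal (4 ^ (2 * s) / c) * ENNReal.ofReal (c * (R / 4) ^ (2 * s) * J) := by
    intro J hJ
    rw [← ENNReal.ofReal_mul (by positivity), ← ENNReal.ofReal_mul (by positivity), hR4]
    congr 1; field_simp
  have hR0 : ENNReal.ofReal (R ^ (2 * s)) ≠ 0 := by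
    simpa using Real.rpow_pos_of_pos hR _
  rw [ENNReal.ofReal_mul (by positivity), mul_assoc]
  refine le_trans ?_ (mul_le_mul_right hm'm _)
  rw [mul_comm, ← ENNReal.le_div_iff_mul_le (Or.inl hR0) (Or.inl ENNReal.ofReal_ne_top)]
  -- The tail is not known to be finite, so it is approached by finite `J` below it; its finiteness
  -- is a consequence of the estimate when the right-hand side is finite.
  refine ENNReal.le_of_forall_nnreal_lt fun J hJ => ?_
  rw [ENNReal.le_div_iff_mul_le (Or.inl hR0) (Or.inl ENNReal.ofReal_ne_top), mul_comm]
  have e := hfac J J.2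
  have hJe : ENNReal.ofReal (J : ℝ) = J := ENNReal.ofReal_coe_nnreal
  rw [hJe] at e
  rw [e]
  exact mul_le_mul_right (hmain J J.2 (by rw [hJe]; exact hJ.le)) _

end NonlocalHarnack

/-! ### Algebraic inequality for negative power test functions. -/

namespace NonlocalHarnack

variable {n : ℕ} {s cs Cs Λ R₀ : ℝ} {μ : Measure (Amb n)} {K : Amb n → Amb n → ℝ≥0∞}

/-- Bernoulli's inequality for the concave power `ε`, applied at `1/t`. -/
theorem mul_one_sub_rpow_neg_ge {t ε : ℝ} (ht : 1 ≤ t) (hε : 0 < ε) (hε1 : ε < 1) :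
    ε * (t - 1) ≤ t * (1 - t ^ (-ε)) := by
  have ht0 : 0 < t := by linarith
  have h := rpow_one_add_le_one_add_mul_self (s := t⁻¹ - 1) (p := ε)
    (by have := inv_pos.2 ht0; linarith) hε.le hε1.le
  rw [add_sub_cancel, Real.inv_rpow ht0.le, ← Real.rpow_neg ht0.le] at h
  have := mul_le_mul_of_nonneg_left h ht0.le
  have e : t * (1 + ε * (t⁻¹ - 1)) = t + ε * (1 - t) := by field_simp
  rw [e] at this
  nlinarith

/-- With `P = t^{(1-ε)/2}`, the bounds `P ≤ t` and `1 ≤ P² ≤ t` give `t (P - 1)² ≤ (t - 1)²`;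
Bernoulli's inequality then replaces one factor `t - 1`. -/
theorem sq_rpow_sub_one_le {t ε : ℝ} (ht : 1 ≤ t) (hε : 0 < ε) (hε1 : ε < 1) :
    ε * (t ^ ((1 - ε) / 2) - 1) ^ 2 ≤ (t - 1) * (1 - t ^ (-ε)) := by
  have ht0 : 0 < t := by linarith
  set P := t ^ ((1 - ε) / 2) with hP
  have hP1 : 1 ≤ P := Real.one_le_rpow ht (by linarith)
  have hPt : P ≤ t := by
    calc P ≤ t ^ (1 : ℝ) := Real.rpow_le_rpow_of_exponent_le ht (by linarith)
      _ = t := Real.rpow_one t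
  have hP2 : P ^ 2 ≤ t := by
    rw [hP, ← Real.rpow_natCast, ← Real.rpow_mul ht0.le]
    calc _ ≤ t ^ (1 : ℝ) := Real.rpow_le_rpow_of_exponent_le ht (by push_cast; linarith)
      _ = t := Real.rpow_one t
  have hF := mul_one_sub_rpow_neg_ge ht hε hε1
  set Q := t ^ (-ε)
  -- `(P - 1)² = (P² - P)(1 - 1/P)`
  have h1 : t * (P - 1) ≤ P * (t - 1) := by nlinarith
  have h2 : t * (P - 1) ^ 2 ≤ (t - 1) * (t - 1) := by
    calc t * (P - 1) ^ 2 = (t * (P - 1)) * (P - 1) := by ring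
      _ ≤ (P * (t - 1)) * (P - 1) := by gcongr
      _ = (t - 1) * (P ^ 2 - P) := by ring
      _ ≤ (t - 1) * (t - 1) := by
          gcongr
  have h3 : t * (ε * (P - 1) ^ 2) ≤ t * ((t - 1) * (1 - Q)) := by
    calc t * (ε * (P - 1) ^ 2) = ε * (t * (P - 1) ^ 2) := by ring
      _ ≤ ε * ((t - 1) * (t - 1)) := by gcongr
      _ = (t - 1) * (ε * (t - 1)) := by ring
      _ ≤ (t - 1) * (t * (1 - Q)) := by gcongr
      _ = _ := by ring
  exact le_of_mul_le_mul_left h3 ht0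

/-- The unfavourable case, in which the cutoff is larger where the function is larger. With `X = 1 -
Q`, expanding the square leaves `(t - 1)(2βD - β² X)`. If `4D ≤ βX`, half of the good term survives.
Otherwise the cutoff difference dominates: for `t ≤ 2` Young's inequality works since `X` is
comparable with `t - 1`, and for `t > 2` one has `X ≥ ε/2`, so `β ≤ 8D/ε` and crude bounds suffice.
-/
theorem power_test_aux {t ε P Q β D : ℝ} (ht : 1 ≤ t) (hε : 0 < ε) (hε1 : ε < 1)
    (hP1 : 1 ≤ P) (hQ1 : Q ≤ 1) (hQ0 : 0 ≤ Q) (hPQ : P ^ 2 = t * Q)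
    (hF1 : ε * (P - 1) ^ 2 ≤ (t - 1) * (1 - Q)) (hF3 : ε * (t - 1) ≤ t * (1 - Q))
    (hD : 0 < D) (hDβ : D ≤ β) :
    (t - 1) * (β ^ 2 * Q - (β - D) ^ 2) ≤ -(ε / 2) * (β ^ 2 * (P - 1) ^ 2) +
        128 / ε ^ 2 * (D ^ 2 * P ^ 2) := by
  obtain ⟨X, hX⟩ : ∃ X, X = 1 - Q := ⟨_, rfl⟩
  rw [← hX] at hF1 hF3
  have hX0 : 0 ≤ X := by linarith
  have hβ0 : 0 < β := by linarith
  have hP2 : 1 ≤ P ^ 2 := one_le_pow₀ hP1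
  have ht0 : 0 ≤ t - 1 := by linarith
  have hDP : 0 ≤ D ^ 2 * P ^ 2 := by positivity
  have hpos : 0 ≤ 128 / ε ^ 2 * (D ^ 2 * P ^ 2) := by positivity
  have hβF := mul_le_mul_of_nonneg_left hF1 (sq_nonneg β)
  have hL : (t - 1) * (β ^ 2 * Q - (β - D) ^ 2) ≤ (t - 1) * (2 * β * D - β ^ 2 * X) := by
    refine mul_le_mul_of_nonneg_left ?_ ht0
    rw [hX]
    linarith [sq_nonneg D]
  rcases le_or_gt (4 * D) (β * X) with h4 | h4
  · have h5 : 2 * β * D - β ^ 2 * X ≤ -(1 / 2) * (β ^ 2 * X) := by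
      linarith [mul_le_mul_of_nonneg_left h4 hβ0.le]
    linarith [mul_le_mul_of_nonneg_left h5 ht0]
  rcases le_or_gt t 2 with ht2 | ht2
  · have hkey : (t - 1) * (2 * β * D) ≤ (t - 1) * (β ^ 2 * X) / 2 + 4 / ε * (D ^ 2 * P ^ 2) := by
      rcases ht.eq_or_lt with h1 | h1
      · rw [← h1]
        have : 0 ≤ 4 / ε * (D ^ 2 * P ^ 2) := by positivity
        simpa using this
      · have hXpos : 0 < X := by
          have : 0 < t * X := (mul_pos hε (by linarith)).trans_le hF3
          exact pos_of_mul_pos_right this (by linarith)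
        have h6 : 2 * β * D ≤ β ^ 2 * X / 2 + 2 * D ^ 2 / X := by
          rw [← sub_nonneg]
          have : β ^ 2 * X / 2 + 2 * D ^ 2 / X - 2 * β * D = (β * X - 2 * D) ^ 2 / (2 * X) := by
            field_simp; ring
          rw [this]; positivity
        have h7 : (t - 1) / X ≤ 2 * P ^ 2 / ε := by
          rw [div_le_div_iff₀ hXpos hε]
          have : t * X ≤ 2 * P ^ 2 * X := mul_le_mul_of_nonneg_right (by linarith) hX0
          linarith
        calc (t - 1) * (2 * β * D) ≤ (t - 1) * (β ^ 2 * X / 2 + 2 * D ^ 2 / X) := by gcongr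
          _ = (t - 1) * (β ^ 2 * X) / 2 + 2 * D ^ 2 * ((t - 1) / X) := by ring
          _ ≤ (t - 1) * (β ^ 2 * X) / 2 + 2 * D ^ 2 * (2 * P ^ 2 / ε) := by gcongr
          _ = _ := by ring
    have h8 : 4 / ε * (D ^ 2 * P ^ 2) ≤ 128 / ε ^ 2 * (D ^ 2 * P ^ 2) := by
      refine mul_le_mul_of_nonneg_right ?_ hDP
      rw [div_le_div_iff₀ hε (by positivity)]
      nlinarith
    linarith
  · have hXe : ε / 2 ≤ X := by
      have : t * (ε / 2) ≤ t * X := by nlinarith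
      exact le_of_mul_le_mul_left this (by linarith)
    have hβD : β * ε ≤ 8 * D := by nlinarith
    have hβD2 : β ^ 2 ≤ 64 / ε ^ 2 * D ^ 2 := by
      rw [div_mul_eq_mul_div, le_div_iff₀ (by positivity)]
      have := mul_self_le_mul_self (by positivity) hβD
      linarith
    have h9 : (t - 1) * (β ^ 2 * Q - (β - D) ^ 2) ≤ β ^ 2 * P ^ 2 := by
      rw [hPQ]
      have h1 : 0 ≤ β ^ 2 * Q := by positivity
      have h2 := mul_nonneg ht0 (sq_nonneg (β - D))
      linarith
    have h10 : ε / 2 * (β ^ 2 * (P - 1) ^ 2) ≤ β ^ 2 * P ^ 2 := by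
      have h1 : (P - 1) ^ 2 ≤ P ^ 2 := pow_le_pow_left₀ (by linarith) (by linarith) 2
      calc ε / 2 * (β ^ 2 * (P - 1) ^ 2) ≤ 1 * (β ^ 2 * P ^ 2) := by
            gcongr
            linarith
        _ = _ := one_mul _
    have h11 := mul_le_mul_of_nonneg_right hβD2 (sq_nonneg P)
    have e : 128 / ε ^ 2 * (D ^ 2 * P ^ 2) = 2 * (64 / ε ^ 2 * D ^ 2 * P ^ 2) := by ring
    rw [e]
    linarith

/-- If `β ≤ α` the sign is favourable and `hF1` alone gives the good term; otherwise
`power_test_aux` applies with `D = β - α`, and `129 = 128 + 1` pays for passing from `β (P - 1)` to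
`α - β P`. The weights `ia`, `ib` stand for the indicator of a set containing the support of the
cutoff, so that the error only sees values of the function there. -/
theorem power_test_normalized {t ε P Q α β : ℝ} (ht : 1 ≤ t) (hε : 0 < ε) (hε1 : ε < 1)
    (hP1 : 1 ≤ P) (hQ1 : Q ≤ 1) (hQ0 : 0 ≤ Q) (hPQ : P ^ 2 = t * Q)
    (hF1 : ε * (P - 1) ^ 2 ≤ (t - 1) * (1 - Q)) (hF3 : ε * (t - 1) ≤ t * (1 - Q))
    (hα : 0 ≤ α) (hβ : 0 ≤ β) {ia ib : ℝ} (hia : 0 ≤ ia) (hib : 0 ≤ ib)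
    (ha : 0 < α → ia = 1) (hb : 0 < β → ib = 1) :
    (t - 1) * (β ^ 2 * Q - α ^ 2) ≤ -(ε / 4) * (α - β * P) ^ 2 +
      129 / ε ^ 2 * (α - β) ^ 2 * (ia + P ^ 2 * ib) := by
  have hε2 : (1 : ℝ) ≤ 1 / ε ^ 2 := by
    rw [le_div_iff₀ (by positivity), one_mul]; exact pow_le_one₀ hε.le hε1.le
  have h129 : 129 / ε ^ 2 = 129 * (1 / ε ^ 2) := by ring
  have hsplit : (α - β * P) ^ 2 ≤ 2 * (α - β) ^ 2 + 2 * (β ^ 2 * (P - 1) ^ 2) := by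
    nlinarith [sq_nonneg ((α - β) + β * (P - 1))]
  have hsplit' := mul_le_mul_of_nonneg_left hsplit (by positivity : 0 ≤ ε / 4)
  have ht0 : 0 ≤ t - 1 := by linarith
  have hsq0 := sq_nonneg (α - β)
  rcases le_or_gt β α with hle | hlt
  · rcases hα.eq_or_lt with h0 | h0
    · have : β = 0 := by linarith
      subst this; rw [← h0]; simp
    · rw [ha h0]
      have h1 : (t - 1) * (β ^ 2 * Q - α ^ 2) ≤ (t - 1) * (β ^ 2 * Q - β ^ 2) := by gcongr
      have h2 : ε / 2 * (α - β) ^ 2 ≤ 129 / ε ^ 2 * (α - β) ^ 2 * (1 + P ^ 2 * ib) := by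
        calc ε / 2 * (α - β) ^ 2 ≤ 1 * (α - β) ^ 2 * 1 := by
              rw [mul_one]; gcongr; linarith
          _ ≤ _ := by
              have : 0 ≤ P ^ 2 * ib := by positivity
              gcongr
              · linarith
              · linarith
      have h3 := mul_le_mul_of_nonneg_left hF1 (sq_nonneg β)
      have h4 : 0 ≤ ε * (β ^ 2 * (P - 1) ^ 2) := by positivity
      linarith
  · have hβ0 : 0 < β := by linarith
    rw [hb hβ0]
    have h1 := power_test_aux (β := β) (D := β - α) ht hε hε1 hP1 hQ1 hQ0 hPQ hF1 hF3
      (by linarith) (by linarith)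
    rw [show β - (β - α) = α by ring, show (β - α) ^ 2 = (α - β) ^ 2 by ring] at h1
    have hP2 : 1 ≤ P ^ 2 := one_le_pow₀ hP1
    have h13 : ε / 2 * (α - β) ^ 2 ≤ 1 / ε ^ 2 * (α - β) ^ 2 * P ^ 2 := by
      calc ε / 2 * (α - β) ^ 2 ≤ 1 / ε ^ 2 * (α - β) ^ 2 :=
            mul_le_mul_of_nonneg_right (by linarith) hsq0
        _ ≤ _ := le_mul_of_one_le_right (by positivity) hP2
    have h14 : 0 ≤ 129 / ε ^ 2 * (α - β) ^ 2 * ia := by positivity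
    have e2 : 129 / ε ^ 2 * (α - β) ^ 2 * (ia + P ^ 2 * 1) = 129 / ε ^ 2 * (α - β) ^ 2 * ia +
      (128 / ε ^ 2 * ((α - β) ^ 2 * P ^ 2) + 1 / ε ^ 2 * (α - β) ^ 2 * P ^ 2) := by ring
    rw [e2]
    linarith

/-- Both sides are homogeneous of degree `1 - ε` in `(a, b)`, so dividing by `a ^ (1 - ε)` leaves
the ratio `t = b / a ≥ 1`. -/
theorem power_test_of_le {a b ε α β : ℝ} (ha : 0 < a) (hab : a ≤ b) (hε : 0 < ε) (hε1 : ε < 1)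
    (hα : 0 ≤ α) (hβ : 0 ≤ β) {ia ib : ℝ} (hia : 0 ≤ ia) (hib : 0 ≤ ib)
    (ha' : 0 < α → ia = 1) (hb' : 0 < β → ib = 1) :
    (a - b) * (α ^ 2 * a ^ (-ε) - β ^ 2 * b ^ (-ε)) ≤
      -(ε / 4) * (α * a ^ ((1 - ε) / 2) - β * b ^ ((1 - ε) / 2)) ^ 2 +
      129 / ε ^ 2 * (α - β) ^ 2 * (ia * a ^ (1 - ε) + ib * b ^ (1 - ε)) := by
  set t := b / a with ht
  have ht1 : 1 ≤ t := (one_le_div ha).2 hab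
  have ht0 : 0 < t := by linarith
  have hb : b = a * t := by rw [ht]; field_simp
  have hQ1 : t ^ (-ε) ≤ 1 := Real.rpow_le_one_of_one_le_of_nonpos ht1 (by linarith)
  have hP1 : 1 ≤ t ^ ((1 - ε) / 2) := Real.one_le_rpow ht1 (by linarith)
  have hsq : ∀ x : ℝ, 0 < x → (x ^ ((1 - ε) / 2)) ^ 2 = x ^ (1 - ε) := fun x hx => by
    rw [← Real.rpow_natCast, ← Real.rpow_mul hx.le]; congr 1; push_cast; ring
  have hPQ : (t ^ ((1 - ε) / 2)) ^ 2 = t * t ^ (-ε) := by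
    rw [hsq t ht0, sub_eq_add_neg, Real.rpow_add ht0, Real.rpow_one]
  have key := power_test_normalized ht1 hε hε1 hP1 hQ1 (by positivity) hPQ (sq_rpow_sub_one_le ht1 hε hε1)
    (mul_one_sub_rpow_neg_ge ht1 hε hε1) hα hβ hia hib ha' hb'
  have hA : 0 < a ^ (1 - ε) := by positivity
  have hA2 : a ^ (1 - ε) = a * a ^ (-ε) := by
    rw [sub_eq_add_neg, Real.rpow_add ha, Real.rpow_one]
  have e1 : (a - b) * (α ^ 2 * a ^ (-ε) - β ^ 2 * b ^ (-ε)) =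
      a ^ (1 - ε) * ((t - 1) * (β ^ 2 * t ^ (-ε) - α ^ 2)) := by
    rw [hb, Real.mul_rpow ha.le ht0.le, hA2]; ring
  have e2 : (α * a ^ ((1 - ε) / 2) - β * b ^ ((1 - ε) / 2)) ^ 2 =
      a ^ (1 - ε) * (α - β * t ^ ((1 - ε) / 2)) ^ 2 := by
    rw [hb, Real.mul_rpow ha.le ht0.le, ← hsq a ha]; ring
  have e3 : b ^ (1 - ε) = a ^ (1 - ε) * (t ^ ((1 - ε) / 2)) ^ 2 := by
    rw [hb, Real.mul_rpow ha.le ht0.le, hsq t ht0]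
  rw [e1, e2, e3]
  calc _ ≤ a ^ (1 - ε) * (-(ε / 4) * (α - β * t ^ ((1 - ε) / 2)) ^ 2 +
      129 / ε ^ 2 * (α - β) ^ 2 * (ia + (t ^ ((1 - ε) / 2)) ^ 2 * ib)) := by gcongr
    _ = _ := by ring

/-- The algebraic inequality behind testing with `η² u^{-ε}`. -/
theorem power_test {a b ε α β : ℝ} (ha : 0 < a) (hb : 0 < b) (hε : 0 < ε) (hε1 : ε < 1)
    (hα : 0 ≤ α) (hβ : 0 ≤ β) {ia ib : ℝ} (hia : 0 ≤ ia) (hib : 0 ≤ ib)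
    (ha' : 0 < α → ia = 1) (hb' : 0 < β → ib = 1) :
    (a - b) * (α ^ 2 * a ^ (-ε) - β ^ 2 * b ^ (-ε)) ≤
      -(ε / 4) * (α * a ^ ((1 - ε) / 2) - β * b ^ ((1 - ε) / 2)) ^ 2 +
      129 / ε ^ 2 * (α - β) ^ 2 * (ia * a ^ (1 - ε) + ib * b ^ (1 - ε)) := by
  rcases le_total a b with hab | hab
  · exact power_test_of_le ha hab hε hε1 hα hβ hia hib ha' hb'
  · have := power_test_of_le hb hab hε hε1 hβ hα hib hia hb' ha'
    calc _ = (b - a) * (β ^ 2 * b ^ (-ε) - α ^ 2 * a ^ (-ε)) := by ring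
      _ ≤ _ := this
      _ = _ := by ring

/-- For `x ≤ y` the ratio of the two powers is `(x/y)^ε`, which lies between `x/y` and `1`; this
gives the Lipschitz bound without differentiation. -/
theorem abs_rpow_neg_sub_le {δ ε x y : ℝ} (hδ : 0 < δ) (hε : 0 < ε) (hε1 : ε < 1) (hx : δ ≤ x)
    (hy : δ ≤ y) : |x ^ (-ε) - y ^ (-ε)| ≤ δ ^ (-ε) / δ * |x - y| := by
  wlog hxy : x ≤ y generalizing x y
  · rw [abs_sub_comm, abs_sub_comm x]; exact this hy hx (by linarith)
  have hx0 : 0 < x := by linarith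
  have hy0 : 0 < y := by linarith
  have h1 : y ^ (-ε) = x ^ (-ε) * (x / y) ^ ε := by
    rw [Real.div_rpow hx0.le hy0.le, Real.rpow_neg hx0.le, Real.rpow_neg hy0.le]
    have := Real.rpow_pos_of_pos hx0 ε
    field_simp
  have h2 : x / y ≤ (x / y) ^ ε := by
    calc x / y = (x / y) ^ (1 : ℝ) := (Real.rpow_one _).symm
      _ ≤ _ := Real.rpow_le_rpow_of_exponent_ge (by positivity) ((div_le_one hy0).2 hxy) hε1.le
  have h3 : (x / y) ^ ε ≤ 1 := Real.rpow_le_one (by positivity) ((div_le_one hy0).2 hxy) hε.le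
  have h4 : x ^ (-ε) ≤ δ ^ (-ε) := Real.rpow_le_rpow_of_nonpos hδ hx (by linarith)
  have h5 : 0 < x ^ (-ε) := by positivity
  rw [h1, abs_of_nonneg (by nlinarith), abs_of_nonpos (by linarith : x - y ≤ 0)]
  calc x ^ (-ε) - x ^ (-ε) * (x / y) ^ ε ≤ x ^ (-ε) * (1 - x / y) := by nlinarith
    _ = x ^ (-ε) * ((y - x) / y) := by field_simp
    _ ≤ δ ^ (-ε) * ((y - x) / δ) := by
        have : 0 ≤ y - x := by linarith
        gcongr
    _ = _ := by ring

end NonlocalHarnack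

/-! ### Energy of small powers of supersolutions. -/

namespace NonlocalHarnack

variable {n : ℕ} {s cs Cs Λ R₀ : ℝ} {μ : Measure (Amb n)} {K : Amb n → Amb n → ℝ≥0∞}

variable {R d b₀ : ℝ} {w : Amb n → ℝ}

/-- Admissibility of `η² (w + δ)^{-ε}` as a test function: the shift by `δ > 0` makes the negative
power bounded and Lipschitz in `w`. -/
theorem energy_power_lt_top [SFinite μ] (hP : Admissible n s cs Cs Λ)
    (h : IsJumpSpace n s cs Cs Λ R₀ μ K) (hw : IsSuper μ K R d b₀ w) (hR : 0 < R)
    (hRR : 4 * R ≤ R₀) {ε δ : ℝ} (hε : 0 < ε) (hε1 : ε < 1) (hδ : 0 < δ) :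
    ∫⁻ z, ENNReal.ofReal ((cutoff R (2 * R) z.1 ^ 2 * (w z.1 + δ) ^ (-ε) -
      cutoff R (2 * R) z.2 ^ 2 * (w z.2 + δ) ^ (-ε)) ^ 2) ∂(jump μ K) < ∞ := by
  have hwm := hw.measurable
  have hcm : Measurable (cutoff (n := n) R (2 * R)) := (continuous_cutoff _ _).measurable
  have hab : R < 2 * R := by linarith
  have hB : Measurable ((ball 0 (2 * R)).indicator (1 : Amb n → ℝ≥0∞)) :=
    measurable_one.indicator measurableSet_ball
  refine (lintegral_sq_le_two_mul h
    (φ := fun x => cutoff R (2 * R) x ^ 2 * (w x + δ) ^ (-ε)) (by fun_prop)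
    (measurableSet_ball (x := (0 : Amb n)) (ε := 2 * R)) ?_).trans_lt ?_
  · intro x hx
    rw [cutoff_eq_zero hab (by simpa using hx)]; simp
  refine ENNReal.mul_lt_top (by simp) ?_
  set A : ℝ := δ ^ (-ε) with hA
  have hA0 : 0 < A := by positivity
  have hpt : ∀ z : Amb n × Amb n, (ball 0 (2 * R)).indicator (1 : Amb n → ℝ≥0∞) z.1 *
      ENNReal.ofReal ((cutoff R (2 * R) z.1 ^ 2 * (w z.1 + δ) ^ (-ε) -
        cutoff R (2 * R) z.2 ^ 2 * (w z.2 + δ) ^ (-ε)) ^ 2) ≤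
      ENNReal.ofReal (8 * A ^ 2) * ((ball 0 (2 * R)).indicator (1 : Amb n → ℝ≥0∞) z.1 *
        ENNReal.ofReal ((cutoff R (2 * R) z.1 - cutoff R (2 * R) z.2) ^ 2)) +
      ENNReal.ofReal (2 * (A / δ) ^ 2) * ((ball 0 (2 * R)).indicator 1 z.1 *
        ENNReal.ofReal ((w z.1 - w z.2) ^ 2)) := by
    intro z
    by_cases hz : z.1 ∈ ball 0 (2 * R)
    · simp only [hz, indicator_of_mem, Pi.one_apply, one_mul]
      rw [← ENNReal.ofReal_mul (by positivity),
        ← ENNReal.ofReal_mul (by positivity), ← ENNReal.ofReal_add (by positivity) (by positivity)]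
      refine ENNReal.ofReal_le_ofReal ?_
      have hw1 : δ ≤ w z.1 + δ := by linarith [hw.nonneg z.1]
      have hw2 : δ ≤ w z.2 + δ := by linarith [hw.nonneg z.2]
      have h1 := abs_rpow_neg_sub_le hδ hε hε1 hw1 hw2
      rw [add_sub_add_right_eq_sub] at h1
      have h2 : (w z.1 + δ) ^ (-ε) ≤ A := Real.rpow_le_rpow_of_nonpos hδ hw1 (by linarith)
      have h3 : 0 ≤ (w z.1 + δ) ^ (-ε) := Real.rpow_nonneg (by linarith) _
      set α := cutoff R (2 * R) z.1
      set β := cutoff R (2 * R) z.2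
      set p := (w z.1 + δ) ^ (-ε)
      set q := (w z.2 + δ) ^ (-ε)
      have hα : 0 ≤ α := cutoff_nonneg _ _ _
      have hα1 : α ≤ 1 := cutoff_le_one _ _ _
      have hβ : 0 ≤ β := cutoff_nonneg _ _ _
      have hβ1 : β ≤ 1 := cutoff_le_one _ _ _
      have e : α ^ 2 * p - β ^ 2 * q = (α - β) * ((α + β) * p) + β ^ 2 * (p - q) := by ring
      have h4 : ((α + β) * p) ^ 2 ≤ 4 * A ^ 2 := by
        have : (α + β) * p ≤ 2 * A := mul_le_mul (by linarith) h2 h3 (by norm_num)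
        have := pow_le_pow_left₀ (by positivity) this 2
        linarith
      have h5 : (p - q) ^ 2 ≤ (A / δ) ^ 2 * (w z.1 - w z.2) ^ 2 := by
        rw [← mul_pow, sq_le_sq, abs_mul, abs_of_nonneg (by positivity : 0 ≤ A / δ)]
        exact h1
      have h6 : (β ^ 2 * (p - q)) ^ 2 ≤ (p - q) ^ 2 := by
        rw [mul_pow]
        exact mul_le_of_le_one_left (sq_nonneg _) (pow_le_one₀ (by positivity)
          (pow_le_one₀ hβ hβ1))
      have h7 : ((α - β) * ((α + β) * p)) ^ 2 ≤ (α - β) ^ 2 * (4 * A ^ 2) := by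
        rw [mul_pow]; gcongr
      rw [e]
      have h8 := sq_nonneg ((α - β) * ((α + β) * p) - β ^ 2 * (p - q))
      calc _ ≤ 2 * ((α - β) * ((α + β) * p)) ^ 2 + 2 * (β ^ 2 * (p - q)) ^ 2 := by linarith
        _ ≤ _ := by linarith
    · simp [hz]
  refine (lintegral_mono hpt).trans_lt ?_
  rw [lintegral_add_left (by fun_prop), lintegral_const_mul _ (by fun_prop),
    lintegral_const_mul _ (by fun_prop)]
  refine ENNReal.add_lt_top.2 ⟨ENNReal.mul_lt_top ENNReal.ofReal_lt_top ?_,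
    ENNReal.mul_lt_top ENNReal.ofReal_lt_top (hw.energy_lt_top _ (by linarith))⟩
  refine (lintegral_jump_sq_le hP h hcm (by linarith : 0 < 2 * R - R) (by linarith)
    (abs_cutoff_sub_le hab) (abs_cutoff_sub_le_one _ _) hB).trans_lt
    (ENNReal.mul_lt_top ENNReal.ofReal_lt_top ?_)
  rw [lintegral_indicator_one measurableSet_ball]
  exact ball_lt_top h (by linarith)

theorem lintegral_lt_top_of_sq [SFinite μ] (h : IsJumpSpace n s cs Cs Λ R₀ μ K)
    (hw : IsSuper μ K R d b₀ w) (hR : 0 < R) (hRR : 4 * R ≤ R₀) {ε δ : ℝ} (hε : 0 < ε)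
    (hε1 : ε < 1) (hδ : 0 < δ) :
    ∫⁻ x in ball 0 (2 * R), ENNReal.ofReal ((w x + δ) ^ (1 - ε)) ∂μ < ∞ := by
  calc _ ≤ ∫⁻ x in ball 0 (2 * R), (ENNReal.ofReal (2 + δ) + ENNReal.ofReal (w x ^ 2)) ∂μ := by
        refine lintegral_mono fun x => ?_
        rw [← ENNReal.ofReal_add (by positivity) (sq_nonneg _)]
        refine ENNReal.ofReal_le_ofReal ?_
        have hu : 0 < w x + δ := by linarith [hw.nonneg x]
        have h1 : (w x + δ) ^ (1 - ε) ≤ 1 + (w x + δ) := by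
          rcases le_total (w x + δ) 1 with h1 | h1
          · have := Real.rpow_le_one hu.le h1 (by linarith : 0 ≤ 1 - ε)
            linarith
          · have := Real.rpow_le_rpow_of_exponent_le h1 (by linarith : 1 - ε ≤ 1)
            rw [Real.rpow_one] at this
            linarith
        nlinarith [sq_nonneg (w x - 1)]
    _ < ∞ := by
        rw [lintegral_add_left measurable_const, setLIntegral_const]
        exact ENNReal.add_lt_top.2 ⟨ENNReal.mul_lt_top ENNReal.ofReal_lt_top
          (ball_lt_top h (by linarith)), hw.sq_lt_top _ (by linarith)⟩

/-- The constant in the energy estimate for powers. -/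
noncomputable def powConst (n : ℕ) (s Cs Λ bs ε : ℝ) : ℝ :=
  4 / ε * (129 / ε ^ 2 * 2 * upConst n s Cs Λ + 2 * (1 + bs))

set_option maxHeartbeats 1000000 in
/-- The energy estimate for small powers of supersolutions. -/
theorem power_energy [SFinite μ] (hP : Admissible n s cs Cs Λ)
    (h : IsJumpSpace n s cs Cs Λ R₀ μ K) (hw : IsSuper μ K R d b₀ w) (hb : 0 ≤ b₀)
    (hR : 0 < R) (hRR : 4 * R ≤ R₀) {bs : ℝ} (hbb : b₀ ≤ bs * R ^ (-(2 * s)))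
    {ε δ : ℝ} (hε : 0 < ε) (hε1 : ε < 1) (hδ : 0 < δ) (hdδ : R ^ (2 * s) * d ≤ δ) :
    ∫⁻ z, ENNReal.ofReal ((cutoff R (2 * R) z.1 * (w z.1 + δ) ^ ((1 - ε) / 2) -
      cutoff R (2 * R) z.2 * (w z.2 + δ) ^ ((1 - ε) / 2)) ^ 2) ∂(jump μ K) ≤
    ENNReal.ofReal (powConst n s Cs Λ bs ε * R ^ (-(2 * s))) *
      ∫⁻ x in ball 0 (2 * R), ENNReal.ofReal ((w x + δ) ^ (1 - ε)) ∂μ := by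
  have hwm := hw.measurable
  have hUC := upConst_pos hP
  have hcm : Measurable (cutoff (n := n) R (2 * R)) := (continuous_cutoff _ _).measurable
  have hab : R < 2 * R := by linarith
  set η : Amb n → ℝ := cutoff R (2 * R) with hη
  have hη0 : ∀ x, 0 ≤ η x := cutoff_nonneg _ _
  have hη1 : ∀ x, η x ≤ 1 := cutoff_le_one _ _
  have hηB : ∀ x ∉ ball (0 : Amb n) (2 * R), η x = 0 := fun x hx =>
    cutoff_eq_zero hab (by simpa using hx)
  set u : Amb n → ℝ := fun x => w x + δ with hu
  have hum : Measurable u := by fun_prop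
  have huδ : ∀ x, δ ≤ u x := fun x => by simp only [hu]; linarith [hw.nonneg x]
  have hu0 : ∀ x, 0 < u x := fun x => hδ.trans_le (huδ x)
  set φ : Amb n → ℝ := fun x => η x ^ 2 * u x ^ (-ε) with hφ
  have hφm : Measurable φ := by fun_prop
  have hφ0 : ∀ x, 0 ≤ φ x := fun x => mul_nonneg (sq_nonneg _) (Real.rpow_nonneg (hu0 x).le _)
  have hφb : ∀ x, φ x ≤ δ ^ (-ε) := fun x => by
    have h1 : u x ^ (-ε) ≤ δ ^ (-ε) := Real.rpow_le_rpow_of_nonpos hδ (huδ x) (by linarith)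
    have h2 : η x ^ 2 ≤ 1 := pow_le_one₀ (hη0 x) (hη1 x)
    calc φ x ≤ 1 * u x ^ (-ε) :=
          mul_le_mul_of_nonneg_right h2 (Real.rpow_nonneg (hu0 x).le _)
      _ ≤ _ := by rw [one_mul]; exact h1
  have hφB : ∀ x ∉ ball (0 : Amb n) (2 * R), φ x = 0 := fun x hx => by simp [hφ, hηB x hx]
  have hφE : ∫⁻ z, ENNReal.ofReal ((φ z.1 - φ z.2) ^ 2) ∂(jump μ K) < ∞ :=
    energy_power_lt_top hP h hw hR hRR hε hε1 hδ
  have hle := hw.le_form φ (2 * R) _ (by linarith) hφm hφ0 hφb hφB hφE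
  have hF := integrable_form h hwm hφm measurableSet_ball (hw.energy_lt_top (2 * R) (by linarith))
    hφB hφE
  set I := ∫⁻ x in ball 0 (2 * R), ENNReal.ofReal ((w x + δ) ^ (1 - ε)) ∂μ with hI
  have hIfin : I < ∞ := lintegral_lt_top_of_sq h hw hR hRR hε hε1 hδ
  set ind : Amb n → ℝ := (ball (0 : Amb n) (2 * R)).indicator 1 with hind
  have hindm : Measurable ind := measurable_one.indicator measurableSet_ball
  have hind0 : ∀ x, 0 ≤ ind x := fun x => indicator_nonneg (fun _ _ => zero_le_one) _
  have hind1 : ∀ x, 0 < η x → ind x = 1 := fun x hx => by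
    have : x ∈ ball (0 : Amb n) (2 * R) := by
      by_contra hcon; rw [hηB x hcon] at hx; exact lt_irrefl _ hx
    simp [hind, this]
  set G : Amb n → ℝ := fun x => ind x * u x ^ (1 - ε) with hG
  have hGm : Measurable G := by fun_prop
  have hG0 : ∀ x, 0 ≤ G x := fun x => mul_nonneg (hind0 x) (Real.rpow_nonneg (hu0 x).le _)
  have hGl : ∫⁻ x, ENNReal.ofReal (G x) ∂μ = I := by
    rw [hI, ← lintegral_indicator measurableSet_ball]
    congr 1; ext x
    by_cases hx : x ∈ ball (0 : Amb n) (2 * R)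
    · rw [indicator_of_mem hx]; simp only [hG, hind, indicator_of_mem hx, Pi.one_apply, one_mul, hu]
    · rw [indicator_of_notMem hx]; simp only [hG, hind, indicator_of_notMem hx, zero_mul,
        ENNReal.ofReal_zero]
  have hGi : Integrable G μ := integrable_of_lintegral_ofReal_lt_top hGm hG0 (hGl ▸ hIfin)
  have hGI : ENNReal.ofReal (∫ x, G x ∂μ) = I := by
    rw [ofReal_integral_eq_lintegral_ofReal hGi (ae_of_all _ hG0), hGl]
  have hGI0 : 0 ≤ ∫ x, G x ∂μ := integral_nonneg hG0
  have huφ : ∀ x, u x * φ x ≤ G x := by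
    intro x
    have e : u x * u x ^ (-ε) = u x ^ (1 - ε) := by
      rw [sub_eq_add_neg, Real.rpow_add (hu0 x), Real.rpow_one]
    have h1 : η x ^ 2 ≤ ind x := by
      rcases (hη0 x).eq_or_lt with h0 | h0
      · rw [← h0]; simpa using hind0 x
      · rw [hind1 x h0]; exact pow_le_one₀ (hη0 x) (hη1 x)
    calc u x * φ x = η x ^ 2 * (u x * u x ^ (-ε)) := by simp only [hφ]; ring
      _ ≤ G x := by
          rw [e]
          exact mul_le_mul_of_nonneg_right h1 (Real.rpow_nonneg (hu0 x).le _)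
  have hφG : ∀ x, δ * φ x ≤ G x := fun x =>
    (mul_le_mul_of_nonneg_right (huδ x) (hφ0 x)).trans (huφ x)
  have hδφ : δ * ∫ x, φ x ∂μ ≤ ∫ x, G x ∂μ := by
    rw [← integral_const_mul]
    exact integral_mono_of_nonneg (ae_of_all _ fun x => mul_nonneg hδ.le (hφ0 x)) hGi
      (ae_of_all _ hφG)
  have hwφ : ∫ x, w x * φ x ∂μ ≤ ∫ x, G x ∂μ := by
    refine integral_mono_of_nonneg (ae_of_all _ fun x => mul_nonneg (hw.nonneg x) (hφ0 x)) hGi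
      (ae_of_all _ fun x => ?_)
    refine (mul_le_mul_of_nonneg_right ?_ (hφ0 x)).trans (huφ x)
    simp only [hu]; linarith
  have hφI0 : 0 ≤ ∫ x, φ x ∂μ := integral_nonneg hφ0
  have hrr : R ^ (-(2 * s)) * R ^ (2 * s) = 1 := by rw [← Real.rpow_add hR]; simp
  have hRm : 0 < R ^ (-(2 * s)) := by positivity
  -- The shift is at least `R ^ (2 * s) * d`, so the forcing is paid by `δ * φ ≤ u * φ ≤ G`, that
  -- is, by `u ^ (1 - ε)` on the ball.
  have hdφ : d * ∫ x, φ x ∂μ ≤ R ^ (-(2 * s)) * ∫ x, G x ∂μ := by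
    calc d * ∫ x, φ x ∂μ = R ^ (-(2 * s)) * (R ^ (2 * s) * d * ∫ x, φ x ∂μ) := by
          linear_combination -(d * ∫ x, φ x ∂μ) * hrr
      _ ≤ R ^ (-(2 * s)) * (δ * ∫ x, φ x ∂μ) := by gcongr
      _ ≤ _ := by gcongr
  have hbφ : b₀ * ∫ x, w x * φ x ∂μ ≤ bs * R ^ (-(2 * s)) * ∫ x, G x ∂μ := by
    calc b₀ * ∫ x, w x * φ x ∂μ ≤ b₀ * ∫ x, G x ∂μ := by gcongr
      _ ≤ _ := by gcongr
  set Q : Amb n × Amb n → ℝ := fun z => G z.1 * (η z.1 - η z.2) ^ 2 with hQ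
  have hQm : Measurable Q := by fun_prop
  have hQ0 : ∀ z, 0 ≤ Q z := fun z => mul_nonneg (hG0 _) (sq_nonneg _)
  have hQl : ∫⁻ z, ENNReal.ofReal (Q z) ∂(jump μ K) ≤
      ENNReal.ofReal (upConst n s Cs Λ * R ^ (-(2 * s))) * I := by
    have := lintegral_jump_sq_le hP h hcm (by linarith : 0 < 2 * R - R) (by linarith)
      (abs_cutoff_sub_le hab) (abs_cutoff_sub_le_one _ _)
      (g := fun x => ENNReal.ofReal (G x)) (by fun_prop)
    rw [hGl, show 2 * R - R = R by ring] at this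
    refine le_trans (le_of_eq ?_) this
    congr 1; ext z
    rw [← ENNReal.ofReal_mul (hG0 _)]
  have hQi : Integrable Q (jump μ K) := integrable_of_lintegral_ofReal_lt_top hQm hQ0
    (hQl.trans_lt (ENNReal.mul_lt_top ENNReal.ofReal_lt_top hIfin))
  have hQs : Integrable (fun z => Q z.swap) (jump μ K) :=
    (measurePreserving_swap_jump h).integrable_comp_of_integrable hQi
  have hQse : ∫ z, Q z.swap ∂(jump μ K) = ∫ z, Q z ∂(jump μ K) :=
    (measurePreserving_swap_jump h).integral_comp' (f := MeasurableEquiv.prodComm) Q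
  have hJ0 : 0 ≤ ∫ z, Q z ∂(jump μ K) := integral_nonneg hQ0
  have hJ : ∫ z, Q z ∂(jump μ K) ≤ upConst n s Cs Λ * R ^ (-(2 * s)) * ∫ x, G x ∂μ := by
    have e := ofReal_integral_eq_lintegral_ofReal hQi (ae_of_all _ hQ0)
    rw [← e, ← hGI, ← ENNReal.ofReal_mul (by positivity),
      ENNReal.ofReal_le_ofReal_iff (by positivity)] at hQl
    exact hQl
  set v : Amb n → ℝ := fun x => η x * u x ^ ((1 - ε) / 2) with hv
  have hvm : Measurable v := by fun_prop
  have hpt : ∀ z : Amb n × Amb n, ε / 4 * (v z.1 - v z.2) ^ 2 ≤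
      (129 / ε ^ 2 * Q z + 129 / ε ^ 2 * Q z.swap) - (w z.1 - w z.2) * (φ z.1 - φ z.2) := by
    intro z
    have h1 := power_test (hu0 z.1) (hu0 z.2) hε hε1 (hη0 z.1) (hη0 z.2) (hind0 z.1) (hind0 z.2)
      (hind1 z.1) (hind1 z.2)
    have e1 : u z.1 - u z.2 = w z.1 - w z.2 := by simp only [hu]; ring
    rw [e1] at h1
    have e2 : 129 / ε ^ 2 * Q z + 129 / ε ^ 2 * Q z.swap = 129 / ε ^ 2 * (η z.1 - η z.2) ^ 2 *
        (ind z.1 * u z.1 ^ (1 - ε) + ind z.2 * u z.2 ^ (1 - ε)) := by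
      simp only [hQ, hG, Prod.fst_swap, Prod.snd_swap]; ring
    rw [e2]
    simp only [hφ, hv]
    linarith
  have hsum : Integrable (fun z => 129 / ε ^ 2 * Q z + 129 / ε ^ 2 * Q z.swap) (jump μ K) :=
    (hQi.const_mul _).add (hQs.const_mul _)
  have hint := hsum.sub hF
  have hv0 : ENNReal.ofReal (ε / 4) * ∫⁻ z, ENNReal.ofReal ((v z.1 - v z.2) ^ 2) ∂(jump μ K) ≤
      ENNReal.ofReal ((129 / ε ^ 2 * 2 * upConst n s Cs Λ + 2 * (1 + bs)) * R ^ (-(2 * s)) *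
        ∫ x, G x ∂μ) := by
    rw [← lintegral_const_mul _ (by fun_prop)]
    calc _ = ∫⁻ z, ENNReal.ofReal (ε / 4 * (v z.1 - v z.2) ^ 2) ∂(jump μ K) := by
          congr 1; ext z; rw [ENNReal.ofReal_mul (by positivity)]
      _ ≤ ∫⁻ z, ENNReal.ofReal ((129 / ε ^ 2 * Q z + 129 / ε ^ 2 * Q z.swap) -
          (w z.1 - w z.2) * (φ z.1 - φ z.2)) ∂(jump μ K) :=
          lintegral_mono fun z => ENNReal.ofReal_le_ofReal (hpt z)
      _ = ENNReal.ofReal (∫ z, ((129 / ε ^ 2 * Q z + 129 / ε ^ 2 * Q z.swap) -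
          (w z.1 - w z.2) * (φ z.1 - φ z.2)) ∂(jump μ K)) := by
          refine (ofReal_integral_eq_lintegral_ofReal hint (ae_of_all _ fun z => ?_)).symm
          refine le_trans ?_ (hpt z)
          simp only [Pi.zero_apply]; positivity
      _ ≤ _ := by
          refine ENNReal.ofReal_le_ofReal ?_
          rw [integral_sub hsum hF, integral_add (hQi.const_mul _) (hQs.const_mul _),
            integral_const_mul, integral_const_mul, hQse]
          have h2 := mul_le_mul_of_nonneg_left hJ (by positivity : 0 ≤ 129 / ε ^ 2)
          linarith
  calc ∫⁻ z, ENNReal.ofReal ((v z.1 - v z.2) ^ 2) ∂(jump μ K)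
      = ENNReal.ofReal (4 / ε) * (ENNReal.ofReal (ε / 4) *
        ∫⁻ z, ENNReal.ofReal ((v z.1 - v z.2) ^ 2) ∂(jump μ K)) := by
        rw [← mul_assoc, ← ENNReal.ofReal_mul (by positivity)]
        have : 4 / ε * (ε / 4) = 1 := by field_simp
        rw [this]; simp
    _ ≤ ENNReal.ofReal (4 / ε) * _ := mul_le_mul_right hv0 _
    _ = _ := by
        rw [← hGI, ENNReal.ofReal_mul' hGI0, ← mul_assoc, ← ENNReal.ofReal_mul (by positivity),
          powConst]
        congr 2; ring

end NonlocalHarnack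

/-! ### Weak-type bounds and integrability up to the exponent `θ`. -/

namespace NonlocalHarnack

variable {n : ℕ} {s cs Cs Λ : ℝ}

/-- The case distinction in `theta` is exactly whether `2s/n ≥ 1/2`, that is, whether `n ≤ 4s`. -/
theorem theta_eq (hP : Admissible n s cs Cs Λ) : theta n s = 1 / (1 - gam n s) := by
  have hn : (1 : ℝ) ≤ n := by exact_mod_cast hP.one_le
  have h1 := hP.half_lt
  have h2 := hP.lt_one
  unfold theta gam
  split_ifs with h
  · have hle : (1 / 2 : ℝ) ≤ 2 * s / n := by
      rw [div_le_div_iff₀ (by norm_num) (by linarith)]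
      rcases h with h | ⟨h, h'⟩
      · have : (n : ℝ) ≤ 2 := by exact_mod_cast h
        linarith
      · rw [h]; push_cast; linarith
    rw [min_eq_right hle]; norm_num
  · push Not at h
    have h3 : 3 ≤ n := h.1
    have hle : 2 * s / n ≤ 1 / 2 := by
      rw [div_le_div_iff₀ (by linarith) (by norm_num)]
      rcases h3.eq_or_lt with h4 | h4
      · have := h.2 h4.symm
        rw [← h4]; push_cast; linarith
      · have : (4 : ℝ) ≤ n := by exact_mod_cast h4
        linarith
    rw [min_eq_left hle]
    have : (3 : ℝ) ≤ n := by exact_mod_cast h3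
    have : (n : ℝ) - 2 * s ≠ 0 := by
      have : 2 * s < n := by linarith
      linarith
    field_simp

theorem gam_le_half : gam n s ≤ 1 / 2 := min_le_right _ _

/-- Weak-type estimate from the energy, by the Faber-Krahn inequality on superlevel sets. -/
theorem weak_type (hP : Admissible n s cs Cs Λ) {E₀ E₁ : ℝ} (hE₀ : 0 ≤ E₀) (hE₁ : 0 ≤ E₁) :
    ∃ τ B : ℝ, 0 < τ ∧ 0 < B ∧
    ∀ (R₀ : ℝ) (μ : Measure (Amb n)) (K : Amb n → Amb n → ℝ≥0∞) (R : ℝ) (v : Amb n → ℝ),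
      SFinite μ → IsJumpSpace n s cs Cs Λ R₀ μ K → 0 < R → 4 * R ≤ R₀ → Measurable v →
      (∀ x ∉ ball 0 (2 * R), v x = 0) →
      ∫⁻ z, ENNReal.ofReal ((v z.1 - v z.2) ^ 2) ∂(jump μ K) ≤
        ENNReal.ofReal (E₀ * (R ^ n * R ^ (-(2 * s)))) →
      ∫⁻ x, ENNReal.ofReal (v x ^ 2) ∂μ ≤ ENNReal.ofReal (E₁ * R ^ n) →
      ∀ j : ℕ, μ {x | 2 ^ j * τ ≤ v x} ≤
        ENNReal.ofReal (B * (2 ^ (-(2 / (1 - gam n s)))) ^ j * R ^ n) := by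
  have hγ := gam_pos hP
  have hγh : gam n s ≤ 1 / 2 := gam_le_half
  set γ := gam n s with hγdef
  have hγn : γ ≤ 2 * s / n := min_le_left _ _
  have hcs := hP.cs_pos
  have hΛ : 0 < Λ := by linarith [hP.one_le_Λ]
  -- `β` is the decay rate reproduced by the recursion `4 ^ j * a (j + 1) ≤ C * a j ^ γ`: it solves
  -- `2 + β γ = β`.
  set β : ℝ := 2 / (1 - γ) with hβ
  have h1γ : 0 < 1 - γ := by linarith
  have hβγ : β * (1 - γ) = 2 := by rw [hβ]; field_simp
  -- Since `τ ^ 2 ≥ τ ≥ 2 * E₁ / cs`, Chebyshev's inequality gives the first superlevel set the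
  -- density required by `faber_krahn`.
  set τ : ℝ := 1 + 2 * E₁ / cs with hτ
  have hτ1 : 1 ≤ τ := by
    have : 0 ≤ 2 * E₁ / cs := by positivity
    linarith
  have hτ0 : 0 < τ := by linarith
  set C₃ : ℝ := 2 * Λ / cs * (2 / cs) ^ γ * E₀ * 2 ^ β with hC₃
  have hC₃0 : 0 ≤ C₃ := by positivity
  -- Large enough to start the induction at `j = 0` and to satisfy `C₃ * B ^ γ ≤ B`, which carries
  -- it on.
  set B : ℝ := max (cs / 2) (C₃ ^ (1 / (1 - γ))) with hB
  have hB0 : 0 < B := lt_of_lt_of_le (by positivity) (le_max_left _ _)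
  have hCB : C₃ * B ^ γ ≤ B := by
    have h1 : C₃ ≤ B ^ (1 - γ) := by
      calc C₃ = (C₃ ^ (1 / (1 - γ))) ^ (1 - γ) := by
            rw [← Real.rpow_mul hC₃0, one_div_mul_cancel h1γ.ne', Real.rpow_one]
        _ ≤ _ := Real.rpow_le_rpow (by positivity) (le_max_right _ _) h1γ.le
    calc C₃ * B ^ γ ≤ B ^ (1 - γ) * B ^ γ := by gcongr
      _ = B := by rw [← Real.rpow_add hB0]; simp
  refine ⟨τ, B, hτ0, hB0, ?_⟩
  intro R₀ μ K R v _ h hR hRR hvm hvB hE hv2 j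
  have hRn : 0 < R ^ n := by positivity
  set A : ℕ → Set (Amb n) := fun j => {x | 2 ^ j * τ ≤ v x} with hA
  have hAm : ∀ j, MeasurableSet (A j) := fun j => measurableSet_le measurable_const hvm
  have hpj : ∀ j : ℕ, (1 : ℝ) ≤ 2 ^ j := fun j => one_le_pow₀ (by norm_num)
  have hAB : ∀ j, A j ⊆ ball 0 (2 * R) := by
    intro j x hx
    by_contra hcon
    have h1 : 2 ^ j * τ ≤ v x := hx
    rw [hvB x hcon] at h1
    have := hpj j
    have : 0 < 2 ^ j * τ := by positivity
    linarith
  have hfin : ∀ j, μ (A j) < ∞ := fun j =>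
    (measure_mono (hAB j)).trans_lt (ball_lt_top h (by linarith))
  have hreal : ∀ j, μ (A j) = ENNReal.ofReal (μ.real (A j)) := fun j =>
    (ENNReal.ofReal_toReal (hfin j).ne).symm
  have hA0 : μ (A 0) ≤ ENNReal.ofReal (cs / 2 * R ^ n) := by
    have h1 : ENNReal.ofReal (τ ^ 2) * μ (A 0) ≤ ENNReal.ofReal (E₁ * R ^ n) := by
      refine le_trans ?_ hv2
      rw [← setLIntegral_const]
      refine (setLIntegral_mono' (hAm 0) fun x hx => ENNReal.ofReal_le_ofReal ?_).trans
        (setLIntegral_le_lintegral _ _)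
      have : 2 ^ 0 * τ ≤ v x := hx
      rw [pow_zero, one_mul] at this
      gcongr
    rw [hreal, ← ENNReal.ofReal_mul (by positivity), ENNReal.ofReal_le_ofReal_iff (by positivity)]
      at h1
    rw [hreal]
    refine ENNReal.ofReal_le_ofReal ?_
    have h2 : E₁ ≤ cs / 2 * τ ^ 2 := by
      have h3 : 2 * E₁ / cs ≤ τ := by rw [hτ]; linarith
      rw [div_le_iff₀ hcs] at h3
      nlinarith
    have h4 : τ ^ 2 * μ.real (A 0) ≤ τ ^ 2 * (cs / 2 * R ^ n) := by
      calc _ ≤ E₁ * R ^ n := h1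
        _ ≤ cs / 2 * τ ^ 2 * R ^ n := by gcongr
        _ = _ := by ring
    exact le_of_mul_le_mul_left h4 (by positivity)
  have hanti : ∀ j, A j ⊆ A 0 := by
    intro j x hx
    have h1 : 2 ^ j * τ ≤ v x := hx
    refine show 2 ^ 0 * τ ≤ v x from ?_
    have := hpj j
    nlinarith
  set a : ℕ → ℝ := fun j => μ.real (A j) / R ^ n with ha
  have haR : ∀ j, μ.real (A j) = a j * R ^ n := fun j => by simp only [ha]; field_simp
  have ha0 : ∀ j, 0 ≤ a j := fun j => by simp only [ha]; positivity
  have hrs : R ^ (2 * s) * R ^ (-(2 * s)) = 1 := by rw [← Real.rpow_add hR]; simp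
  -- Between `A (j + 1)` and the complement of `A j` the function drops by at least `t`. Faber-Krahn
  -- on `A j`, with weight `t ^ 2` on `A (j + 1)`, is therefore bounded by the energy.
  have hstep : ∀ j, (2 ^ j) ^ 2 * a (j + 1) ≤ 2 * Λ / cs * (2 / cs) ^ γ * E₀ * a j ^ γ := by
    intro j
    set t : ℝ := 2 ^ j * τ with ht
    have ht0 : 0 < t := by have := hpj j; positivity
    have hFK := faber_krahn hP h hγn hR (by linarith) (hAm j) (hAB j)
      ((measure_mono (hanti j)).trans hA0)
      (g := (A (j + 1)).indicator fun _ => ENNReal.ofReal (t ^ 2))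
      (measurable_const.indicator (hAm (j + 1)))
    have hsub : A (j + 1) ⊆ A j := by
      intro x hx
      have h1 : 2 ^ (j + 1) * τ ≤ v x := hx
      refine show 2 ^ j * τ ≤ v x from ?_
      rw [pow_succ] at h1
      linarith
    rw [lintegral_indicator (hAm _), setLIntegral_const, Measure.restrict_apply (hAm _),
      inter_eq_left.2 hsub] at hFK
    have h2 : ∫⁻ z in A j ×ˢ (A j)ᶜ, (A (j + 1)).indicator (fun _ => ENNReal.ofReal (t ^ 2)) z.1
        ∂(jump μ K) ≤ ENNReal.ofReal (E₀ * (R ^ n * R ^ (-(2 * s)))) := by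
      refine le_trans ?_ hE
      refine (setLIntegral_mono' ((hAm j).prod (hAm j).compl) fun z hz => ?_).trans
        (setLIntegral_le_lintegral _ _)
      by_cases hz1 : z.1 ∈ A (j + 1)
      · rw [indicator_of_mem hz1]
        refine ENNReal.ofReal_le_ofReal ?_
        have h3 : 2 ^ (j + 1) * τ ≤ v z.1 := hz1
        have h4 : ¬ (2 ^ j * τ ≤ v z.2) := hz.2
        rw [pow_succ] at h3
        push Not at h4
        exact pow_le_pow_left₀ ht0.le (by linarith) 2
      · rw [indicator_of_notMem hz1]; exact bot_le
    have h3 := hFK.trans (mul_le_mul_right h2 _)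
    have e1 : 2 * (a j * R ^ n) / (cs * R ^ n) = 2 / cs * a j := by field_simp
    rw [hreal, haR, haR, e1, Real.mul_rpow (by positivity) (ha0 j),
      ← ENNReal.ofReal_mul (by positivity)] at h3
    rw [← ENNReal.ofReal_mul (mul_nonneg (by positivity) (by have := ha0 j; positivity)),
      ENNReal.ofReal_le_ofReal_iff (by have := ha0 j; positivity)] at h3
    have h4 : R ^ n * ((2 ^ j) ^ 2 * a (j + 1)) ≤
        R ^ n * (2 * Λ / cs * (2 / cs) ^ γ * E₀ * a j ^ γ) := by
      calc R ^ n * ((2 ^ j) ^ 2 * a (j + 1)) ≤ t ^ 2 * (a (j + 1) * R ^ n) := by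
            have h5 : (2 ^ j : ℝ) ^ 2 ≤ t ^ 2 :=
              pow_le_pow_left₀ (by positivity) (le_mul_of_one_le_right (by positivity) hτ1) 2
            have := mul_le_mul_of_nonneg_right h5 (mul_nonneg (ha0 (j + 1)) hRn.le)
            linarith
        _ ≤ _ := h3
        _ = (R ^ (2 * s) * R ^ (-(2 * s))) *
            (R ^ n * (2 * Λ / cs * (2 / cs) ^ γ * E₀ * a j ^ γ)) := by ring
        _ = _ := by rw [hrs, one_mul]
    exact le_of_mul_le_mul_left h4 hRn
  have hmain : ∀ j, a j ≤ B * (2 ^ (-β)) ^ j := by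
    intro j
    induction j with
    | zero =>
      rw [pow_zero, mul_one]
      refine le_trans ?_ (le_max_left _ _)
      rw [hreal, haR, ENNReal.ofReal_le_ofReal_iff (by positivity)] at hA0
      exact le_of_mul_le_mul_right hA0 hRn
    | succ j ih =>
      have h1 := hstep j
      have h2 : a j ^ γ ≤ B ^ γ * ((2 ^ (-β)) ^ j) ^ γ := by
        rw [← Real.mul_rpow hB0.le (by positivity)]
        exact Real.rpow_le_rpow (ha0 j) ih hγ.le
      have e1 : ((2 : ℝ) ^ (-β)) ^ j = 2 ^ (-β * j) := by
        rw [← Real.rpow_natCast, ← Real.rpow_mul (by norm_num)]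
      have e2 : (2 ^ (-β * j)) ^ γ = (2 : ℝ) ^ (2 * (j : ℝ)) * 2 ^ (-β * j) := by
        rw [← Real.rpow_mul (by norm_num), ← Real.rpow_add (by norm_num)]
        congr 1
        linear_combination (j : ℝ) * hβγ
      have e3 : ((2 : ℝ) ^ j) ^ 2 = 2 ^ (2 * (j : ℝ)) := by
        rw [← pow_mul, ← Real.rpow_natCast]; congr 1; push_cast; ring
      have e4 : (2 : ℝ) ^ β * 2 ^ (-β) = 1 := by rw [← Real.rpow_add (by norm_num)]; simp
      rw [e3] at h1
      have h3 : (2 : ℝ) ^ (2 * (j : ℝ)) * a (j + 1) ≤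
          2 ^ (2 * (j : ℝ)) * (B * (2 ^ (-β)) ^ (j + 1)) := by
        calc _ ≤ 2 * Λ / cs * (2 / cs) ^ γ * E₀ * a j ^ γ := h1
          _ ≤ 2 * Λ / cs * (2 / cs) ^ γ * E₀ * (B ^ γ * ((2 ^ (-β)) ^ j) ^ γ) := by gcongr
          _ = (2 * Λ / cs * (2 / cs) ^ γ * E₀ * (2 ^ β * 2 ^ (-β))) *
              (B ^ γ * (2 ^ (2 * (j : ℝ)) * 2 ^ (-β * j))) := by rw [e4, e1, e2, mul_one]
          _ = C₃ * B ^ γ * (2 ^ (-β) * (2 ^ (2 * (j : ℝ)) * 2 ^ (-β * j))) := by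
              rw [hC₃]; ring
          _ ≤ B * (2 ^ (-β) * (2 ^ (2 * (j : ℝ)) * 2 ^ (-β * j))) := by gcongr
          _ = _ := by rw [pow_succ, e1]; ring
      exact le_of_mul_le_mul_left h3 (by positivity)
  rw [show {x | 2 ^ j * τ ≤ v x} = A j from rfl, hreal, haR]
  refine ENNReal.ofReal_le_ofReal ?_
  exact mul_le_mul_of_nonneg_right (hmain j) hRn.le

/-- Integrability of powers below the weak-type exponent. -/
theorem lintegral_rpow_le_of_weak_type {α : Type*} [MeasurableSpace α] {ν : Measure α}
    {v : α → ℝ} (hv : Measurable v) (hv0 : ∀ x, 0 ≤ v x) {S : Set α}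
    {τ B V β q M : ℝ} (hτ : 0 < τ) (hB : 0 ≤ B) (hM : 0 ≤ M) (hV : 0 ≤ V) (hq : 0 < q)
    (hqβ : q < β) (hS : ν S ≤ ENNReal.ofReal (M * V))
    (h : ∀ j : ℕ, ν {x | 2 ^ j * τ ≤ v x} ≤ ENNReal.ofReal (B * (2 ^ (-β)) ^ j * V)) :
    ∫⁻ x in S, ENNReal.ofReal (v x ^ q) ∂ν ≤
      ENNReal.ofReal ((τ ^ q * M + 2 ^ q * τ ^ q * B * (1 - 2 ^ (q - β))⁻¹) * V) := by
  have hr1 : (2 : ℝ) ^ (q - β) < 1 :=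
    Real.rpow_lt_one_of_one_lt_of_neg (by norm_num) (by linarith)
  have hr0 : (0 : ℝ) < 2 ^ (q - β) := by positivity
  have hr2 : 0 < 1 - (2 : ℝ) ^ (q - β) := sub_pos.2 hr1
  have hm : ∀ j : ℕ, MeasurableSet {x | 2 ^ j * τ ≤ v x} := fun j =>
    measurableSet_le measurable_const hv
  have hpt : ∀ x, ENNReal.ofReal (v x ^ q) ≤ ENNReal.ofReal (τ ^ q) +
      ∑' j : ℕ, {x | 2 ^ j * τ ≤ v x}.indicator
        (fun _ => ENNReal.ofReal ((2 ^ (j + 1) * τ) ^ q)) x := by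
    intro x
    rcases lt_or_ge (v x) τ with hx | hx
    · exact (ENNReal.ofReal_le_ofReal (Real.rpow_le_rpow (hv0 x) hx.le hq.le)).trans le_self_add
    · obtain ⟨j, hj1, hj2⟩ := exists_nat_pow_near ((one_le_div hτ).2 hx) one_lt_two
      rw [le_div_iff₀ hτ] at hj1
      rw [div_lt_iff₀ hτ] at hj2
      refine le_trans ?_ le_add_self
      refine le_trans ?_ (ENNReal.le_tsum j)
      rw [indicator_of_mem (show x ∈ {x | 2 ^ j * τ ≤ v x} from hj1)]
      exact ENNReal.ofReal_le_ofReal (Real.rpow_le_rpow (hv0 x) hj2.le hq.le)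
  calc ∫⁻ x in S, ENNReal.ofReal (v x ^ q) ∂ν
      ≤ ∫⁻ x in S, (ENNReal.ofReal (τ ^ q) + ∑' j : ℕ, {x | 2 ^ j * τ ≤ v x}.indicator
        (fun _ => ENNReal.ofReal ((2 ^ (j + 1) * τ) ^ q)) x) ∂ν := lintegral_mono hpt
    _ = ENNReal.ofReal (τ ^ q) * ν S + ∫⁻ x in S, ∑' j : ℕ, {x | 2 ^ j * τ ≤ v x}.indicator
        (fun _ => ENNReal.ofReal ((2 ^ (j + 1) * τ) ^ q)) x ∂ν := by
        rw [lintegral_add_left measurable_const, setLIntegral_const]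
    _ ≤ ENNReal.ofReal (τ ^ q) * ν S + ∫⁻ x, ∑' j : ℕ, {x | 2 ^ j * τ ≤ v x}.indicator
        (fun _ => ENNReal.ofReal ((2 ^ (j + 1) * τ) ^ q)) x ∂ν :=
        add_le_add le_rfl (setLIntegral_le_lintegral _ _)
    _ = ENNReal.ofReal (τ ^ q) * ν S + ∑' j : ℕ, ENNReal.ofReal ((2 ^ (j + 1) * τ) ^ q) *
        ν {x | 2 ^ j * τ ≤ v x} := by
        rw [lintegral_tsum fun j => (measurable_const.indicator (hm j)).aemeasurable]
        congr 2; ext j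
        rw [lintegral_indicator (hm j), setLIntegral_const]
    _ ≤ ENNReal.ofReal (τ ^ q) * ENNReal.ofReal (M * V) +
        ∑' j : ℕ, ENNReal.ofReal (2 ^ q * τ ^ q * B * V * (2 ^ (q - β)) ^ j) := by
        refine add_le_add (mul_le_mul_right hS _) (ENNReal.tsum_le_tsum fun j => ?_)
        refine (mul_le_mul_right (h j) _).trans ?_
        rw [← ENNReal.ofReal_mul (by positivity)]
        refine ENNReal.ofReal_le_ofReal (le_of_eq ?_)
        have e1 : ((2 : ℝ) ^ (j + 1) * τ) ^ q = 2 ^ q * τ ^ q * (2 ^ q) ^ j := by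
          rw [Real.mul_rpow (by positivity) hτ.le, pow_succ, Real.mul_rpow (by positivity)
            (by norm_num), ← Real.rpow_natCast 2 j, ← Real.rpow_natCast (2 ^ q) j,
            ← Real.rpow_mul (by norm_num), ← Real.rpow_mul (by norm_num), mul_comm q]
          ring
        have e2 : (2 : ℝ) ^ (q - β) = 2 ^ q * 2 ^ (-β) := by
          rw [← Real.rpow_add (by norm_num)]; congr 1
        rw [e1, e2, mul_pow]; ring
    _ = _ := by
        rw [← ENNReal.ofReal_tsum_of_nonneg (fun i => by positivity)
          ((summable_geometric_of_lt_one hr0.le hr1).mul_left _), tsum_mul_left,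
          tsum_geometric_of_lt_one hr0.le hr1, ← ENNReal.ofReal_mul (by positivity),
          ← ENNReal.ofReal_add (by positivity) (by positivity)]
        congr 1; ring

/-- Supersolutions have integrable powers up to the exponent `θ`. -/
theorem higher_integrability (hP : Admissible n s cs Cs Λ) {bs p : ℝ} (hbs : 0 ≤ bs) (hp : 0 < p)
    (hpθ : p < theta n s) : ∃ C : ℝ, 0 < C ∧
    ∀ (R₀ : ℝ) (μ : Measure (Amb n)) (K : Amb n → Amb n → ℝ≥0∞) (R d b₀ : ℝ) (w : Amb n → ℝ)
      (δ M : ℝ), SFinite μ → IsJumpSpace n s cs Cs Λ R₀ μ K → IsSuper μ K R d b₀ w →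
      0 ≤ b₀ → 0 < R → 4 * R ≤ R₀ → b₀ ≤ bs * R ^ (-(2 * s)) → 0 < δ → R ^ (2 * s) * d ≤ δ →
      0 < M → ∫⁻ x in ball 0 (2 * R), ENNReal.ofReal (w x + δ) ∂μ ≤ ENNReal.ofReal (M * R ^ n) →
      ∫⁻ x in ball 0 R, ENNReal.ofReal ((w x + δ) ^ p) ∂μ ≤
        ENNReal.ofReal (C * M ^ p * R ^ n) := by
  have hcs := hP.cs_pos
  have hCs : 0 < Cs := hcs.trans_le hP.cs_le
  have hU := upConst_pos hP
  have hγh : gam n s ≤ 1 / 2 := gam_le_half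
  have h1γ : 0 < 1 - gam n s := by linarith
  rw [theta_eq hP, lt_div_iff₀ h1γ] at hpθ
  -- `1 - ε` is the midpoint of `p (1 - γ)` and `1`. Hence the exponent `q = 2p/(1 - ε)` needed for
  -- `v` stays strictly below the weak-type exponent `2/(1 - γ)`.
  set ε : ℝ := (1 - p * (1 - gam n s)) / 2 with hε
  have hε0 : 0 < ε := by rw [hε]; linarith
  have hpγ : 0 < p * (1 - gam n s) := by positivity
  have hε1 : ε < 1 := by rw [hε]; linarith
  have h1ε : 0 < 1 - ε := by linarith
  set V : ℝ := Cs * 2 ^ n + 1 with hV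
  have hV0 : 0 < V := by positivity
  have hpc : 0 < powConst n s Cs Λ bs ε := by unfold powConst; positivity
  obtain ⟨τ, B, hτ, hB, hweak⟩ := weak_type hP (E₀ := powConst n s Cs Λ bs ε * V) (E₁ := V)
    (by positivity) hV0.le
  set β : ℝ := 2 / (1 - gam n s) with hβ
  set q : ℝ := p / ((1 - ε) / 2) with hq
  have hq0 : 0 < q := by positivity
  have hqβ : q < β := by
    rw [hq, hβ, div_lt_div_iff₀ (by positivity) h1γ]
    rw [hε]; linarith
  have hr2 : 0 < 1 - (2 : ℝ) ^ (q - β) :=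
    sub_pos.2 (Real.rpow_lt_one_of_one_lt_of_neg (by norm_num) (by linarith))
  refine ⟨τ ^ q * Cs + 2 ^ q * τ ^ q * B * (1 - 2 ^ (q - β))⁻¹, by positivity, ?_⟩
  intro R₀ μ K R d b₀ w δ M _ h hw hb hR hRR hbb hδ hdδ hM hmean
  have hwm := hw.measurable
  have hab : R < 2 * R := by linarith
  have hu0 : ∀ x, 0 < w x + δ := fun x => by linarith [hw.nonneg x]
  -- Dividing by `L` makes the energy and the square integral of `v` independent of `M`, so
  -- `weak_type` is applied with fixed constants; the factor `M ^ p` returns at the end.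
  set L : ℝ := M ^ ((1 - ε) / 2) with hL
  have hL0 : 0 < L := by positivity
  have hL2 : L ^ 2 = M ^ (1 - ε) := by
    rw [hL, ← Real.rpow_natCast, ← Real.rpow_mul hM.le]; congr 1; push_cast; ring
  set I := ∫⁻ x in ball 0 (2 * R), ENNReal.ofReal ((w x + δ) ^ (1 - ε)) ∂μ with hI
  have hIle : I ≤ ENNReal.ofReal (L ^ 2 * V * R ^ n) := by
    calc I ≤ ∫⁻ x in ball 0 (2 * R), (ENNReal.ofReal (L ^ 2) +
          ENNReal.ofReal (L ^ 2 / M) * ENNReal.ofReal (w x + δ)) ∂μ := by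
          refine lintegral_mono fun x => ?_
          rw [← ENNReal.ofReal_mul (by positivity),
            ← ENNReal.ofReal_add (by positivity) (by have := hu0 x; positivity)]
          refine ENNReal.ofReal_le_ofReal ?_
          set t := (w x + δ) / M with ht
          have ht0 : 0 < t := div_pos (hu0 x) hM
          have e1 : w x + δ = M * t := by rw [ht]; field_simp
          have h1 : t ^ (1 - ε) ≤ 1 + t := by
            rcases le_total t 1 with h1 | h1
            · have := Real.rpow_le_one ht0.le h1 (by linarith : 0 ≤ 1 - ε)
              linarith
            · have := Real.rpow_le_rpow_of_exponent_le h1 (by linarith : 1 - ε ≤ 1)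
              rw [Real.rpow_one] at this
              linarith
          rw [e1, Real.mul_rpow hM.le ht0.le, hL2]
          have e2 : M ^ (1 - ε) + M ^ (1 - ε) / M * (M * t) = M ^ (1 - ε) * (1 + t) := by
            field_simp
          rw [e2]
          gcongr
      _ ≤ ENNReal.ofReal (L ^ 2) * ENNReal.ofReal (Cs * (2 * R) ^ n) +
          ENNReal.ofReal (L ^ 2 / M) * ENNReal.ofReal (M * R ^ n) := by
          rw [lintegral_add_left measurable_const, setLIntegral_const,
            lintegral_const_mul _ (by fun_prop)]
          gcongr
          exact h.upper_zero _ (by positivity) (by linarith)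
      _ = _ := by
          rw [← ENNReal.ofReal_mul (by positivity), ← ENNReal.ofReal_mul (by positivity),
            ← ENNReal.ofReal_add (by positivity) (by positivity), mul_pow, hV]
          congr 1; field_simp
  set v : Amb n → ℝ := fun x => cutoff R (2 * R) x * (w x + δ) ^ ((1 - ε) / 2) / L with hv
  have hcm : Measurable (cutoff (n := n) R (2 * R)) := (continuous_cutoff _ _).measurable
  have hvm : Measurable v := by fun_prop
  have hv0 : ∀ x, 0 ≤ v x := fun x =>
    div_nonneg (mul_nonneg (cutoff_nonneg _ _ _) (Real.rpow_nonneg (hu0 x).le _)) hL0.le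
  have hvB : ∀ x ∉ ball 0 (2 * R), v x = 0 := fun x hx => by
    simp only [hv, cutoff_eq_zero hab (by simpa using hx : 2 * R ≤ ‖x‖), zero_mul, zero_div]
  have hLinv : ENNReal.ofReal ((L ^ 2)⁻¹) * ENNReal.ofReal (L ^ 2) = 1 := by
    rw [← ENNReal.ofReal_mul (by positivity), inv_mul_cancel₀ (by positivity)]; simp
  have hE : ∫⁻ z, ENNReal.ofReal ((v z.1 - v z.2) ^ 2) ∂(jump μ K) ≤
      ENNReal.ofReal (powConst n s Cs Λ bs ε * V * (R ^ n * R ^ (-(2 * s)))) := by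
    have h1 := power_energy hP h hw hb hR hRR hbb hε0 hε1 hδ hdδ
    calc _ = ENNReal.ofReal ((L ^ 2)⁻¹) * ∫⁻ z, ENNReal.ofReal
          ((cutoff R (2 * R) z.1 * (w z.1 + δ) ^ ((1 - ε) / 2) -
          cutoff R (2 * R) z.2 * (w z.2 + δ) ^ ((1 - ε) / 2)) ^ 2) ∂(jump μ K) := by
          rw [← lintegral_const_mul _ (by fun_prop)]
          congr 1; ext z
          rw [← ENNReal.ofReal_mul (by positivity)]
          congr 1
          simp only [hv]
          rw [← sub_div, div_pow]; ring
      _ ≤ ENNReal.ofReal ((L ^ 2)⁻¹) * (ENNReal.ofReal (powConst n s Cs Λ bs ε * R ^ (-(2 * s))) *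
          ENNReal.ofReal (L ^ 2 * V * R ^ n)) :=
          mul_le_mul_right (h1.trans (mul_le_mul_right hIle _)) _
      _ = _ := by
          rw [← ENNReal.ofReal_mul (by positivity), ← ENNReal.ofReal_mul (by positivity)]
          congr 1; field_simp
  have hv2 : ∫⁻ x, ENNReal.ofReal (v x ^ 2) ∂μ ≤ ENNReal.ofReal (V * R ^ n) := by
    calc _ ≤ ∫⁻ x, ENNReal.ofReal ((L ^ 2)⁻¹) * (ball 0 (2 * R)).indicator
          (fun x => ENNReal.ofReal ((w x + δ) ^ (1 - ε))) x ∂μ := by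
          refine lintegral_mono fun x => ?_
          by_cases hx : x ∈ ball 0 (2 * R)
          · rw [indicator_of_mem hx, ← ENNReal.ofReal_mul (by positivity)]
            refine ENNReal.ofReal_le_ofReal ?_
            have e : ((w x + δ) ^ ((1 - ε) / 2)) ^ 2 = (w x + δ) ^ (1 - ε) := by
              rw [← Real.rpow_natCast, ← Real.rpow_mul (hu0 x).le]; congr 1; push_cast; ring
            simp only [hv]
            rw [div_pow, mul_pow, e, div_eq_inv_mul]
            have h1 : cutoff R (2 * R) x ^ 2 ≤ 1 :=
              pow_le_one₀ (cutoff_nonneg _ _ _) (cutoff_le_one _ _ _)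
            have h2 := (Real.rpow_pos_of_pos (hu0 x) (1 - ε)).le
            gcongr
            exact mul_le_of_le_one_left h2 h1
          · simp [hvB x hx]
      _ = ENNReal.ofReal ((L ^ 2)⁻¹) * I := by
          rw [lintegral_const_mul _ (by fun_prop (disch := measurability)),
            lintegral_indicator measurableSet_ball]
      _ ≤ ENNReal.ofReal ((L ^ 2)⁻¹) * ENNReal.ofReal (L ^ 2 * V * R ^ n) :=
          mul_le_mul_right hIle _
      _ = _ := by
          rw [← ENNReal.ofReal_mul (by positivity)]
          congr 1; field_simp
  have hw' := hweak R₀ μ K R v inferInstance h hR hRR hvm hvB hE hv2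
  have hfin := lintegral_rpow_le_of_weak_type (S := ball 0 R) hvm hv0 hτ hB.le hCs.le
    (by positivity : 0 ≤ R ^ n) hq0 hqβ (h.upper_zero R hR (by linarith)) hw'
  calc ∫⁻ x in ball 0 R, ENNReal.ofReal ((w x + δ) ^ p) ∂μ
      = ∫⁻ x in ball 0 R, ENNReal.ofReal (M ^ p) * ENNReal.ofReal (v x ^ q) ∂μ := by
        refine setLIntegral_congr_fun measurableSet_ball fun x hx => ?_
        rw [← ENNReal.ofReal_mul (by positivity)]
        congr 1
        have hx1 : cutoff R (2 * R) x = 1 :=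
          cutoff_eq_one hab (by simpa using (mem_ball_zero_iff.1 hx).le)
        have hqe : (1 - ε) / 2 * q = p := by rw [hq]; field_simp
        simp only [hv, hx1, one_mul]
        rw [Real.div_rpow (Real.rpow_nonneg (hu0 x).le _) hL0.le, hL,
          ← Real.rpow_mul (hu0 x).le, ← Real.rpow_mul hM.le, hqe]
        field_simp
    _ = ENNReal.ofReal (M ^ p) * ∫⁻ x in ball 0 R, ENNReal.ofReal (v x ^ q) ∂μ :=
        lintegral_const_mul _ (by fun_prop)
    _ ≤ _ := mul_le_mul_right hfin _
    _ = _ := by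
        rw [← ENNReal.ofReal_mul (by positivity)]
        congr 1; ring

end NonlocalHarnack

/-! ### The weak Harnack inequality in the energy class. -/

namespace NonlocalHarnack

variable {n : ℕ} {s cs Cs Λ : ℝ}

/-- The mean bound of `mean_le` is the input `M` of `higher_integrability`. The shift must be
positive even if `d = 0`, so it is taken to be `D + τ`, and `τ` tends to zero at the end. -/
theorem power_mean_le (hP : Admissible n s cs Cs Λ) {bs p : ℝ} (hbs : 0 ≤ bs) (hp : 0 < p)
    (hpθ : p < theta n s) : ∃ C : ℝ, 0 < C ∧
    ∀ (R₀ : ℝ) (μ : Measure (Amb n)) (K : Amb n → Amb n → ℝ≥0∞) (R d b₀ : ℝ) (w : Amb n → ℝ),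
      SFinite μ → IsJumpSpace n s cs Cs Λ R₀ μ K → IsSuper μ K R d b₀ w →
      0 ≤ d → 0 ≤ b₀ → 0 < R → 4 * R ≤ R₀ → b₀ ≤ bs * R ^ (-(2 * s)) →
      (⨍⁻ x in ball 0 R, ENNReal.ofReal (w x) ^ p ∂μ) ^ (1 / p) ≤ ENNReal.ofReal C *
        (essInf (fun x => ENNReal.ofReal (w x)) (μ.restrict (ball 0 R)) +
          ENNReal.ofReal (R ^ (2 * s) * d)) := by
  have hcs := hP.cs_pos
  have hCs : 0 < Cs := hcs.trans_le hP.cs_le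
  obtain ⟨C₁, hC₁, hmean⟩ := mean_le hP hbs
  obtain ⟨C₂, hC₂, hhigh⟩ := higher_integrability hP hbs hp hpθ
  set C₃ : ℝ := C₁ + 2 ^ n * Cs with hC₃
  have hC₃0 : 0 < C₃ := by positivity
  refine ⟨(C₂ / cs) ^ (1 / p) * C₃, by positivity, ?_⟩
  intro R₀ μ K R d b₀ w _ h hw hd hb hR hRR hbb
  have hwm := hw.measurable
  set m := essInf (fun x => ENNReal.ofReal (w x)) (μ.restrict (ball 0 R)) with hm
  set D := R ^ (2 * s) * d with hD
  have hD0 : 0 ≤ D := by positivity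
  have hC0 : ENNReal.ofReal ((C₂ / cs) ^ (1 / p) * C₃) ≠ 0 := by
    have : 0 < (C₂ / cs) ^ (1 / p) * C₃ := by positivity
    simpa using this
  rcases eq_or_ne (m + ENNReal.ofReal D) ∞ with hX | hX
  · rw [hX, ENNReal.mul_top hC0]; exact le_top
  obtain ⟨x₀, hx₀⟩ : ∃ x₀ : ℝ, x₀ = (m + ENNReal.ofReal D).toReal := ⟨_, rfl⟩
  have hx0 : 0 ≤ x₀ := hx₀ ▸ ENNReal.toReal_nonneg
  have hXx : m + ENNReal.ofReal D = ENNReal.ofReal x₀ := by rw [hx₀, ENNReal.ofReal_toReal hX]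
  have hDx : D ≤ x₀ := by
    rw [← ENNReal.ofReal_le_ofReal_iff hx0, ← hXx]; exact le_add_self
  have hm1 := hmean R₀ μ K R d b₀ w inferInstance h hw hd hb hR hRR hbb
  rw [← hD, hXx, ← ENNReal.ofReal_mul (by positivity)] at hm1
  rw [hXx]
  have hRn : 0 < R ^ n := by positivity
  have key : ∀ τ : ℝ, 0 < τ → (⨍⁻ x in ball 0 R, ENNReal.ofReal (w x) ^ p ∂μ) ^ (1 / p) ≤
      ENNReal.ofReal ((C₂ / cs) ^ (1 / p) * C₃ * (x₀ + τ)) := by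
    intro τ hτ
    have hδ : 0 < D + τ := by linarith
    have hM : 0 < C₃ * (x₀ + τ) := by positivity
    have hint : ∫⁻ x in ball 0 (2 * R), ENNReal.ofReal (w x + (D + τ)) ∂μ ≤
        ENNReal.ofReal (C₃ * (x₀ + τ) * R ^ n) := by
      calc _ = ∫⁻ x in ball 0 (2 * R), (ENNReal.ofReal (w x) + ENNReal.ofReal (D + τ)) ∂μ := by
            congr 1; ext x; rw [ENNReal.ofReal_add (hw.nonneg x) hδ.le]
        _ = ∫⁻ x in ball 0 (2 * R), ENNReal.ofReal (w x) ∂μ +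
            ENNReal.ofReal (D + τ) * μ (ball 0 (2 * R)) := by
            rw [lintegral_add_right _ measurable_const, setLIntegral_const]
        _ ≤ ENNReal.ofReal (C₁ * R ^ n * x₀) + ENNReal.ofReal (x₀ + τ) *
            ENNReal.ofReal (Cs * (2 * R) ^ n) := by
            gcongr
            exact h.upper_zero _ (by positivity) (by linarith)
        _ ≤ _ := by
            rw [← ENNReal.ofReal_mul (by positivity), ← ENNReal.ofReal_add (by positivity)
              (by positivity)]
            refine ENNReal.ofReal_le_ofReal ?_
            have : C₁ * R ^ n * x₀ ≤ C₁ * R ^ n * (x₀ + τ) := by gcongr; linarith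
            rw [hC₃, mul_pow]
            linarith
    have h1 := hhigh R₀ μ K R d b₀ w (D + τ) _ inferInstance h hw hb hR hRR hbb hδ
      (by linarith) hM hint
    have h2 : ⨍⁻ x in ball 0 R, ENNReal.ofReal (w x) ^ p ∂μ ≤
        ENNReal.ofReal (C₂ / cs * (C₃ * (x₀ + τ)) ^ p) := by
      rw [setLAverage_eq]
      refine ENNReal.div_le_of_le_mul ?_
      calc ∫⁻ x in ball 0 R, ENNReal.ofReal (w x) ^ p ∂μ
          ≤ ∫⁻ x in ball 0 R, ENNReal.ofReal ((w x + (D + τ)) ^ p) ∂μ := by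
            refine lintegral_mono fun x => ?_
            rw [ENNReal.ofReal_rpow_of_nonneg (hw.nonneg x) hp.le]
            exact ENNReal.ofReal_le_ofReal
              (Real.rpow_le_rpow (hw.nonneg x) (by linarith) hp.le)
        _ ≤ _ := h1
        _ = ENNReal.ofReal (C₂ / cs * (C₃ * (x₀ + τ)) ^ p) * ENNReal.ofReal (cs * R ^ n) := by
            rw [← ENNReal.ofReal_mul (by positivity)]
            congr 1; field_simp
        _ ≤ _ := mul_le_mul_right (h.lower_zero R hR (by linarith)) _
    refine (ENNReal.rpow_le_rpow h2 (by positivity)).trans (le_of_eq ?_)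
    rw [ENNReal.ofReal_rpow_of_nonneg (by positivity) (by positivity),
      Real.mul_rpow (by positivity) (by positivity), ← Real.rpow_mul hM.le,
      mul_one_div_cancel hp.ne', Real.rpow_one, mul_assoc]
  have hlim : Tendsto (fun τ : ℝ => ENNReal.ofReal ((C₂ / cs) ^ (1 / p) * C₃ * (x₀ + τ)))
      (𝓝[>] 0) (𝓝 (ENNReal.ofReal ((C₂ / cs) ^ (1 / p) * C₃) * ENNReal.ofReal x₀)) := by
    have hc : Continuous fun τ : ℝ => ENNReal.ofReal ((C₂ / cs) ^ (1 / p) * C₃ * (x₀ + τ)) :=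
      ENNReal.continuous_ofReal.comp (by fun_prop)
    have := (hc.tendsto 0).mono_left (nhdsWithin_le_nhds (s := Ioi 0))
    rwa [add_zero, ENNReal.ofReal_mul (by positivity)] at this
  exact ge_of_tendsto hlim (by filter_upwards [self_mem_nhdsWithin] with τ hτ using key τ hτ)

/-- The weak Harnack inequality for supersolutions in the energy sense. -/
theorem weak_harnack (hP : Admissible n s cs Cs Λ) {bs p : ℝ} (hbs : 0 ≤ bs) (hp : 0 < p)
    (hpθ : p < theta n s) : ∃ c : ℝ, 0 < c ∧ c ≤ 1 ∧
    ∀ (R₀ : ℝ) (μ : Measure (Amb n)) (K : Amb n → Amb n → ℝ≥0∞) (R d b₀ : ℝ) (w : Amb n → ℝ),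
      SFinite μ → IsJumpSpace n s cs Cs Λ R₀ μ K → IsSuper μ K R d b₀ w →
      0 ≤ d → 0 ≤ b₀ → 0 < R → 4 * R ≤ R₀ → b₀ ≤ bs * R ^ (-(2 * s)) →
      ENNReal.ofReal c * ((⨍⁻ x in ball 0 R, ENNReal.ofReal (w x) ^ p ∂μ) ^ (1 / p) +
        ENNReal.ofReal (R ^ (2 * s)) *
          essInf (fun x => ∫⁻ y in (ball 0 R)ᶜ, ENNReal.ofReal (w y) * K x y ∂μ)
            (μ.restrict (ball 0 (R / 2)))) ≤
        essInf (fun x => ENNReal.ofReal (w x)) (μ.restrict (ball 0 R)) +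
          ENNReal.ofReal (R ^ (2 * s) * d) := by
  obtain ⟨C₁, hC₁, h1⟩ := power_mean_le hP hbs hp hpθ
  obtain ⟨C₂, hC₂, h2⟩ := tail_le hP hbs
  refine ⟨min 1 (1 / (C₁ + C₂)), lt_min one_pos (by positivity), min_le_left _ _, ?_⟩
  intro R₀ μ K R d b₀ w _ h hw hd hb hR hRR hbb
  have h3 := h1 R₀ μ K R d b₀ w inferInstance h hw hd hb hR hRR hbb
  have h4 := h2 R₀ μ K R d b₀ w inferInstance h hw hd hb hR hRR hbb
  set X := essInf (fun x => ENNReal.ofReal (w x)) (μ.restrict (ball 0 R)) +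
          ENNReal.ofReal (R ^ (2 * s) * d)
  refine (mul_le_mul' (ENNReal.ofReal_le_ofReal (min_le_right _ _)) (add_le_add h3 h4)).trans
    (le_of_eq ?_)
  rw [← add_mul, ← ENNReal.ofReal_add hC₁.le hC₂.le, ← mul_assoc,
    ← ENNReal.ofReal_mul (by positivity), one_div_mul_cancel (by positivity)]
  simp

end NonlocalHarnack

/-! ### From the surface to the jump space; weak supersolutions. -/

namespace NonlocalHarnack

variable {n : ℕ} {s cs Cs Λ R₀ : ℝ} {M Ω : Set (Amb n)} {K : Amb n → Amb n → ℝ≥0∞}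

/-- A measurable version of the kernel. -/
noncomputable def kernelMk (hK : IsTruncatedKernel n s Λ R₀ M Ω K) (x y : Amb n) : ℝ≥0∞ :=
  hK.measurable.mk _ (x, y)

theorem measurable_kernelMk (hK : IsTruncatedKernel n s Λ R₀ M Ω K) :
    Measurable (fun z : Amb n × Amb n => kernelMk hK z.1 z.2) :=
  hK.measurable.measurable_mk

theorem kernelMk_ae (hK : IsTruncatedKernel n s Λ R₀ M Ω K) :
    ∀ᵐ z ∂((surf n M).prod (surf n M)), K z.1 z.2 = kernelMk hK z.1 z.2 :=
  hK.measurable.ae_eq_mk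

theorem prod_restrict_eq [SFinite (surf n M)] :
    ((surf n M).restrict Ω).prod ((surf n M).restrict Ω) =
      ((surf n M).prod (surf n M)).restrict (Ω ×ˢ Ω) := Measure.prod_restrict _ _

theorem ae_prod_of_ae_surf [SFinite (surf n M)] {p : Amb n × Amb n → Prop}
    (hp : ∀ᵐ z ∂((surf n M).prod (surf n M)), p z) :
    ∀ᵐ z ∂(((surf n M).restrict Ω).prod ((surf n M).restrict Ω)), p z := by
  rw [prod_restrict_eq]; exact ae_restrict_of_ae hp

theorem surf_apply {S : Set (Amb n)} (hS : MeasurableSet S) :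
    surf n M S = (μHE[n] : Measure (Amb n)) (M ∩ S) := by
  rw [surf, Measure.restrict_apply hS, inter_comm]

theorem restrict_ball_eq (hΩ : IsOpen Ω) {r : ℝ} (h : M ∩ ball 0 R₀ ⊆ Ω) (hr : r ≤ R₀) :
    ((surf n M).restrict Ω).restrict (ball 0 r) = (surf n M).restrict (ball 0 r) := by
  rw [Measure.restrict_restrict measurableSet_ball, surf,
    Measure.restrict_restrict (measurableSet_ball.inter hΩ.measurableSet),
    Measure.restrict_restrict measurableSet_ball]
  congr 1
  ext x
  constructor
  · rintro ⟨⟨h1, h2⟩, h3⟩; exact ⟨h1, h3⟩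
  · rintro ⟨h1, h2⟩; exact ⟨⟨h1, h ⟨h2, ball_subset_ball hr h1⟩⟩, h2⟩

theorem ae_mem_surf (hM : NullMeasurableSet M (μHE[n] : Measure (Amb n))) :
    ∀ᵐ x ∂(surf n M), x ∈ M := ae_restrict_mem₀ hM

/-- Restricting to `Ω` could destroy the lower density bound. It survives on balls contained in
`B_{R₀}`, because `M` lies inside `Ω` there; hence the condition `‖x‖ + ρ ≤ R₀` in `IsJumpSpace`. -/
theorem isJumpSpace_surf [SFinite (surf n M)]
    (hM : NullMeasurableSet M (μHE[n] : Measure (Amb n))) (hΩ : IsOpen Ω) (hR₀ : 0 < R₀)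
    (h0 : (0 : Amb n) ∈ M) (hMΩ : M ∩ ball 0 R₀ ⊆ Ω) (hD : HasDensity n cs Cs R₀ M Ω)
    (hK : IsTruncatedKernel n s Λ R₀ M Ω K) :
    IsJumpSpace n s cs Cs Λ R₀ ((surf n M).restrict Ω) (kernelMk hK) := by
  have hmem : ∀ᵐ x ∂((surf n M).restrict Ω), x ∈ M ∩ Ω := by
    filter_upwards [ae_restrict_of_ae (ae_mem_surf hM), ae_restrict_mem hΩ.measurableSet]
      with x h1 h2 using ⟨h1, h2⟩
  have hup : ∀ x ∈ M ∩ Ω, ∀ ρ : ℝ, 0 < ρ → ρ ≤ R₀ →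
      (surf n M).restrict Ω (ball x ρ) ≤ ENNReal.ofReal (Cs * ρ ^ n) := by
    intro x hx ρ hρ hρR
    refine (Measure.restrict_apply_le _ _).trans ?_
    rw [surf_apply measurableSet_ball]
    exact (hD x hx ρ hρ hρR).2
  have hlow : ∀ x ∈ M ∩ Ω, ∀ ρ : ℝ, 0 < ρ → ‖x‖ + ρ ≤ R₀ →
      ENNReal.ofReal (cs * ρ ^ n) ≤ (surf n M).restrict Ω (ball x ρ) := by
    intro x hx ρ hρ hρR
    rw [Measure.restrict_apply measurableSet_ball,
      surf_apply (measurableSet_ball.inter hΩ.measurableSet)]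
    refine (hD x hx ρ hρ (by linarith [norm_nonneg x])).1.trans (measure_mono ?_)
    rintro y ⟨h1, h2⟩
    refine ⟨h1, h2, hMΩ ⟨h1, ?_⟩⟩
    rw [mem_ball] at h2 ⊢
    have := dist_triangle y x 0
    rw [dist_zero_right x] at this
    linarith
  have h0' : (0 : Amb n) ∈ M ∩ Ω := ⟨h0, hMΩ ⟨h0, mem_ball_self hR₀⟩⟩
  have hKae := kernelMk_ae hK
  have hKae' : ∀ᵐ z ∂((surf n M).prod (surf n M)), K z.2 z.1 = kernelMk hK z.2 z.1 :=
    (Measure.measurePreserving_swap (μ := surf n M) (ν := surf n M)).quasiMeasurePreserving.ae hKae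
  exact
    { upper_ball := hmem.mono hup
      lower_ball := hmem.mono hlow
      upper_zero := hup 0 h0'
      lower_zero := fun ρ hρ hρR => hlow 0 h0' ρ hρ (by simpa using hρR)
      measurable := measurable_kernelMk hK
      symm := by
        filter_upwards [ae_prod_of_ae_surf hKae, ae_prod_of_ae_surf hKae',
          ae_prod_of_ae_surf hK.symm] with z h1 h2 h3
        rw [← h1, ← h2, h3]
      lower := by
        filter_upwards [ae_prod_of_ae_surf hKae, hK.lower] with z h1 h2
        rwa [← h1]
      upper := by
        filter_upwards [ae_prod_of_ae_surf hKae, hK.upper] with z h1 h2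
        rwa [← h1] }

/-- If exactly one point is in `Ω`, truncation and symmetry make the kernel vanish. If neither is,
both lie outside `B_{R₀}`, where test functions supported near the origin vanish. Thus forms over `M
× M` reduce to `Ω × Ω`. -/
theorem kernel_eq_zero_of_notMem [SFinite (surf n M)]
    (hM : NullMeasurableSet M (μHE[n] : Measure (Amb n))) (hΩ : IsOpen Ω)
    (hMΩ : M ∩ ball 0 R₀ ⊆ Ω) (hK : IsTruncatedKernel n s Λ R₀ M Ω K) :
    ∀ᵐ z ∂((surf n M).prod (surf n M)), z ∉ Ω ×ˢ Ω → K z.1 z.2 = 0 ∨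
      (z.1 ∉ ball (0 : Amb n) R₀ ∧ z.2 ∉ ball (0 : Amb n) R₀) := by
  have h1 : ∀ᵐ z ∂((surf n M).prod (surf n M)), z ∈ Ω ×ˢ Ωᶜ → K z.1 z.2 = 0 := by
    have := hK.trunc
    rw [Measure.prod_restrict, ae_restrict_iff' (hΩ.measurableSet.prod hΩ.measurableSet.compl)]
      at this
    exact this
  have h2 : ∀ᵐ z ∂((surf n M).prod (surf n M)), z ∈ Ωᶜ ×ˢ Ω → K z.2 z.1 = 0 := by
    have := (Measure.measurePreserving_swap (μ := surf n M)
      (ν := surf n M)).quasiMeasurePreserving.ae h1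
    filter_upwards [this] with z hz hz'
    exact hz ⟨hz'.2, hz'.1⟩
  filter_upwards [h1, h2, hK.symm,
    Measure.quasiMeasurePreserving_fst.ae (ae_mem_surf hM),
    Measure.quasiMeasurePreserving_snd.ae (ae_mem_surf hM)] with z k1 k2 k3 m1 m2 hz
  by_cases hz1 : z.1 ∈ Ω
  · left
    exact k1 ⟨hz1, fun hz2 => hz ⟨hz1, hz2⟩⟩
  · by_cases hz2 : z.2 ∈ Ω
    · left; rw [k3]; exact k2 ⟨hz1, hz2⟩
    · right; exact ⟨fun hb => hz1 (hMΩ ⟨m1, hb⟩), fun hb => hz2 (hMΩ ⟨m2, hb⟩)⟩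

/-- Integrals against the jump measure on `M ∩ Ω` in terms of the kernel on `M`. -/
theorem lintegral_jump_surf [SFinite (surf n M)] (hK : IsTruncatedKernel n s Λ R₀ M Ω K)
    {F : Amb n × Amb n → ℝ≥0∞} (hF : Measurable F) :
    ∫⁻ z, F z ∂(jump ((surf n M).restrict Ω) (kernelMk hK)) =
      ∫⁻ z in Ω ×ˢ Ω, F z * K z.1 z.2 ∂((surf n M).prod (surf n M)) := by
  rw [jump, lintegral_withDensity_eq_lintegral_mul _ (measurable_kernelMk hK) hF,
    prod_restrict_eq]
  refine lintegral_congr_ae (ae_restrict_of_ae ?_)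
  filter_upwards [kernelMk_ae hK] with z hz
  rw [Pi.mul_apply, ← hz, mul_comm]

theorem integral_jump_surf [SFinite (surf n M)] (hP : Admissible n s cs Cs Λ) (hR₀ : 0 < R₀)
    (hK : IsTruncatedKernel n s Λ R₀ M Ω K)
    (hJ : IsJumpSpace n s cs Cs Λ R₀ ((surf n M).restrict Ω) (kernelMk hK))
    (F : Amb n × Amb n → ℝ) :
    ∫ z, F z ∂(jump ((surf n M).restrict Ω) (kernelMk hK)) =
      ∫ z in Ω ×ˢ Ω, F z * (K z.1 z.2).toReal ∂((surf n M).prod (surf n M)) := by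
  rw [jump, integral_withDensity_eq_integral_toReal_smul (measurable_kernelMk hK)
    (kernel_lt_top hP hR₀ hJ), prod_restrict_eq]
  refine integral_congr_ae (ae_restrict_of_ae ?_)
  filter_upwards [kernelMk_ae hK] with z hz
  rw [← hz, smul_eq_mul, mul_comm]

theorem compact_closure_ball (ρ : ℝ) : IsCompact (closure (ball (0 : Amb n) ρ)) :=
  (isCompact_closedBall 0 ρ).of_isClosed_subset isClosed_closure closure_ball_subset_closedBall

theorem enorm_sq_eq (a : ℝ) : ‖a‖ₑ ^ 2 = ENNReal.ofReal (a ^ 2) := by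
  rw [Real.enorm_eq_ofReal_abs, ← ENNReal.ofReal_pow (abs_nonneg a), sq_abs]

/-- Weak supersolutions are supersolutions in the energy sense. -/
theorem isSuper_of_weak [SFinite (surf n M)] (hP : Admissible n s cs Cs Λ)
    (hM : NullMeasurableSet M (μHE[n] : Measure (Amb n))) (hΩ : IsOpen Ω) {R d b₀ : ℝ}
    (hR : 0 < R) (hRR : 4 * R ≤ R₀) (hd : 0 ≤ d) (hb₀ : 0 ≤ b₀)
    (hMΩ : M ∩ ball 0 R₀ ⊆ Ω) (hK : IsTruncatedKernel n s Λ R₀ M Ω K)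
    (hJ : IsJumpSpace n s cs Cs Λ R₀ ((surf n M).restrict Ω) (kernelMk hK))
    {b f w w' : Amb n → ℝ} (hb : ∀ x ∈ M ∩ ball 0 (4 * R), b x ≤ b₀)
    (hf : ∀ x ∈ M ∩ ball 0 (4 * R), -d ≤ f x)
    (hw : IsWeakSupersolution n M (ball 0 (4 * R)) K b f w)
    (hw'm : Measurable w') (hw'0 : ∀ x, 0 ≤ w' x)
    (hww' : ∀ᵐ x ∂((surf n M).restrict Ω), w x = w' x) :
    IsSuper ((surf n M).restrict Ω) (kernelMk hK) R d b₀ w' := by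
  have hR₀ : 0 < R₀ := by linarith
  set μ := (surf n M).restrict Ω with hμ
  have hwz : ∀ᵐ z ∂((surf n M).prod (surf n M)), z ∈ Ω ×ˢ Ω → w z.1 = w' z.1 ∧ w z.2 = w' z.2 := by
    rw [← ae_restrict_iff' (hΩ.measurableSet.prod hΩ.measurableSet), ← prod_restrict_eq]
    exact (Measure.quasiMeasurePreserving_fst.ae hww').and
      (Measure.quasiMeasurePreserving_snd.ae hww')
  have hHK : ∀ ρ < 4 * R, MemHK n M (ball 0 ρ) K w := fun ρ hρ =>
    hw.1 _ isOpen_ball (compact_closure_ball ρ)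
      (closure_ball_subset_closedBall.trans (closedBall_subset_ball hρ))
  have hball : ∀ ρ < 4 * R, μ.restrict (ball 0 ρ) = (surf n M).restrict (ball 0 ρ) :=
    fun ρ hρ => restrict_ball_eq hΩ hMΩ (by linarith)
  have hwb : ∀ ρ < 4 * R, ∀ᵐ x ∂((surf n M).restrict (ball 0 ρ)), w x = w' x := fun ρ hρ => by
    rw [← hball ρ hρ]; exact ae_restrict_of_ae hww'
  have hsq : ∀ ρ < 4 * R, ∫⁻ x in ball 0 ρ, ENNReal.ofReal (w' x ^ 2) ∂μ < ∞ := by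
    intro ρ hρ
    have h1 := (hHK ρ hρ).2.1.integrable_sq.2
    rw [hasFiniteIntegral_iff_ofReal (ae_of_all _ fun x => sq_nonneg _)] at h1
    rw [hball ρ hρ]
    refine lt_of_eq_of_lt (lintegral_congr_ae ?_) h1
    filter_upwards [hwb ρ hρ] with x hx
    rw [hx]
  refine ⟨hw'm, hw'0, hsq, ?_, ?_⟩
  · intro ρ hρ
    have hind : Measurable ((ball (0 : Amb n) ρ).indicator (1 : Amb n → ℝ≥0∞)) :=
      measurable_one.indicator measurableSet_ball
    rw [lintegral_jump_surf hK (by fun_prop)]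
    refine lt_of_le_of_lt ?_ (hHK ρ hρ).2.2
    have hmS : MeasurableSet {z : Amb n × Amb n | z.1 ∈ ball 0 ρ ∨ z.2 ∈ ball 0 ρ} :=
      (measurableSet_ball.preimage measurable_fst).union
        (measurableSet_ball.preimage measurable_snd)
    rw [energy, ← lintegral_indicator hmS,
      ← lintegral_indicator (hΩ.measurableSet.prod hΩ.measurableSet)]
    refine lintegral_mono_ae ?_
    filter_upwards [hwz] with z hz
    by_cases hzΩ : z ∈ Ω ×ˢ Ω
    · rw [indicator_of_mem hzΩ]
      by_cases hz1 : z.1 ∈ ball 0 ρ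
      · rw [indicator_of_mem hz1, indicator_of_mem
          (show z ∈ {z : Amb n × Amb n | z.1 ∈ ball 0 ρ ∨ z.2 ∈ ball 0 ρ} from Or.inl hz1),
          Pi.one_apply, one_mul, (hz hzΩ).1, (hz hzΩ).2, enorm_sq_eq]
      · rw [indicator_of_notMem hz1]; simp
    · rw [indicator_of_notMem hzΩ]; exact bot_le
  · intro φ ρ B hρ hφm hφ0 hφB hφρ hφE
    have hρ4 : ball (0 : Amb n) ρ ⊆ ball 0 (4 * R) := ball_subset_ball hρ.le
    have hρ0 : ball (0 : Amb n) ρ ⊆ ball 0 R₀ := ball_subset_ball (by linarith)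
    have hsupp : Function.support φ ⊆ ball 0 ρ := fun x hx => by
      by_contra hcon; exact hx (hφρ x hcon)
    have hbfin : (surf n M) (ball 0 ρ) < ∞ := by
      have := ball_lt_top hJ (ρ := ρ) (by linarith)
      have h2 : ((surf n M).restrict (ball 0 ρ)) univ = (μ.restrict (ball 0 ρ)) univ := by
        rw [hball ρ hρ]
      rw [Measure.restrict_apply_univ, Measure.restrict_apply_univ] at h2
      rw [h2]; exact this
    have hoff := kernel_eq_zero_of_notMem hM hΩ hMΩ hK
    have hE : energy n M (ball 0 (4 * R)) K φ < ∞ := by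
      rw [energy]
      refine (setLIntegral_le_lintegral _ _).trans_lt (lt_of_le_of_lt ?_ hφE)
      rw [lintegral_jump_surf hK (by fun_prop),
        ← lintegral_indicator (hΩ.measurableSet.prod hΩ.measurableSet)]
      refine lintegral_mono_ae ?_
      filter_upwards [hoff] with z hz
      by_cases hzΩ : z ∈ Ω ×ˢ Ω
      · rw [indicator_of_mem hzΩ, enorm_sq_eq]
      · rcases hz hzΩ with h1 | h1
        · rw [h1]; simp
        · rw [hφρ z.1 fun h => h1.1 (hρ0 h), hφρ z.2 fun h => h1.2 (hρ0 h)]; simp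
    have hφbd : ∀ x, ‖φ x‖ ≤ B := fun x => by
      rw [Real.norm_eq_abs, abs_of_nonneg (hφ0 x)]; exact hφB x
    have hφL2 : MemLp φ 2 (surf n M) := by
      have h1 : MemLp φ 2 ((surf n M).restrict (ball 0 ρ)) := by
        have : IsFiniteMeasure ((surf n M).restrict (ball 0 ρ)) := ⟨by
          rwa [Measure.restrict_apply_univ]⟩
        exact MemLp.of_bound hφm.aestronglyMeasurable B (ae_of_all _ hφbd)
      have h2 : (ball 0 ρ).indicator φ = φ := indicator_eq_self.2 hsupp
      rw [← h2]
      exact (memLp_indicator_iff_restrict measurableSet_ball).2 h1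
    have hφHK : MemHK n M (ball 0 (4 * R)) K φ :=
      ⟨hφm.aemeasurable, hφL2.restrict _, hE⟩
    have key := hw.2 φ hφHK (fun x _ => hφ0 x) ⟨closedBall 0 ρ, isCompact_closedBall _ _,
      closedBall_subset_ball hρ, fun x _ hx => hφρ x fun h => hx (ball_subset_closedBall h)⟩
    have hint : ∀ g : Amb n → ℝ, ∫ x, g x * φ x ∂(surf n M) = ∫ x in ball 0 ρ, g x * φ x ∂μ := by
      intro g
      rw [hball ρ hρ]
      exact (setIntegral_eq_integral_of_forall_compl_eq_zero fun x hx => by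
        rw [hφρ x hx, mul_zero]).symm
    have hint' : ∀ g : Amb n → ℝ, ∫ x, g x * φ x ∂μ = ∫ x in ball 0 ρ, g x * φ x ∂μ := by
      intro g
      exact (setIntegral_eq_integral_of_forall_compl_eq_zero fun x hx => by
        rw [hφρ x hx, mul_zero]).symm
    have hfin : IsFiniteMeasure (μ.restrict (ball 0 ρ)) := ⟨by
      rw [Measure.restrict_apply_univ]; exact ball_lt_top hJ (by linarith)⟩
    have hmemM : ∀ᵐ x ∂(μ.restrict (ball 0 ρ)), x ∈ M ∩ ball 0 (4 * R) := by
      filter_upwards [ae_restrict_of_ae (ae_restrict_of_ae (ae_mem_surf hM)),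
        ae_restrict_mem measurableSet_ball] with x h1 h2 using ⟨h1, hρ4 h2⟩
    have hφi : Integrable φ (μ.restrict (ball 0 ρ)) :=
      Integrable.of_bound hφm.aestronglyMeasurable B (ae_of_all _ hφbd)
    have h1 : -d * ∫ x, φ x ∂μ ≤ ∫ x, f x * φ x ∂(surf n M) := by
      rw [hint, ← integral_const_mul, hint' fun _ => -d]
      by_cases hi : Integrable (fun x => f x * φ x) (μ.restrict (ball 0 ρ))
      · refine integral_mono_ae (hφi.const_mul _) hi ?_
        filter_upwards [hmemM] with x hx
        exact mul_le_mul_of_nonneg_right (hf x hx) (hφ0 x)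
      -- A non-integrable product has integral `0` by convention, and the inequality persists
      -- because the other side is non-positive.
      · rw [integral_undef hi]
        exact integral_nonpos fun x => mul_nonpos_of_nonpos_of_nonneg (by linarith) (hφ0 x)
    have h2 : ∫ x, b x * w x * φ x ∂(surf n M) ≤ b₀ * ∫ x, w' x * φ x ∂μ := by
      rw [hint fun x => b x * w x, hint', ← integral_const_mul]
      by_cases hi : Integrable (fun x => b x * w x * φ x) (μ.restrict (ball 0 ρ))
      · have hw'i : Integrable (fun x => w' x * φ x) (μ.restrict (ball 0 ρ)) := by
          have hw'2 : Integrable (fun x => w' x ^ 2) (μ.restrict (ball 0 ρ)) :=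
            integrable_of_lintegral_ofReal_lt_top (by fun_prop) (fun _ => sq_nonneg _) (hsq ρ hρ)
          refine ((hw'2.add (integrable_const 1)).const_mul B).mono' (by fun_prop)
            (ae_of_all _ fun x => ?_)
          rw [Real.norm_eq_abs, abs_of_nonneg (mul_nonneg (hw'0 x) (hφ0 x)), mul_comm]
          refine mul_le_mul (hφB x) ?_ (hw'0 x) ((hφ0 x).trans (hφB x))
          simp only [Pi.add_apply]
          nlinarith [sq_nonneg (w' x - 1)]
        refine integral_mono_ae hi (hw'i.const_mul _) ?_
        filter_upwards [hmemM, ae_restrict_of_ae hww'] with x hx hx'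
        rw [hx', mul_assoc]
        exact mul_le_mul_of_nonneg_right (hb x hx) (mul_nonneg (hw'0 x) (hφ0 x))
      · rw [integral_undef hi]
        exact integral_nonneg fun x => mul_nonneg hb₀ (mul_nonneg (hw'0 x) (hφ0 x))
    have h3 : ∫ z, (w z.1 - w z.2) * (φ z.1 - φ z.2) * (K z.1 z.2).toReal
        ∂((surf n M).prod (surf n M)) =
        ∫ z, (w' z.1 - w' z.2) * (φ z.1 - φ z.2) ∂(jump μ (kernelMk hK)) := by
      rw [integral_jump_surf hP hR₀ hK hJ]
      rw [← setIntegral_eq_integral_of_ae_compl_eq_zero (s := Ω ×ˢ Ω)]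
      · refine setIntegral_congr_ae (hΩ.measurableSet.prod hΩ.measurableSet) ?_
        filter_upwards [hwz] with z hz hzΩ
        rw [(hz hzΩ).1, (hz hzΩ).2]
      · filter_upwards [hoff] with z hz hzΩ
        rcases hz hzΩ with h1 | h1
        · rw [h1]; simp
        · rw [hφρ z.1 fun h => h1.1 (hρ0 h), hφρ z.2 fun h => h1.2 (hρ0 h)]; simp
    rw [h3] at key
    linarith

end NonlocalHarnack

/-! ### Truncated bilinear forms away from the diagonal. -/

namespace NonlocalHarnack

variable {n : ℕ} {s cs Cs Λ R₀ : ℝ} {μ : Measure (Amb n)} {K : Amb n → Amb n → ℝ≥0∞}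

/-- The pairs of points at distance at least `δ`. -/
def farPairs (n : ℕ) (δ : ℝ) : Set (Amb n × Amb n) := {z | δ ≤ dist z.1 z.2}

theorem measurableSet_farPairs (δ : ℝ) : MeasurableSet (farPairs n δ) :=
  measurableSet_le measurable_const (measurable_fst.dist measurable_snd)

/-- Away from the diagonal, the pairs starting in a ball have finite jump measure. Bounded functions
can thus be integrated there without any energy bound. -/
theorem jump_far_lt_top [SFinite μ] (hP : Admissible n s cs Cs Λ)
    (h : IsJumpSpace n s cs Cs Λ R₀ μ K) {δ ρ : ℝ} (hδ : 0 < δ) (hδR : δ ≤ R₀) (hρ : ρ ≤ R₀) :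
    ∫⁻ z in farPairs n δ, (ball (0 : Amb n) ρ).indicator 1 z.1 ∂(jump μ K) < ∞ := by
  have hind : Measurable ((ball (0 : Amb n) ρ).indicator (1 : Amb n → ℝ≥0∞)) :=
    measurable_one.indicator measurableSet_ball
  rw [← lintegral_indicator (measurableSet_farPairs δ), lintegral_jump h.measurable
    (Measurable.indicator (by fun_prop) (measurableSet_farPairs δ))]
  have hb : ∀ᵐ x ∂μ, ∫⁻ y, K x y * (farPairs n δ).indicator
      (fun z => (ball (0 : Amb n) ρ).indicator 1 z.1) (x, y) ∂μ ≤
      ENNReal.ofReal (upConst n s Cs Λ * δ ^ (-(2 * s))) *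
        (ball (0 : Amb n) ρ).indicator 1 x := by
    filter_upwards [lintegral_kernel_tail_le hP h] with x hx
    have e : ∀ y, K x y * (farPairs n δ).indicator
        (fun z => (ball (0 : Amb n) ρ).indicator 1 z.1) (x, y) =
        (ball x δ)ᶜ.indicator (K x) y * (ball (0 : Amb n) ρ).indicator 1 x := by
      intro y
      by_cases hy : y ∈ (ball x δ)ᶜ
      · have hy' : (x, y) ∈ farPairs n δ := by
          rw [mem_compl_iff, mem_ball, not_lt, dist_comm] at hy; exact hy
        rw [indicator_of_mem hy, indicator_of_mem hy']
      · have hy' : (x, y) ∉ farPairs n δ := by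
          rw [mem_compl_iff, mem_ball, not_lt, dist_comm] at hy; exact hy
        rw [indicator_of_notMem hy, indicator_of_notMem hy', mul_zero, zero_mul]
    simp_rw [e]
    have hKx : Measurable (K x) := h.measurable.comp measurable_prodMk_left
    rw [lintegral_mul_const _ (hKx.indicator measurableSet_ball.compl),
      lintegral_indicator measurableSet_ball.compl]
    exact mul_le_mul_left (hx δ hδ hδR) _
  refine (lintegral_mono_ae hb).trans_lt ?_
  rw [lintegral_const_mul _ hind, lintegral_indicator_one measurableSet_ball]
  exact ENNReal.mul_lt_top ENNReal.ofReal_lt_top (ball_lt_top h hρ)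

section Truncated

variable {w φ : Amb n → ℝ} {B B' δ ρ : ℝ}

theorem integrableOn_farPairs [SFinite μ] (hP : Admissible n s cs Cs Λ)
    (h : IsJumpSpace n s cs Cs Λ R₀ μ K) (hwm : Measurable w) (hw0 : ∀ x, 0 ≤ w x)
    (hwB : ∀ x, w x ≤ B) (hφm : Measurable φ) (hφB : ∀ x, |φ x| ≤ B')
    (hφρ : ∀ x ∉ ball 0 ρ, φ x = 0) (hρ : ρ ≤ R₀) (hδ : 0 < δ) (hδR : δ ≤ R₀) :
    IntegrableOn (fun z : Amb n × Amb n => φ z.1 * (w z.1 - w z.2)) (farPairs n δ)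
      (jump μ K) := by
  have hB0 : 0 ≤ B := (hw0 0).trans (hwB 0)
  have hB0' : 0 ≤ B' := (abs_nonneg _).trans (hφB 0)
  have hind : Measurable ((ball (0 : Amb n) ρ).indicator (1 : Amb n → ℝ)) :=
    measurable_one.indicator measurableSet_ball
  have i1 : Integrable (fun z : Amb n × Amb n => (ball (0 : Amb n) ρ).indicator (1 : Amb n → ℝ) z.1)
      ((jump μ K).restrict (farPairs n δ)) := by
    refine integrable_of_lintegral_ofReal_lt_top (by fun_prop)
      (fun z => indicator_nonneg (fun _ _ => zero_le_one) _) ?_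
    convert jump_far_lt_top hP h hδ hδR hρ using 3 with z
    by_cases hz : z.1 ∈ ball (0 : Amb n) ρ <;> simp [hz]
  refine (i1.const_mul (B' * B)).mono' (by fun_prop) (ae_of_all _ fun z => ?_)
  by_cases hz : z.1 ∈ ball (0 : Amb n) ρ
  · rw [indicator_of_mem hz, Pi.one_apply, mul_one, Real.norm_eq_abs, abs_mul]
    refine mul_le_mul (hφB _) ?_ (abs_nonneg _) hB0'
    rw [abs_le]
    constructor <;> linarith [hw0 z.1, hw0 z.2, hwB z.1, hwB z.2]
  · rw [hφρ _ hz, zero_mul, norm_zero, indicator_of_notMem hz, mul_zero]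

/-- Symmetrization of the truncated form. -/
theorem setIntegral_farPairs_symm [SFinite μ] (hP : Admissible n s cs Cs Λ)
    (h : IsJumpSpace n s cs Cs Λ R₀ μ K) (hwm : Measurable w) (hw0 : ∀ x, 0 ≤ w x)
    (hwB : ∀ x, w x ≤ B) (hφm : Measurable φ) (hφB : ∀ x, |φ x| ≤ B')
    (hφρ : ∀ x ∉ ball 0 ρ, φ x = 0) (hρ : ρ ≤ R₀) (hδ : 0 < δ) (hδR : δ ≤ R₀) :
    IntegrableOn (fun z : Amb n × Amb n => (w z.1 - w z.2) * (φ z.1 - φ z.2)) (farPairs n δ)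
      (jump μ K) ∧
    ∫ z in farPairs n δ, φ z.1 * (w z.1 - w z.2) ∂(jump μ K) =
      (1 / 2) * ∫ z in farPairs n δ, (w z.1 - w z.2) * (φ z.1 - φ z.2) ∂(jump μ K) := by
  have i1 := integrableOn_farPairs hP h hwm hw0 hwB hφm hφB hφρ hρ hδ hδR
  have hpre : Prod.swap ⁻¹' farPairs n δ = farPairs n δ := by
    ext z; simp only [farPairs, mem_preimage, mem_ofPred_eq, Prod.fst_swap, Prod.snd_swap, dist_comm]
  have hsw : MeasurePreserving Prod.swap ((jump μ K).restrict (farPairs n δ))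
      ((jump μ K).restrict (farPairs n δ)) := by
    have := (measurePreserving_swap_jump h).restrict_preimage (measurableSet_farPairs δ)
    rwa [hpre] at this
  have i2 : Integrable (fun z : Amb n × Amb n => φ z.swap.1 * (w z.swap.1 - w z.swap.2))
      ((jump μ K).restrict (farPairs n δ)) := hsw.integrable_comp_of_integrable i1
  have e2 : ∫ z in farPairs n δ, φ z.swap.1 * (w z.swap.1 - w z.swap.2) ∂(jump μ K) =
      ∫ z in farPairs n δ, φ z.1 * (w z.1 - w z.2) ∂(jump μ K) :=
    hsw.integral_comp MeasurableEquiv.prodComm.measurableEmbedding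
      (fun z : Amb n × Amb n => φ z.1 * (w z.1 - w z.2))
  have e3 : ∀ z : Amb n × Amb n, (w z.1 - w z.2) * (φ z.1 - φ z.2) =
      φ z.1 * (w z.1 - w z.2) + φ z.swap.1 * (w z.swap.1 - w z.swap.2) := by
    intro z; simp only [Prod.fst_swap, Prod.snd_swap]; ring
  simp_rw [e3]
  refine ⟨i1.add i2, ?_⟩
  rw [integral_add i1 i2, e2]
  ring

/-- The truncated form as an iterated integral. -/
theorem integral_mul_truncated [SFinite μ] (hP : Admissible n s cs Cs Λ)
    (h : IsJumpSpace n s cs Cs Λ R₀ μ K) (hwm : Measurable w) (hw0 : ∀ x, 0 ≤ w x)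
    (hwB : ∀ x, w x ≤ B) (hφm : Measurable φ) (hφB : ∀ x, |φ x| ≤ B')
    (hφρ : ∀ x ∉ ball 0 ρ, φ x = 0) (hρ : ρ ≤ R₀) (hδ : 0 < δ) (hδR : δ ≤ R₀) :
    Integrable (fun x => φ x * ∫ y in (ball x δ)ᶜ, (w x - w y) * (K x y).toReal ∂μ) μ ∧
    ∫ x, φ x * ∫ y in (ball x δ)ᶜ, (w x - w y) * (K x y).toReal ∂μ ∂μ =
      (1 / 2) * ∫ z in farPairs n δ, (w z.1 - w z.2) * (φ z.1 - φ z.2) ∂(jump μ K) := by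
  have hR₀ : 0 < R₀ := hδ.trans_le hδR
  have i1 := integrableOn_farPairs hP h hwm hw0 hwB hφm hφB hφρ hρ hδ hδR
  rw [← (setIntegral_farPairs_symm hP h hwm hw0 hwB hφm hφB hφρ hρ hδ hδR).2]
  rw [← integrable_indicator_iff (measurableSet_farPairs δ), jump,
    integrable_withDensity_iff_integrable_smul' h.measurable (kernel_lt_top hP hR₀ h)] at i1
  rw [← integral_indicator (measurableSet_farPairs δ), jump,
    integral_withDensity_eq_integral_toReal_smul h.measurable (kernel_lt_top hP hR₀ h),
    integral_prod _ i1]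
  have e : ∀ x, φ x * ∫ y in (ball x δ)ᶜ, (w x - w y) * (K x y).toReal ∂μ =
      ∫ y, (K x y).toReal • (farPairs n δ).indicator
        (fun z : Amb n × Amb n => φ z.1 * (w z.1 - w z.2)) (x, y) ∂μ := by
    intro x
    rw [← integral_indicator measurableSet_ball.compl, ← integral_const_mul]
    congr 1; ext y
    by_cases hy : y ∈ (ball x δ)ᶜ
    · have hy' : (x, y) ∈ farPairs n δ := by
        rw [mem_compl_iff, mem_ball, not_lt, dist_comm] at hy; exact hy
      rw [indicator_of_mem hy, indicator_of_mem hy', smul_eq_mul]; ring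
    · have hy' : (x, y) ∉ farPairs n δ := by
        rw [mem_compl_iff, mem_ball, not_lt, dist_comm] at hy; exact hy
      rw [indicator_of_notMem hy, indicator_of_notMem hy', smul_zero, mul_zero]
  simp_rw [e]
  exact ⟨i1.integral_prod_left, trivial⟩

end Truncated

/-- Truncated integrals control the full integral of a function vanishing on the diagonal. -/
theorem lintegral_le_of_farPairs {ν : Measure (Amb n × Amb n)} {G : Amb n × Amb n → ℝ≥0∞}
    (hG : ∀ x, G (x, x) = 0) {C : ℝ≥0∞}
    (hC : ∀ᶠ δ in 𝓝[>] (0 : ℝ), ∫⁻ z in farPairs n δ, G z ∂ν ≤ C) : ∫⁻ z, G z ∂ν ≤ C := by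
  have hanti : Monotone fun k : ℕ => farPairs n (1 / ((k : ℝ) + 1)) := by
    intro i j hij z hz
    simp only [farPairs, mem_ofPred_eq] at hz ⊢
    exact (one_div_le_one_div_of_le (by positivity) (by gcongr)).trans hz
  have hk : ∀ k : ℕ, ∫⁻ z in farPairs n (1 / ((k : ℝ) + 1)), G z ∂ν ≤ C := by
    intro k
    have hpos : (0 : ℝ) < 1 / ((k : ℝ) + 1) := by positivity
    obtain ⟨δ, hδ, hδ'⟩ := (hC.and (Ioo_mem_nhdsGT hpos)).exists
    refine (lintegral_mono_set ?_).trans hδ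
    intro z hz
    exact hδ'.2.le.trans hz
  -- Only diagonal points are missed by the union, and `G` vanishes on them.
  have hU : ∫⁻ z, G z ∂ν = ∫⁻ z in ⋃ k : ℕ, farPairs n (1 / ((k : ℝ) + 1)), G z ∂ν := by
    rw [← lintegral_indicator (MeasurableSet.iUnion fun k => measurableSet_farPairs _)]
    congr 1; ext z
    by_cases hz : z ∈ ⋃ k : ℕ, farPairs n (1 / ((k : ℝ) + 1))
    · rw [indicator_of_mem hz]
    · rw [indicator_of_notMem hz]
      have : z.1 = z.2 := by
        by_contra hne
        obtain ⟨k, hk⟩ := exists_nat_one_div_lt (dist_pos.2 hne)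
        exact hz (mem_iUnion.2 ⟨k, hk.le⟩)
      obtain ⟨x, y⟩ := z
      simp only at this
      rw [this, hG]
  rw [hU, setLIntegral_iUnion_of_directed _ hanti.directed_le]
  exact iSup_le hk

theorem tendsto_setIntegral_farPairs {ν : Measure (Amb n × Amb n)} {G : Amb n × Amb n → ℝ}
    (hGi : Integrable G ν) (hG : ∀ x, G (x, x) = 0) :
    Tendsto (fun δ => ∫ z in farPairs n δ, G z ∂ν) (𝓝[>] (0 : ℝ)) (𝓝 (∫ z, G z ∂ν)) := by
  simp_rw [← integral_indicator (measurableSet_farPairs _)]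
  refine tendsto_integral_filter_of_dominated_convergence (fun z => ‖G z‖)
    (Eventually.of_forall fun δ => hGi.aestronglyMeasurable.indicator (measurableSet_farPairs δ))
    (Eventually.of_forall fun δ => ae_of_all _ fun z => norm_indicator_le_norm_self _ _)
    hGi.norm (ae_of_all _ fun z => ?_)
  refine tendsto_const_nhds.congr' ?_
  by_cases hz : z.1 = z.2
  · obtain ⟨x, y⟩ := z
    simp only at hz
    refine Eventually.of_forall fun δ => ?_
    rw [hz, hG]
    change 0 = (farPairs n δ).indicator G (y, y)
    by_cases hm : (y, y) ∈ farPairs n δ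
    · rw [indicator_of_mem hm, hG]
    · rw [indicator_of_notMem hm]
  · filter_upwards [Ioo_mem_nhdsGT (dist_pos.2 hz)] with δ hδ
    rw [indicator_of_mem (show z ∈ farPairs n δ from hδ.2.le)]

end NonlocalHarnack

/-! ### A Caccioppoli inequality for truncated forms. -/

namespace NonlocalHarnack

variable {n : ℕ} {s cs Cs Λ R₀ : ℝ} {μ : Measure (Amb n)} {K : Amb n → Amb n → ℝ≥0∞}

theorem sq_sub_mul_le {a b p q B : ℝ} (hq0 : 0 ≤ q) (hq1 : q ≤ 1)
    (ha0 : 0 ≤ a) (haB : a ≤ B) :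
    (a * p - b * q) ^ 2 ≤ 2 * (a - b) ^ 2 + 2 * B ^ 2 * (p - q) ^ 2 := by
  have e : a * p - b * q = a * (p - q) + q * (a - b) := by ring
  have h1 : (a * (p - q)) ^ 2 ≤ B ^ 2 * (p - q) ^ 2 := by
    rw [mul_pow]
    exact mul_le_mul_of_nonneg_right (pow_le_pow_left₀ ha0 haB 2) (sq_nonneg _)
  have h2 : (q * (a - b)) ^ 2 ≤ (a - b) ^ 2 := by
    rw [mul_pow]
    exact mul_le_of_le_one_left (sq_nonneg _) (pow_le_one₀ hq0 hq1)
  rw [e]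
  nlinarith [sq_nonneg (a * (p - q) - q * (a - b))]

theorem energy_mul_le {u ψ : Amb n → ℝ} {B : ℝ} (hum : Measurable u) (hψm : Measurable ψ)
    (hu0 : ∀ x, 0 ≤ u x) (huB : ∀ x, u x ≤ B) (hψ0 : ∀ x, 0 ≤ ψ x) (hψ1 : ∀ x, ψ x ≤ 1)
    (ν : Measure (Amb n × Amb n)) :
    ∫⁻ z, ENNReal.ofReal ((u z.1 * ψ z.1 - u z.2 * ψ z.2) ^ 2) ∂ν ≤
      ENNReal.ofReal 2 * ∫⁻ z, ENNReal.ofReal ((u z.1 - u z.2) ^ 2) ∂ν +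
        ENNReal.ofReal (2 * B ^ 2) * ∫⁻ z, ENNReal.ofReal ((ψ z.1 - ψ z.2) ^ 2) ∂ν := by
  rw [← lintegral_const_mul _ (by fun_prop), ← lintegral_const_mul _ (by fun_prop),
    ← lintegral_add_left (by fun_prop)]
  refine lintegral_mono fun z => ?_
  rw [← ENNReal.ofReal_mul (by norm_num), ← ENNReal.ofReal_mul (by positivity),
    ← ENNReal.ofReal_add (by positivity) (by positivity)]
  exact ENNReal.ofReal_le_ofReal (sq_sub_mul_le (hψ0 _) (hψ1 _) (hu0 _) (huB _))

theorem energy_cutoff_lt_top [SFinite μ] (hP : Admissible n s cs Cs Λ)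
    (h : IsJumpSpace n s cs Cs Λ R₀ μ K) {a b : ℝ} (ha : 0 ≤ a) (hab : a < b) (hb : b ≤ R₀) :
    ∫⁻ z, ENNReal.ofReal ((cutoff a b z.1 - cutoff a b z.2) ^ 2) ∂(jump μ K) < ∞ := by
  have hm : Measurable (cutoff (n := n) a b) := (continuous_cutoff a b).measurable
  refine (lintegral_sq_le_two_mul h hm (measurableSet_ball (x := (0 : Amb n)) (ε := b))
    fun x hx => cutoff_eq_zero hab (by simpa using hx)).trans_lt ?_
  refine ENNReal.mul_lt_top (by norm_num) ((lintegral_jump_sq_le hP h hm (sub_pos.2 hab)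
    (by linarith) (abs_cutoff_sub_le hab) (abs_cutoff_sub_le_one a b)
    (measurable_one.indicator measurableSet_ball)).trans_lt ?_)
  rw [lintegral_indicator_one measurableSet_ball]
  exact ENNReal.mul_lt_top ENNReal.ofReal_lt_top (ball_lt_top h hb)

section Truncated

variable {w : Amb n → ℝ} {B R d b₀ : ℝ}

/-- The supersolution inequality for truncated forms, tested against products with `ψ`. -/
def IsTruncatedSuper (μ : Measure (Amb n)) (K : Amb n → Amb n → ℝ≥0∞) (R d b₀ : ℝ)
    (w ψ : Amb n → ℝ) : Prop :=
  ∀ (φ : Amb n → ℝ) (ρ B' κ : ℝ), ρ < 4 * R → Measurable φ → (∀ x, 0 ≤ φ x) →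
    (∀ x, φ x ≤ B') → (∀ x ∉ ball 0 ρ, φ x = 0) → 0 < κ →
    ∀ᶠ δ in 𝓝[>] (0 : ℝ), -d * ∫ x, φ x * ψ x ∂μ ≤
      (1 / 2) * ∫ z in farPairs n δ, (w z.1 - w z.2) * (φ z.1 * ψ z.1 - φ z.2 * ψ z.2)
          ∂(jump μ K) +
        b₀ * ∫ x, w x * (φ x * ψ x) ∂μ + κ * ∫ x, φ x * ψ x ∂μ

theorem integrable_of_bounded_ball (h : IsJumpSpace n s cs Cs Λ R₀ μ K) {φ : Amb n → ℝ} {B' ρ : ℝ}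
    (hφm : Measurable φ) (hφB : ∀ x, |φ x| ≤ B') (hφρ : ∀ x ∉ ball 0 ρ, φ x = 0)
    (hρ : ρ ≤ R₀) : Integrable φ μ := by
  have hfin : IsFiniteMeasure (μ.restrict (ball 0 ρ)) := ⟨by
    rw [Measure.restrict_apply_univ]; exact ball_lt_top h hρ⟩
  have h1 : IntegrableOn φ (ball 0 ρ) μ :=
    Integrable.of_bound hφm.aestronglyMeasurable B' (ae_of_all _ hφB)
  exact h1.integrable_of_forall_notMem_eq_zero hφρ

/-- A Caccioppoli inequality, uniform in the test factor `ψ`. -/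
theorem caccioppoli_truncated [SFinite μ] (hP : Admissible n s cs Cs Λ)
    (h : IsJumpSpace n s cs Cs Λ R₀ μ K) (hR : 0 < R) (hRR : 4 * R ≤ R₀)
    (hd : 0 ≤ d) (hb₀ : 0 ≤ b₀) (hwm : Measurable w) (hw0 : ∀ x, 0 ≤ w x) (hwB : ∀ x, w x ≤ B)
    {ψ : Amb n → ℝ} (hψm : Measurable ψ) (hψ0 : ∀ x, 0 ≤ ψ x) (hψ1 : ∀ x, ψ x ≤ 1)
    (hT : IsTruncatedSuper μ K R d b₀ w ψ) {η : Amb n → ℝ} (hηm : Measurable η)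
    (hη0 : ∀ x, 0 ≤ η x) (hη1 : ∀ x, η x ≤ 1) {ρ : ℝ} (hρ : ρ < 4 * R)
    (hηρ : ∀ x ∉ ball 0 ρ, η x = 0) :
    ∫⁻ z, ENNReal.ofReal ((η z.1 * (B - w z.1) * ψ z.1 - η z.2 * (B - w z.2) * ψ z.2) ^ 2)
        ∂(jump μ K) ≤
      ENNReal.ofReal (2 * (d + b₀ * B + 1) * (B * μ.real (ball 0 ρ))) +
      ENNReal.ofReal (B ^ 2) * (ENNReal.ofReal 2 * ∫⁻ z, ENNReal.ofReal ((η z.1 - η z.2) ^ 2)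
        ∂(jump μ K) + ENNReal.ofReal 2 * ∫⁻ z, ENNReal.ofReal ((ψ z.1 - ψ z.2) ^ 2)
        ∂(jump μ K)) := by
  have hB0 : 0 ≤ B := (hw0 0).trans (hwB 0)
  have hρR : ρ ≤ R₀ := by linarith
  set E : ℝ≥0∞ := ENNReal.ofReal 2 * ∫⁻ z, ENNReal.ofReal ((η z.1 - η z.2) ^ 2) ∂(jump μ K) +
    ENNReal.ofReal 2 * ∫⁻ z, ENNReal.ofReal ((ψ z.1 - ψ z.2) ^ 2) ∂(jump μ K) with hE
  rcases eq_or_ne (ENNReal.ofReal (B ^ 2) * E) ∞ with htop | htop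
  · rw [htop]; simp
  have hEτ : ∫⁻ z, ENNReal.ofReal ((η z.1 * ψ z.1 - η z.2 * ψ z.2) ^ 2) ∂(jump μ K) ≤ E := by
    have := energy_mul_le hηm hψm hη0 hη1 hψ0 hψ1 (jump μ K)
    rwa [one_pow, mul_one] at this
  -- `IsTruncatedSuper` multiplies by `ψ` once more, so the effective test function is `(ηψ)² (B -
  -- w)`, which is non-negative because `w ≤ B`.
  set φ : Amb n → ℝ := fun x => η x ^ 2 * ψ x * (B - w x) with hφ
  have hh0 : ∀ x, 0 ≤ B - w x := fun x => sub_nonneg.2 (hwB x)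
  have hhB : ∀ x, B - w x ≤ B := fun x => by linarith [hw0 x]
  have hφ0 : ∀ x, 0 ≤ φ x := fun x => mul_nonneg (mul_nonneg (sq_nonneg _) (hψ0 x)) (hh0 x)
  have hφB : ∀ x, φ x ≤ B := fun x => by
    refine (mul_le_of_le_one_left (hh0 x) ?_).trans (hhB x)
    exact mul_le_one₀ (pow_le_one₀ (hη0 x) (hη1 x)) (hψ0 x) (hψ1 x)
  have hφm : Measurable φ := by fun_prop
  have hφρ : ∀ x ∉ ball 0 ρ, φ x = 0 := fun x hx => by simp [hφ, hηρ x hx]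
  set φψ : Amb n → ℝ := fun x => φ x * ψ x with hφψ
  have hφψm : Measurable φψ := by fun_prop
  have hφψ0 : ∀ x, 0 ≤ φψ x := fun x => mul_nonneg (hφ0 x) (hψ0 x)
  have hφψB : ∀ x, φψ x ≤ B := fun x => (mul_le_of_le_one_right (hφ0 x) (hψ1 x)).trans (hφB x)
  have hφψabs : ∀ x, |φψ x| ≤ B := fun x => by rw [abs_of_nonneg (hφψ0 x)]; exact hφψB x
  have hφψρ : ∀ x ∉ ball 0 ρ, φψ x = 0 := fun x hx => by simp [hφψ, hφρ x hx]
  have hφψi := integrable_of_bounded_ball h hφψm hφψabs hφψρ hρR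
  have hbfin : μ (ball 0 ρ) ≠ ∞ := (ball_lt_top h hρR).ne
  have hIφ0 : 0 ≤ ∫ x, φψ x ∂μ := integral_nonneg hφψ0
  have hIφ : ∫ x, φψ x ∂μ ≤ B * μ.real (ball 0 ρ) := by
    have hi : Integrable ((ball (0 : Amb n) ρ).indicator fun _ => B) μ :=
      (integrable_indicator_iff measurableSet_ball).2 (integrableOn_const hbfin)
    calc ∫ x, φψ x ∂μ ≤ ∫ x, (ball (0 : Amb n) ρ).indicator (fun _ => B) x ∂μ := by
          refine integral_mono hφψi hi fun x => ?_
          by_cases hx : x ∈ ball (0 : Amb n) ρ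
          · rw [indicator_of_mem hx]; exact hφψB x
          · rw [indicator_of_notMem hx, hφψρ x hx]
      _ = B * μ.real (ball 0 ρ) := by
          rw [integral_indicator measurableSet_ball, setIntegral_const, smul_eq_mul, mul_comm]
  have hIwφ : ∫ x, w x * φψ x ∂μ ≤ B * ∫ x, φψ x ∂μ := by
    rw [← integral_const_mul]
    refine integral_mono_of_nonneg (ae_of_all _ fun x => mul_nonneg (hw0 x) (hφψ0 x))
      (hφψi.const_mul B) (ae_of_all _ fun x => ?_)
    exact mul_le_mul_of_nonneg_right (hwB x) (hφψ0 x)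
  refine lintegral_le_of_farPairs (fun x => by simp) ?_
  filter_upwards [hT φ ρ B 1 hρ hφm hφ0 hφB hφρ one_pos,
    Ioo_mem_nhdsGT (show (0 : ℝ) < R₀ by linarith)] with δ hδ hδ'
  have i1 := (setIntegral_farPairs_symm hP h hwm hw0 hwB hφψm hφψabs hφψρ hρR hδ'.1 hδ'.2.le).1
  set T : Amb n × Amb n → ℝ := fun z => (B - w z.1) * (B - w z.2) *
    (η z.1 * ψ z.1 - η z.2 * ψ z.2) ^ 2 with hTdef
  have hTm : Measurable T := by fun_prop
  have hT0 : ∀ z, 0 ≤ T z := fun z => mul_nonneg (mul_nonneg (hh0 _) (hh0 _)) (sq_nonneg _)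
  have hTle : ∫⁻ z in farPairs n δ, ENNReal.ofReal (T z) ∂(jump μ K) ≤
      ENNReal.ofReal (B ^ 2) * E := by
    refine (setLIntegral_le_lintegral _ _).trans ?_
    refine le_trans ?_ (mul_le_mul_right hEτ _)
    rw [← lintegral_const_mul _ (by fun_prop)]
    refine lintegral_mono fun z => ?_
    rw [← ENNReal.ofReal_mul (sq_nonneg _), sq B]
    exact ENNReal.ofReal_le_ofReal (mul_le_mul_of_nonneg_right
      (mul_le_mul (hhB _) (hhB _) (hh0 _) hB0) (sq_nonneg _))
  have iT : Integrable T ((jump μ K).restrict (farPairs n δ)) :=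
    integrable_of_lintegral_ofReal_lt_top hTm hT0 (hTle.trans_lt htop.lt_top)
  -- With `h = B - w` and `τ = ηψ` this is `(τ₁h₁ - τ₂h₂)² = h₁h₂ (τ₁ - τ₂)² + (h₁ - h₂)(τ₁²h₁ -
  -- τ₂²h₂)`, where `h₁ - h₂` is minus the difference of `w`.
  have e : ∀ z : Amb n × Amb n,
      (η z.1 * (B - w z.1) * ψ z.1 - η z.2 * (B - w z.2) * ψ z.2) ^ 2 =
        T z - (w z.1 - w z.2) * (φψ z.1 - φψ z.2) := by
    intro z; simp only [hTdef, hφψ, hφ]; ring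
  have iG : Integrable (fun z : Amb n × Amb n =>
      (η z.1 * (B - w z.1) * ψ z.1 - η z.2 * (B - w z.2) * ψ z.2) ^ 2)
      ((jump μ K).restrict (farPairs n δ)) := by
    simp_rw [e]; exact iT.sub i1
  rw [← ofReal_integral_eq_lintegral_ofReal iG (ae_of_all _ fun z => sq_nonneg _)]
  simp_rw [e]
  rw [integral_sub iT i1]
  have hb : -∫ z in farPairs n δ, (w z.1 - w z.2) * (φψ z.1 - φψ z.2) ∂(jump μ K) ≤
      2 * (d + b₀ * B + 1) * (B * μ.real (ball 0 ρ)) := by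
    have h1 : b₀ * ∫ x, w x * φψ x ∂μ ≤ b₀ * (B * ∫ x, φψ x ∂μ) :=
      mul_le_mul_of_nonneg_left hIwφ hb₀
    have h2 : 2 * (d + b₀ * B + 1) * ∫ x, φψ x ∂μ ≤
        2 * (d + b₀ * B + 1) * (B * μ.real (ball 0 ρ)) :=
      mul_le_mul_of_nonneg_left hIφ (by positivity)
    simp only [← hφψ] at hδ
    have hδ2 : -d * ∫ x, φψ x ∂μ ≤ (1 / 2) * ∫ z in farPairs n δ, (w z.1 - w z.2) *
        (φψ z.1 - φψ z.2) ∂(jump μ K) + b₀ * ∫ x, w x * φψ x ∂μ + 1 * ∫ x, φψ x ∂μ := hδ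
    linarith
  have hTi : ENNReal.ofReal (∫ z in farPairs n δ, T z ∂(jump μ K)) ≤ ENNReal.ofReal (B ^ 2) * E := by
    rw [ofReal_integral_eq_lintegral_ofReal iT (ae_of_all _ hT0)]; exact hTle
  calc _ ≤ ENNReal.ofReal (2 * (d + b₀ * B + 1) * (B * μ.real (ball 0 ρ)) +
        ∫ z in farPairs n δ, T z ∂(jump μ K)) := ENNReal.ofReal_le_ofReal (by linarith)
    _ ≤ _ := ENNReal.ofReal_add_le.trans (add_le_add_right hTi _)

end Truncated

end NonlocalHarnack

/-! ### Removing the truncation and the test factors. -/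

namespace NonlocalHarnack

variable {n : ℕ} {s cs Cs Λ R₀ : ℝ} {μ : Measure (Amb n)} {K : Amb n → Amb n → ℝ≥0∞}
variable {w : Amb n → ℝ} {B R d b₀ : ℝ} {ψ : ℕ → Amb n → ℝ}

/-- Finite energy is derived here from boundedness. The Caccioppoli bound for `η (B - w) ψ_j` is
eventually uniform in `j`, Fatou's lemma removes `ψ_j`, and `η = 1` on the given ball recovers `w`.
-/
theorem energy_of_truncated [SFinite μ] (hP : Admissible n s cs Cs Λ)
    (h : IsJumpSpace n s cs Cs Λ R₀ μ K) (hR : 0 < R) (hRR : 4 * R ≤ R₀)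
    (hd : 0 ≤ d) (hb₀ : 0 ≤ b₀) (hwm : Measurable w) (hw0 : ∀ x, 0 ≤ w x) (hwB : ∀ x, w x ≤ B)
    (hψm : ∀ j, Measurable (ψ j)) (hψ0 : ∀ j x, 0 ≤ ψ j x) (hψ1 : ∀ j x, ψ j x ≤ 1)
    (hψE : Tendsto (fun j => ∫⁻ z, ENNReal.ofReal ((ψ j z.1 - ψ j z.2) ^ 2) ∂(jump μ K)) atTop
      (𝓝 0))
    (hψt : ∀ᵐ x ∂μ, Tendsto (fun j => ψ j x) atTop (𝓝 1))
    (hT : ∀ j, IsTruncatedSuper μ K R d b₀ w (ψ j)) {ρ : ℝ} (hρ : ρ < 4 * R) :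
    ∫⁻ z, (ball 0 ρ).indicator 1 z.1 * ENNReal.ofReal ((w z.1 - w z.2) ^ 2) ∂(jump μ K) < ∞ := by
  have hB0 : 0 ≤ B := (hw0 0).trans (hwB 0)
  set a := max ρ 0 with ha
  have ha4 : a < 4 * R := max_lt hρ (by linarith)
  obtain ⟨b, hab, hb4⟩ := exists_between ha4
  set η : Amb n → ℝ := cutoff a b with hη
  have hηm : Measurable η := (continuous_cutoff a b).measurable
  have hηb : ∀ x ∉ ball 0 b, η x = 0 := fun x hx => cutoff_eq_zero hab (by simpa using hx)
  have hηE := energy_cutoff_lt_top hP h (le_max_right ρ 0) hab (hb4.le.trans hRR)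
  set C : ℝ≥0∞ := ENNReal.ofReal (2 * (d + b₀ * B + 1) * (B * μ.real (ball 0 b))) +
      ENNReal.ofReal (B ^ 2) * (ENNReal.ofReal 2 * ∫⁻ z, ENNReal.ofReal ((η z.1 - η z.2) ^ 2)
        ∂(jump μ K) + ENNReal.ofReal 2 * 1) with hC
  have hCtop : C < ∞ := by
    refine ENNReal.add_lt_top.2 ⟨ENNReal.ofReal_lt_top, ENNReal.mul_lt_top ENNReal.ofReal_lt_top
      (ENNReal.add_lt_top.2 ⟨ENNReal.mul_lt_top ENNReal.ofReal_lt_top hηE, ?_⟩)⟩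
    exact ENNReal.mul_lt_top ENNReal.ofReal_lt_top ENNReal.one_lt_top
  have hcac : ∀ᶠ j in atTop, ∫⁻ z, ENNReal.ofReal ((η z.1 * (B - w z.1) * ψ j z.1 -
      η z.2 * (B - w z.2) * ψ j z.2) ^ 2) ∂(jump μ K) ≤ C := by
    filter_upwards [hψE.eventually_le_const one_pos] with j hj
    refine (caccioppoli_truncated hP h hR hRR hd hb₀ hwm hw0 hwB (hψm j) (hψ0 j) (hψ1 j) (hT j) hηm
      (cutoff_nonneg a b) (cutoff_le_one a b) hb4 hηb).trans ?_
    rw [hC]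
    gcongr
  have hlim : ∫⁻ z, ENNReal.ofReal ((η z.1 * (B - w z.1) - η z.2 * (B - w z.2)) ^ 2)
      ∂(jump μ K) ≤ C := by
    have hF : ∀ j, Measurable fun z : Amb n × Amb n => ENNReal.ofReal
        ((η z.1 * (B - w z.1) * ψ j z.1 - η z.2 * (B - w z.2) * ψ j z.2) ^ 2) := fun j => by
      have := hψm j
      fun_prop
    calc _ ≤ ∫⁻ z, liminf (fun j => ENNReal.ofReal ((η z.1 * (B - w z.1) * ψ j z.1 -
          η z.2 * (B - w z.2) * ψ j z.2) ^ 2)) atTop ∂(jump μ K) := by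
          refine lintegral_mono_ae ?_
          filter_upwards [ae_jump_of_ae (K := K) hψt] with z hz
          refine le_of_eq (Tendsto.liminf_eq ?_).symm
          refine (ENNReal.continuous_ofReal.tendsto _).comp ?_
          have := ((hz.1.const_mul (η z.1 * (B - w z.1))).sub
            (hz.2.const_mul (η z.2 * (B - w z.2)))).pow 2
          simpa using this
      _ ≤ liminf (fun j => ∫⁻ z, ENNReal.ofReal ((η z.1 * (B - w z.1) * ψ j z.1 -
          η z.2 * (B - w z.2) * ψ j z.2) ^ 2) ∂(jump μ K)) atTop := lintegral_liminf_le hF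
      _ ≤ C := liminf_le_of_frequently_le' hcac.frequently
  have hpt : ∀ z : Amb n × Amb n,
      (ball 0 ρ).indicator 1 z.1 * ENNReal.ofReal ((w z.1 - w z.2) ^ 2) ≤
      ENNReal.ofReal 2 * ENNReal.ofReal ((η z.1 * (B - w z.1) - η z.2 * (B - w z.2)) ^ 2) +
        ENNReal.ofReal (2 * B ^ 2) * ENNReal.ofReal ((η z.1 - η z.2) ^ 2) := by
    intro z
    by_cases hz : z.1 ∈ ball (0 : Amb n) ρ
    · have h1 : η z.1 = 1 := cutoff_eq_one hab
        ((by simpa using hz : ‖z.1‖ < ρ).le.trans (le_max_left _ _))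
      rw [indicator_of_mem hz, Pi.one_apply, one_mul, ← ENNReal.ofReal_mul (by norm_num),
        ← ENNReal.ofReal_mul (by positivity), ← ENNReal.ofReal_add (by positivity) (by positivity)]
      refine ENNReal.ofReal_le_ofReal ?_
      rw [h1, one_mul]
      have h2 : (B - w z.2) ^ 2 ≤ B ^ 2 :=
        pow_le_pow_left₀ (sub_nonneg.2 (hwB _)) (by linarith [hw0 z.2]) 2
      have h3 := mul_le_mul_of_nonneg_right h2 (sq_nonneg (1 - η z.2))
      have e : w z.1 - w z.2 =
          (1 - η z.2) * (B - w z.2) - ((B - w z.1) - η z.2 * (B - w z.2)) := by ring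
      rw [e]
      nlinarith [sq_nonneg ((1 - η z.2) * (B - w z.2) + ((B - w z.1) - η z.2 * (B - w z.2)))]
    · rw [indicator_of_notMem hz, zero_mul]; exact bot_le
  refine (lintegral_mono hpt).trans_lt ?_
  rw [lintegral_add_left (by fun_prop), lintegral_const_mul _ (by fun_prop),
    lintegral_const_mul _ (by fun_prop)]
  exact ENNReal.add_lt_top.2 ⟨ENNReal.mul_lt_top ENNReal.ofReal_lt_top (hlim.trans_lt hCtop),
    ENNReal.mul_lt_top ENNReal.ofReal_lt_top hηE⟩

/-- Passing to the limit in truncated inequalities. -/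
theorem form_of_truncated [SFinite μ]
    (h : IsJumpSpace n s cs Cs Λ R₀ μ K) (hwm : Measurable w)
    {ψ : Amb n → ℝ} (hψm : Measurable ψ) (hψ0 : ∀ x, 0 ≤ ψ x) (hψ1 : ∀ x, ψ x ≤ 1)
    (hψE : ∫⁻ z, ENNReal.ofReal ((ψ z.1 - ψ z.2) ^ 2) ∂(jump μ K) < ∞)
    (hT : IsTruncatedSuper μ K R d b₀ w ψ) {φ : Amb n → ℝ} {ρ B' : ℝ} (hρ : ρ < 4 * R)
    (hwE : ∫⁻ z, (ball 0 ρ).indicator 1 z.1 * ENNReal.ofReal ((w z.1 - w z.2) ^ 2)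
      ∂(jump μ K) < ∞)
    (hφm : Measurable φ) (hφ0 : ∀ x, 0 ≤ φ x) (hφB : ∀ x, φ x ≤ B')
    (hφρ : ∀ x ∉ ball 0 ρ, φ x = 0)
    (hφE : ∫⁻ z, ENNReal.ofReal ((φ z.1 - φ z.2) ^ 2) ∂(jump μ K) < ∞) :
    Integrable (fun z : Amb n × Amb n => (w z.1 - w z.2) * (φ z.1 * ψ z.1 - φ z.2 * ψ z.2))
      (jump μ K) ∧
    -d * ∫ x, φ x * ψ x ∂μ ≤
      (1 / 2) * ∫ z, (w z.1 - w z.2) * (φ z.1 * ψ z.1 - φ z.2 * ψ z.2) ∂(jump μ K) +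
        b₀ * ∫ x, w x * (φ x * ψ x) ∂μ := by
  have hE : ∫⁻ z, ENNReal.ofReal ((φ z.1 * ψ z.1 - φ z.2 * ψ z.2) ^ 2) ∂(jump μ K) < ∞ :=
    (energy_mul_le hφm hψm hφ0 hφB hψ0 hψ1 _).trans_lt (ENNReal.add_lt_top.2
      ⟨ENNReal.mul_lt_top ENNReal.ofReal_lt_top hφE,
        ENNReal.mul_lt_top ENNReal.ofReal_lt_top hψE⟩)
  have hi := integrable_form h hwm (hφm.mul hψm) measurableSet_ball hwE
    (fun x hx => by simp [hφρ x hx]) hE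
  refine ⟨hi, ?_⟩
  have hlim := tendsto_setIntegral_farPairs hi fun x => by simp
  have hI0 : 0 ≤ ∫ x, φ x * ψ x ∂μ := integral_nonneg fun x => mul_nonneg (hφ0 x) (hψ0 x)
  have hκ : ∀ κ : ℝ, 0 < κ → -d * ∫ x, φ x * ψ x ∂μ ≤
      (1 / 2) * ∫ z, (w z.1 - w z.2) * (φ z.1 * ψ z.1 - φ z.2 * ψ z.2) ∂(jump μ K) +
        b₀ * ∫ x, w x * (φ x * ψ x) ∂μ + κ * ∫ x, φ x * ψ x ∂μ := fun κ hκ =>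
    ge_of_tendsto (((hlim.const_mul (1 / 2)).add_const _).add_const _)
      (hT φ ρ B' κ hρ hφm hφ0 hφB hφρ hκ)
  have hc : Tendsto (fun κ : ℝ =>
      (1 / 2) * ∫ z, (w z.1 - w z.2) * (φ z.1 * ψ z.1 - φ z.2 * ψ z.2) ∂(jump μ K) +
        b₀ * ∫ x, w x * (φ x * ψ x) ∂μ + κ * ∫ x, φ x * ψ x ∂μ) (𝓝[>] 0)
      (𝓝 ((1 / 2) * ∫ z, (w z.1 - w z.2) * (φ z.1 * ψ z.1 - φ z.2 * ψ z.2) ∂(jump μ K) +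
        b₀ * ∫ x, w x * (φ x * ψ x) ∂μ + 0 * ∫ x, φ x * ψ x ∂μ)) :=
    ((tendsto_id.mono_left nhdsWithin_le_nhds).mul_const _).const_add _
  rw [zero_mul, add_zero] at hc
  exact ge_of_tendsto hc (eventually_nhdsWithin_of_forall hκ)

/-- The product difference splits as `φ₁ψ₁ - φ₂ψ₂ = ψ₂ (φ₁ - φ₂) + φ₁ (ψ₁ - ψ₂)`. Paired with `w₁ -
w₂`, the first part converges by domination. Young's inequality bounds the second by `ε` times the
energy of `w` plus `ε⁻¹` times the energy of `ψ_j`, up to the factor `B'`, so `j → ∞` precedes `ε →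
0`. -/
theorem isSuper_of_truncated [SFinite μ] (hP : Admissible n s cs Cs Λ)
    (h : IsJumpSpace n s cs Cs Λ R₀ μ K) (hR : 0 < R) (hRR : 4 * R ≤ R₀)
    (hd : 0 ≤ d) (hb₀ : 0 ≤ b₀) (hwm : Measurable w) (hw0 : ∀ x, 0 ≤ w x) (hwB : ∀ x, w x ≤ B)
    (hψm : ∀ j, Measurable (ψ j)) (hψ0 : ∀ j x, 0 ≤ ψ j x) (hψ1 : ∀ j x, ψ j x ≤ 1)
    (hψE : ∀ j, ∫⁻ z, ENNReal.ofReal ((ψ j z.1 - ψ j z.2) ^ 2) ∂(jump μ K) < ∞)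
    (hψE' : Tendsto (fun j => ∫⁻ z, ENNReal.ofReal ((ψ j z.1 - ψ j z.2) ^ 2) ∂(jump μ K)) atTop
      (𝓝 0))
    (hψt : ∀ᵐ x ∂μ, Tendsto (fun j => ψ j x) atTop (𝓝 1))
    (hT : ∀ j, IsTruncatedSuper μ K R d b₀ w (ψ j)) : IsSuper μ K R d b₀ w := by
  have hB0 : 0 ≤ B := (hw0 0).trans (hwB 0)
  have hwE : ∀ ρ < 4 * R, _ := fun ρ hρ =>
    energy_of_truncated hP h hR hRR hd hb₀ hwm hw0 hwB hψm hψ0 hψ1 hψE' hψt hT hρ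
  refine ⟨hwm, hw0, fun ρ hρ => ?_, hwE, ?_⟩
  · refine (setLIntegral_mono' measurableSet_ball fun x _ => ENNReal.ofReal_le_ofReal
      (pow_le_pow_left₀ (hw0 x) (hwB x) 2)).trans_lt ?_
    rw [setLIntegral_const]
    exact ENNReal.mul_lt_top ENNReal.ofReal_lt_top (ball_lt_top h (by linarith))
  intro φ ρ B' hρ hφm hφ0 hφB hφρ hφE
  have hφabs : ∀ x, |φ x| ≤ B' := fun x => by rw [abs_of_nonneg (hφ0 x)]; exact hφB x
  have hB0' : 0 ≤ B' := (hφ0 0).trans (hφB 0)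
  have hρR : ρ ≤ R₀ := by linarith
  have hφi := integrable_of_bounded_ball h hφm hφabs hφρ hρR
  have hwφi : Integrable (fun x => w x * φ x) μ :=
    (hφi.const_mul B).mono' (by fun_prop) (ae_of_all _ fun x => by
      rw [Real.norm_eq_abs, abs_of_nonneg (mul_nonneg (hw0 x) (hφ0 x))]
      exact mul_le_mul_of_nonneg_right (hwB x) (hφ0 x))
  have hform := integrable_form h hwm hφm measurableSet_ball (hwE ρ hρ) hφρ hφE
  have hind : Measurable ((ball (0 : Amb n) ρ).indicator (1 : Amb n → ℝ)) :=
    measurable_one.indicator measurableSet_ball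
  set EW : Amb n × Amb n → ℝ := fun z =>
    (ball (0 : Amb n) ρ).indicator (1 : Amb n → ℝ) z.1 * (w z.1 - w z.2) ^ 2 with hEW
  have iEW : Integrable EW (jump μ K) := by
    refine integrable_of_lintegral_ofReal_lt_top (by fun_prop)
      (fun z => mul_nonneg (indicator_nonneg (fun _ _ => zero_le_one) _) (sq_nonneg _)) ?_
    convert hwE ρ hρ using 3 with z
    by_cases hz : z.1 ∈ ball (0 : Amb n) ρ <;> simp [hEW, hz]
  have iψ : ∀ j, Integrable (fun z : Amb n × Amb n => (ψ j z.1 - ψ j z.2) ^ 2) (jump μ K) :=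
    fun j => integrable_of_lintegral_ofReal_lt_top (by have := hψm j; fun_prop)
      (fun _ => sq_nonneg _) (hψE j)
  have lψ : Tendsto (fun j => ∫ z, (ψ j z.1 - ψ j z.2) ^ 2 ∂(jump μ K)) atTop (𝓝 0) := by
    have h1 : ∀ j, ∫ z, (ψ j z.1 - ψ j z.2) ^ 2 ∂(jump μ K) =
        (∫⁻ z, ENNReal.ofReal ((ψ j z.1 - ψ j z.2) ^ 2) ∂(jump μ K)).toReal := fun j =>
      integral_eq_lintegral_of_nonneg_ae (ae_of_all _ fun z => sq_nonneg _)
        (by have := hψm j; fun_prop)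
    simp_rw [h1]
    have h2 := (ENNReal.tendsto_toReal ENNReal.zero_ne_top).comp hψE'
    rwa [ENNReal.toReal_zero] at h2
  have l1 : Tendsto (fun j => ∫ x, φ x * ψ j x ∂μ) atTop (𝓝 (∫ x, φ x ∂μ)) := by
    refine tendsto_integral_of_dominated_convergence φ
      (fun j => by have := hψm j; fun_prop) hφi (fun j => ae_of_all _ fun x => ?_) ?_
    · rw [Real.norm_eq_abs, abs_of_nonneg (mul_nonneg (hφ0 x) (hψ0 j x))]
      exact mul_le_of_le_one_right (hφ0 x) (hψ1 j x)
    · filter_upwards [hψt] with x hx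
      simpa using hx.const_mul (φ x)
  have l2 : Tendsto (fun j => ∫ x, w x * (φ x * ψ j x) ∂μ) atTop (𝓝 (∫ x, w x * φ x ∂μ)) := by
    refine tendsto_integral_of_dominated_convergence (fun x => w x * φ x)
      (fun j => by have := hψm j; fun_prop) hwφi (fun j => ae_of_all _ fun x => ?_) ?_
    · rw [Real.norm_eq_abs, ← mul_assoc,
        abs_of_nonneg (mul_nonneg (mul_nonneg (hw0 x) (hφ0 x)) (hψ0 j x))]
      exact mul_le_of_le_one_right (mul_nonneg (hw0 x) (hφ0 x)) (hψ1 j x)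
    · filter_upwards [hψt] with x hx
      simpa using (hx.const_mul (φ x)).const_mul (w x)
  have iD : ∀ j, Integrable (fun z : Amb n × Amb n =>
      ψ j z.2 * ((w z.1 - w z.2) * (φ z.1 - φ z.2))) (jump μ K) := fun j => by
    refine hform.norm.mono' (by have := hψm j; fun_prop) (ae_of_all _ fun z => ?_)
    rw [norm_mul]
    refine mul_le_of_le_one_left (norm_nonneg _) ?_
    rw [Real.norm_eq_abs, abs_of_nonneg (hψ0 j _)]
    exact hψ1 j _
  have l3 : Tendsto (fun j => ∫ z, ψ j z.2 * ((w z.1 - w z.2) * (φ z.1 - φ z.2)) ∂(jump μ K)) atTop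
      (𝓝 (∫ z, (w z.1 - w z.2) * (φ z.1 - φ z.2) ∂(jump μ K))) := by
    refine tendsto_integral_of_dominated_convergence
      (fun z => ‖(w z.1 - w z.2) * (φ z.1 - φ z.2)‖)
      (fun j => (iD j).aestronglyMeasurable) hform.norm (fun j => ae_of_all _ fun z => ?_) ?_
    · rw [norm_mul]
      refine mul_le_of_le_one_left (norm_nonneg _) ?_
      rw [Real.norm_eq_abs, abs_of_nonneg (hψ0 j _)]
      exact hψ1 j _
    · filter_upwards [ae_jump_of_ae (K := K) hψt] with z hz
      simpa using hz.2.mul_const ((w z.1 - w z.2) * (φ z.1 - φ z.2))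
  -- The term `ε⁻¹ * 0` is the limit in `j` of `ε⁻¹` times the energy of `ψ j`.
  have hε : ∀ ε : ℝ, 0 < ε → -d * ∫ x, φ x ∂μ ≤
      (1 / 2) * ((∫ z, (w z.1 - w z.2) * (φ z.1 - φ z.2) ∂(jump μ K)) +
        B' * (ε * (∫ z, EW z ∂(jump μ K)) + ε⁻¹ * 0)) + b₀ * ∫ x, w x * φ x ∂μ := by
    intro ε hε
    refine le_of_tendsto_of_tendsto' (l1.const_mul (-d)) (((l3.add
      (((lψ.const_mul ε⁻¹).const_add (ε * (∫ z, EW z ∂(jump μ K)))).const_mul B')).const_mul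
        (1 / 2)).add (l2.const_mul b₀)) fun j => ?_
    obtain ⟨hi, hle⟩ := form_of_truncated h hwm (hψm j) (hψ0 j) (hψ1 j) (hψE j) (hT j)
      hρ (hwE ρ hρ) hφm hφ0 hφB hφρ hφE
    refine hle.trans ?_
    gcongr
    have i0 : Integrable (fun z : Amb n × Amb n =>
        B' * (ε * EW z + ε⁻¹ * (ψ j z.1 - ψ j z.2) ^ 2)) (jump μ K) :=
      ((iEW.const_mul ε).add ((iψ j).const_mul ε⁻¹)).const_mul B'
    have e1 : ∫ z, ψ j z.2 * ((w z.1 - w z.2) * (φ z.1 - φ z.2)) ∂(jump μ K) +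
        B' * (ε * (∫ z, EW z ∂(jump μ K)) + ε⁻¹ * ∫ z, (ψ j z.1 - ψ j z.2) ^ 2 ∂(jump μ K)) =
        ∫ z, (ψ j z.2 * ((w z.1 - w z.2) * (φ z.1 - φ z.2)) +
          B' * (ε * EW z + ε⁻¹ * (ψ j z.1 - ψ j z.2) ^ 2)) ∂(jump μ K) := by
      rw [integral_add (iD j) i0,
        integral_const_mul, integral_add (iEW.const_mul ε) ((iψ j).const_mul ε⁻¹),
        integral_const_mul, integral_const_mul]
    rw [e1]
    refine integral_mono hi ((iD j).add i0) fun z => ?_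
    have e2 : (w z.1 - w z.2) * (φ z.1 * ψ j z.1 - φ z.2 * ψ j z.2) =
        ψ j z.2 * ((w z.1 - w z.2) * (φ z.1 - φ z.2)) +
          φ z.1 * ((w z.1 - w z.2) * (ψ j z.1 - ψ j z.2)) := by ring
    simp only [e2]
    refine add_le_add_right ?_ _
    by_cases hz : z.1 ∈ ball (0 : Amb n) ρ
    · have hy : (w z.1 - w z.2) * (ψ j z.1 - ψ j z.2) ≤
          ε * (w z.1 - w z.2) ^ 2 + ε⁻¹ * (ψ j z.1 - ψ j z.2) ^ 2 := by
        have h1 := sq_nonneg (ε * (w z.1 - w z.2) - (ψ j z.1 - ψ j z.2))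
        have h2 := mul_nonneg (inv_nonneg.2 hε.le) h1
        have h3 : ε⁻¹ * (ε * (w z.1 - w z.2) - (ψ j z.1 - ψ j z.2)) ^ 2 =
            ε * (w z.1 - w z.2) ^ 2 - 2 * ((w z.1 - w z.2) * (ψ j z.1 - ψ j z.2)) +
              ε⁻¹ * (ψ j z.1 - ψ j z.2) ^ 2 := by field_simp; ring
        have h4 : 0 ≤ ε * (w z.1 - w z.2) ^ 2 := by positivity
        have h5 : 0 ≤ ε⁻¹ * (ψ j z.1 - ψ j z.2) ^ 2 := by positivity
        linarith
      simp only [hEW, indicator_of_mem hz, Pi.one_apply, one_mul]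
      exact (mul_le_mul_of_nonneg_left hy (hφ0 _)).trans
        (mul_le_mul_of_nonneg_right (hφB _) (by positivity))
    · rw [hφρ _ hz, zero_mul]
      simp only [hEW, indicator_of_notMem hz, zero_mul, mul_zero, zero_add]
      positivity
  have hc : Tendsto (fun ε : ℝ => (1 / 2) * ((∫ z, (w z.1 - w z.2) * (φ z.1 - φ z.2) ∂(jump μ K)) +
        B' * (ε * (∫ z, EW z ∂(jump μ K)) + ε⁻¹ * 0)) + b₀ * ∫ x, w x * φ x ∂μ) (𝓝[>] 0)
      (𝓝 ((1 / 2) * ((∫ z, (w z.1 - w z.2) * (φ z.1 - φ z.2) ∂(jump μ K)) +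
        B' * (0 * (∫ z, EW z ∂(jump μ K)))) + b₀ * ∫ x, w x * φ x ∂μ)) := by
    simp only [mul_zero, add_zero]
    exact (((((tendsto_id.mono_left nhdsWithin_le_nhds).mul_const _).const_mul B').const_add
      _).const_mul _).add_const _
  rw [zero_mul, mul_zero, add_zero] at hc
  exact ge_of_tendsto hc (eventually_nhdsWithin_of_forall hε)

end NonlocalHarnack

/-! ### Capacity factors and generalized pointwise supersolutions. -/

namespace NonlocalHarnack

variable {n : ℕ} {s cs Cs Λ R₀ : ℝ} {M Ω : Set (Amb n)} {K : Amb n → Amb n → ℝ≥0∞}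

/-- Functions of small norm near a set of capacity zero. -/
theorem exists_hsNormSq_lt {Z : Set (Amb n)} (hn : 1 ≤ n) (hZ1 : n = 1 → Z = ∅)
    (hZ2 : 2 ≤ n → fracCap n s M Ω Z = 0) {ε : ℝ≥0∞} (hε : 0 < ε) :
    ∃ v : Amb n → ℝ, AEMeasurable v ((surf n M).restrict Ω) ∧
      (∃ O : Set (Amb n), IsOpen O ∧ Z ⊆ O ∧ ∀ᵐ x ∂((surf n M).restrict (Ω ∩ O)), 1 ≤ v x) ∧
      hsNormSq n s M Ω v < ε := by
  rcases hn.eq_or_lt with h1 | h2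
  · refine ⟨0, aemeasurable_const, ⟨∅, isOpen_empty, (hZ1 h1.symm).subset, by simp⟩, ?_⟩
    simpa [hsNormSq] using hε
  · have h := hZ2 h2
    rw [fracCap] at h
    rw [← h] at hε
    simp only [iInf_lt_iff] at hε
    obtain ⟨v, hv, hO, hlt⟩ := hε
    exact ⟨v, hv, hO, hlt⟩

/-- A measurable factor vanishing near a set of capacity zero, with small energy. -/
theorem exists_factor [SFinite (surf n M)] (hP : Admissible n s cs Cs Λ)
    (hK : IsTruncatedKernel n s Λ R₀ M Ω K)
    (hJ : IsJumpSpace n s cs Cs Λ R₀ ((surf n M).restrict Ω) (kernelMk hK))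
    {Z : Set (Amb n)} (hZ1 : n = 1 → Z = ∅)
    (hZ2 : 2 ≤ n → fracCap n s M Ω Z = 0) {ε : ℝ≥0∞} (hε : 0 < ε) :
    ∃ (ψ : Amb n → ℝ) (O : Set (Amb n)), IsOpen O ∧ Z ⊆ O ∧ Measurable ψ ∧ (∀ x, 0 ≤ ψ x) ∧
      (∀ x, ψ x ≤ 1) ∧ (∀ x ∈ O, ψ x = 0) ∧
      ∫⁻ x, ENNReal.ofReal ((1 - ψ x) ^ 2) ∂((surf n M).restrict Ω) ≤ ε ∧
      ∫⁻ z, ENNReal.ofReal ((ψ z.1 - ψ z.2) ^ 2)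
        ∂(jump ((surf n M).restrict Ω) (kernelMk hK)) ≤ ENNReal.ofReal Λ * ε := by
  obtain ⟨v, hv, ⟨O, hO, hZO, hvO⟩, hlt⟩ := exists_hsNormSq_lt hP.one_le hZ1 hZ2 hε
  set μ := (surf n M).restrict Ω with hμ
  set u := hv.mk v with hu
  have hum : Measurable u := hv.measurable_mk
  have huv : ∀ᵐ x ∂μ, v x = u x := hv.ae_eq_mk
  -- As `v ≥ 1` almost everywhere in `O`, the indicator changes `1 - min 1 (max 0 v)` only on a null
  -- set, but it makes `ψ` vanish at every point of `O`.
  set ψ : Amb n → ℝ := Oᶜ.indicator fun x => 1 - min 1 (max 0 (u x)) with hψ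
  have hc0 : ∀ t : ℝ, 0 ≤ min 1 (max 0 t) := fun t => le_min zero_le_one (le_max_left _ _)
  have hc1 : ∀ t : ℝ, min 1 (max 0 t) ≤ 1 := fun t => min_le_left _ _
  have hψm : Measurable ψ := Measurable.indicator (by fun_prop) hO.measurableSet.compl
  have hψae : ∀ᵐ x ∂μ, ψ x = 1 - min 1 (max 0 (v x)) := by
    have h1 : ∀ᵐ x ∂μ, x ∈ O → 1 ≤ v x := by
      rw [inter_comm, ← Measure.restrict_restrict hO.measurableSet,
        ae_restrict_iff' hO.measurableSet] at hvO
      exact hvO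
    filter_upwards [h1, huv] with x h2 h3
    by_cases hx : x ∈ O
    · rw [hψ, indicator_of_notMem (by simpa using hx),
        max_eq_right (zero_le_one.trans (h2 hx)), min_eq_left (h2 hx), sub_self]
    · rw [hψ, indicator_of_mem (by simpa using hx), h3]
  rw [hsNormSq] at hlt
  refine ⟨ψ, O, hO, hZO, hψm, ?_, ?_, ?_, ?_, ?_⟩
  · exact fun x => indicator_nonneg (fun x _ => sub_nonneg.2 (hc1 _)) x
  · exact fun x => indicator_le_self' (fun _ _ => sub_nonneg.2 (hc1 _)) x |>.trans
      (by linarith [hc0 (u x)])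
  · exact fun x hx => indicator_of_notMem (by simpa using hx) _
  · refine le_trans ?_ ((le_add_of_nonneg_right bot_le).trans hlt.le)
    refine lintegral_mono_ae ?_
    filter_upwards [hψae] with x hx
    rw [hx, enorm_sq_eq, sub_sub_cancel]
    refine ENNReal.ofReal_le_ofReal (sq_le_sq.2 ?_)
    rw [abs_of_nonneg (hc0 _)]
    exact (min_le_right _ _).trans (max_le (abs_nonneg _) (le_abs_self _))
  · refine le_trans ?_ (mul_le_mul_right ((le_add_of_nonneg_left bot_le).trans hlt.le) _)
    rw [lintegral_jump hJ.measurable (by fun_prop),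
      ← lintegral_const_mul' _ _ ENNReal.ofReal_ne_top]
    refine lintegral_mono_ae ?_
    filter_upwards [ae_ae_upper hJ, hψae] with x hx hx'
    rw [← lintegral_const_mul' _ _ ENNReal.ofReal_ne_top]
    refine lintegral_mono_ae ?_
    filter_upwards [hx, hψae] with y hy hy'
    rw [hx', hy', div_eq_mul_inv, mul_comm (‖v x - v y‖ₑ ^ 2), ← mul_assoc, enorm_sq_eq]
    refine mul_le_mul' hy (ENNReal.ofReal_le_ofReal (sq_le_sq.2 ?_))
    rw [sub_sub_sub_cancel_left, abs_sub_comm]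
    refine (abs_min_sub_min_le_max _ _ _ _).trans ?_
    rw [sub_self, abs_zero, max_eq_right (abs_nonneg _)]
    refine (abs_max_sub_max_le_max _ _ _ _).trans ?_
    rw [sub_self, abs_zero, max_eq_right (abs_nonneg _)]

/-- The product `φψ` lives on a closed ball minus `O`, a compact set avoiding the exceptional set.
There the truncated operators converge uniformly, so for small `δ` the pointwise inequality holds up
to `κ`. It is multiplied by `φψ`, integrated, and symmetrized by `integral_mul_truncated`. -/
theorem isTruncatedSuper_of_pointwise [SFinite (surf n M)] (hP : Admissible n s cs Cs Λ)
    (hM : NullMeasurableSet M (μHE[n] : Measure (Amb n))) {R d b₀ : ℝ}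
    (hR : 0 < R) (hRR : 4 * R ≤ R₀) (hK : IsTruncatedKernel n s Λ R₀ M Ω K)
    (hJ : IsJumpSpace n s cs Cs Λ R₀ ((surf n M).restrict Ω) (kernelMk hK))
    {b f w w' L : Amb n → ℝ} {B : ℝ} (hb : ∀ x ∈ M ∩ ball 0 (4 * R), b x ≤ b₀)
    (hf : ∀ x ∈ M ∩ ball 0 (4 * R), -d ≤ f x) {Z : Set (Amb n)}
    (hunif : ∀ C : Set (Amb n), IsCompact C → C ⊆ ball 0 (4 * R) \ Z →
        TendstoUniformlyOn (fun δ : ℝ => truncLK n M Ω K w δ) L (𝓝[>] 0) (M ∩ C))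
    (hL : ∀ x ∈ (M ∩ ball 0 (4 * R)) \ Z, f x ≤ -L x + b x * w x)
    (hw'm : Measurable w') (hw'0 : ∀ x, 0 ≤ w' x) (hw'B : ∀ x, w' x ≤ B)
    (hww' : ∀ᵐ x ∂((surf n M).restrict Ω), w x = w' x)
    {ψ : Amb n → ℝ} {O : Set (Amb n)} (hO : IsOpen O) (hZO : Z ⊆ O) (hψm : Measurable ψ)
    (hψ0 : ∀ x, 0 ≤ ψ x) (hψ1 : ∀ x, ψ x ≤ 1) (hψO : ∀ x ∈ O, ψ x = 0) :
    IsTruncatedSuper ((surf n M).restrict Ω) (kernelMk hK) R d b₀ w' ψ := by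
  intro φ ρ B' κ hρ hφm hφ0 hφB hφρ hκ
  set μ := (surf n M).restrict Ω with hμ
  have hρR : ρ ≤ R₀ := by linarith
  set φψ : Amb n → ℝ := fun x => φ x * ψ x with hφψ
  have hφψm : Measurable φψ := by fun_prop
  have hφψ0 : ∀ x, 0 ≤ φψ x := fun x => mul_nonneg (hφ0 x) (hψ0 x)
  have hφψB : ∀ x, |φψ x| ≤ B' := fun x => by
    rw [abs_of_nonneg (hφψ0 x)]
    exact (mul_le_of_le_one_right (hφ0 x) (hψ1 x)).trans (hφB x)
  have hφψρ : ∀ x ∉ ball 0 ρ, φψ x = 0 := fun x hx => by simp [hφψ, hφρ x hx]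
  have hφi : Integrable φψ μ := integrable_of_bounded_ball hJ hφψm hφψB hφψρ hρR
  have hwφi : Integrable (fun x => w' x * φψ x) μ :=
    (hφi.const_mul B).mono' (by fun_prop) (ae_of_all _ fun x => by
      rw [Real.norm_eq_abs, abs_of_nonneg (mul_nonneg (hw'0 x) (hφψ0 x))]
      exact mul_le_mul_of_nonneg_right (hw'B x) (hφψ0 x))
  set C : Set (Amb n) := closedBall 0 ρ \ O with hC
  have hCc : IsCompact C := (isCompact_closedBall 0 ρ).diff hO
  have hC4 : C ⊆ ball 0 (4 * R) \ Z := fun x hx =>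
    ⟨closedBall_subset_ball hρ hx.1, fun hz => hx.2 (hZO hz)⟩
  have hφψC : ∀ x ∉ C, φψ x = 0 := fun x hx => by
    by_cases hxρ : x ∈ ball (0 : Amb n) ρ
    · have : x ∈ O := by
        by_contra hxO
        exact hx ⟨ball_subset_closedBall hxρ, hxO⟩
      simp [hφψ, hψO x this]
    · exact hφψρ x hxρ
  have hKae : ∀ᵐ x ∂μ, ∀ᵐ y ∂μ, K x y = kernelMk hK x y :=
    Measure.ae_ae_of_ae_prod (ae_prod_of_ae_surf (kernelMk_ae hK))
  filter_upwards [Metric.tendstoUniformlyOn_iff.1 (hunif C hCc hC4) κ hκ,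
    Ioo_mem_nhdsGT (show (0 : ℝ) < R₀ by linarith)] with δ hδ hδ'
  obtain ⟨i1, e1⟩ :=
    integral_mul_truncated hP hJ hw'm hw'0 hw'B hφψm hφψB hφψρ hρR hδ'.1 hδ'.2.le
  have htr : ∀ᵐ x ∂μ, truncLK n M Ω K w δ x =
      -∫ y in (ball x δ)ᶜ, (w' x - w' y) * (kernelMk hK x y).toReal ∂μ := by
    filter_upwards [hww', hKae] with x hx hx'
    rw [truncLK, sdiff_eq, inter_comm, ← Measure.restrict_restrict measurableSet_ball.compl,
      ← integral_neg]
    refine integral_congr_ae (ae_restrict_of_ae ?_)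
    filter_upwards [hww', hx'] with y hy hy'
    rw [integrandLK, hx, hy, hy']
    ring
  have hpt : ∀ᵐ x ∂μ, -d * φψ x ≤
      φψ x * (∫ y in (ball x δ)ᶜ, (w' x - w' y) * (kernelMk hK x y).toReal ∂μ) +
        b₀ * (w' x * φψ x) + κ * φψ x := by
    filter_upwards [htr, hww', ae_restrict_of_ae (ae_mem_surf hM)] with x h1 h2 hxM
    by_cases hxC : x ∈ C
    · have hx4 := hC4 hxC
      have hxU : x ∈ M ∩ ball 0 (4 * R) := ⟨hxM, hx4.1⟩
      have hd := hδ x ⟨hxM, hxC⟩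
      rw [Real.dist_eq, h1] at hd
      have hd' := (abs_lt.1 hd).1
      have hLx := hL x ⟨hxU, hx4.2⟩
      rw [h2] at hLx
      have hbx := mul_le_mul_of_nonneg_right (hb x hxU) (hw'0 x)
      have hfx := hf x hxU
      have := mul_le_mul_of_nonneg_left (show -d ≤
        (∫ y in (ball x δ)ᶜ, (w' x - w' y) * (kernelMk hK x y).toReal ∂μ) + b₀ * w' x + κ by
          linarith) (hφψ0 x)
      linarith
    · simp [hφψC x hxC]
  have hle := integral_mono_ae (hφi.const_mul (-d))
    ((i1.add (hwφi.const_mul b₀)).add (hφi.const_mul κ)) hpt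
  have e2 : ∫ x, (φψ x * (∫ y in (ball x δ)ᶜ, (w' x - w' y) * (kernelMk hK x y).toReal ∂μ) +
        b₀ * (w' x * φψ x) + κ * φψ x) ∂μ =
      (1 / 2) * ∫ z in farPairs n δ, (w' z.1 - w' z.2) * (φψ z.1 - φψ z.2)
        ∂(jump μ (kernelMk hK)) + b₀ * ∫ x, w' x * φψ x ∂μ + κ * ∫ x, φψ x ∂μ := by
    have i2 : Integrable (fun x => b₀ * (w' x * φψ x)) μ := hwφi.const_mul b₀
    have i3 : Integrable (fun x => φψ x * (∫ y in (ball x δ)ᶜ, (w' x - w' y) *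
        (kernelMk hK x y).toReal ∂μ) + b₀ * (w' x * φψ x)) μ := i1.add i2
    rw [integral_add i3 (hφi.const_mul κ), integral_add i1 i2, e1, integral_const_mul,
      integral_const_mul]
  rw [integral_const_mul] at hle
  exact hle.trans e2.le

/-- The factors are taken with error `2^{-j}`: summability of the squared norms of `1 - ψ_j` yields
convergence to `1` almost everywhere along the whole sequence. -/
theorem isSuper_of_pointwise [SFinite (surf n M)] (hP : Admissible n s cs Cs Λ)
    (hM : NullMeasurableSet M (μHE[n] : Measure (Amb n))) {R d b₀ : ℝ}
    (hR : 0 < R) (hRR : 4 * R ≤ R₀) (hd : 0 ≤ d) (hb₀ : 0 ≤ b₀)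
    (hK : IsTruncatedKernel n s Λ R₀ M Ω K)
    (hJ : IsJumpSpace n s cs Cs Λ R₀ ((surf n M).restrict Ω) (kernelMk hK))
    {b f w w' : Amb n → ℝ} {B : ℝ} (hb : ∀ x ∈ M ∩ ball 0 (4 * R), b x ≤ b₀)
    (hf : ∀ x ∈ M ∩ ball 0 (4 * R), -d ≤ f x)
    (hw : IsGenPointwiseSupersolution n s M Ω (ball 0 (4 * R)) K b f w)
    (hw'm : Measurable w') (hw'0 : ∀ x, 0 ≤ w' x) (hw'B : ∀ x, w' x ≤ B)
    (hww' : ∀ᵐ x ∂((surf n M).restrict Ω), w x = w' x) :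
    IsSuper ((surf n M).restrict Ω) (kernelMk hK) R d b₀ w' := by
  obtain ⟨-, -, Z, -, hZ1, hZ2, L, -, hunif, hL⟩ := hw
  have hε : ∀ j : ℕ, (0 : ℝ≥0∞) < (2 : ℝ≥0∞)⁻¹ ^ j := fun j =>
    ENNReal.pow_pos (ENNReal.inv_pos.2 (by norm_num)) j
  choose ψ O hO hZO hψm hψ0 hψ1 hψO hψ2 hψE using fun j : ℕ =>
    exists_factor hP hK hJ hZ1 hZ2 (hε j)
  have hsum : ∑' j : ℕ, (2 : ℝ≥0∞)⁻¹ ^ j ≠ ∞ := by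
    rw [ENNReal.tsum_geometric, ENNReal.one_sub_inv_two, inv_inv]; norm_num
  have hε0 : Tendsto (fun j : ℕ => (2 : ℝ≥0∞)⁻¹ ^ j) atTop (𝓝 0) :=
    ENNReal.tendsto_atTop_zero_of_tsum_ne_top hsum
  refine isSuper_of_truncated hP hJ hR hRR hd hb₀ hw'm hw'0 hw'B hψm hψ0 hψ1 ?_ ?_ ?_ ?_
  · exact fun j => (hψE j).trans_lt (ENNReal.mul_lt_top ENNReal.ofReal_lt_top
      (ENNReal.pow_lt_top (by simp)))
  · refine tendsto_of_tendsto_of_tendsto_of_le_of_le tendsto_const_nhds ?_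
      (fun j => bot_le) hψE
    simpa using ENNReal.Tendsto.const_mul hε0 (Or.inr ENNReal.ofReal_ne_top)
  · have hfin : ∫⁻ x, ∑' j, ENNReal.ofReal ((1 - ψ j x) ^ 2) ∂((surf n M).restrict Ω) ≠ ∞ := by
      rw [lintegral_tsum fun j => by have := hψm j; fun_prop]
      exact ((ENNReal.tsum_le_tsum hψ2).trans_lt hsum.lt_top).ne
    filter_upwards [ae_lt_top' (AEMeasurable.tsum fun j => by
      have := hψm j; fun_prop) hfin] with x hx
    have h1 := ENNReal.tendsto_atTop_zero_of_tsum_ne_top hx.ne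
    have h2 := (ENNReal.tendsto_toReal ENNReal.zero_ne_top).comp h1
    have h3 : Tendsto (fun j => (1 - ψ j x) ^ 2) atTop (𝓝 0) := by
      refine (h2.congr fun j => ?_)
      exact ENNReal.toReal_ofReal (sq_nonneg _)
    have h4 := h3.sqrt
    rw [Real.sqrt_zero] at h4
    have h5 : ∀ j, √((1 - ψ j x) ^ 2) = 1 - ψ j x := fun j =>
      Real.sqrt_sq (sub_nonneg.2 (hψ1 j x))
    simp_rw [h5] at h4
    simpa using h4.const_sub 1
  · exact fun j => isTruncatedSuper_of_pointwise hP hM hR hRR hK hJ hb hf hunif hL hw'm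
      hw'0 hw'B hww' (hO j) (hZO j) (hψm j) (hψ0 j) (hψ1 j) (hψO j)

end NonlocalHarnack

/-! ### Passage between versions and conclusion. -/

namespace NonlocalHarnack

variable {n : ℕ} {s cs Cs Λ R₀ : ℝ} {M Ω : Set (Amb n)} {K : Amb n → Amb n → ℝ≥0∞}

theorem one_lt_theta (hP : Admissible n s cs Cs Λ) : 1 < theta n s := by
  rw [theta_eq hP, one_lt_div (by linarith [gam_le_half (n := n) (s := s)])]
  linarith [gam_pos hP]

/-- The tail of a function, with respect to the two versions of the kernel. -/
theorem tail_surf_eq [SFinite (surf n M)] (hΩ : IsOpen Ω)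
    (hK : IsTruncatedKernel n s Λ R₀ M Ω K) {w w' : Amb n → ℝ}
    (hww' : ∀ᵐ x ∂((surf n M).restrict Ω), w x = w' x) {A : Set (Amb n)} (hA : MeasurableSet A) :
    ∀ᵐ x ∂((surf n M).restrict Ω), ∫⁻ y in A, ENNReal.ofReal (w y) * K x y ∂(surf n M) =
      ∫⁻ y in A, ENNReal.ofReal (w' y) * kernelMk hK x y ∂((surf n M).restrict Ω) := by
  filter_upwards [Measure.ae_ae_of_ae_prod hK.trunc,
    Measure.ae_ae_of_ae_prod (ae_prod_of_ae_surf (kernelMk_ae hK))] with x h1 h2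
  have e0 : ∫⁻ y in A \ Ω, ENNReal.ofReal (w y) * K x y ∂(surf n M) = 0 := by
    rw [sdiff_eq, ← Measure.restrict_restrict hA]
    refine (lintegral_congr_ae (ae_restrict_of_ae ?_)).trans lintegral_zero
    filter_upwards [h1] with y hy
    rw [hy, mul_zero]
  rw [← lintegral_inter_add_sdiff _ A hΩ.measurableSet, e0, add_zero,
    ← Measure.restrict_restrict hA]
  refine lintegral_congr_ae (ae_restrict_of_ae ?_)
  filter_upwards [h2, hww'] with y hy hy'
  rw [hy, hy']

theorem exists_nonneg_version {μ : Measure (Amb n)} {w : Amb n → ℝ} (hw : AEMeasurable w μ)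
    (hw0 : ∀ᵐ x ∂μ, 0 ≤ w x) :
    ∃ w' : Amb n → ℝ, Measurable w' ∧ (∀ x, 0 ≤ w' x) ∧ ∀ᵐ x ∂μ, w x = w' x := by
  refine ⟨fun x => max 0 (hw.mk w x), measurable_const.max hw.measurable_mk,
    fun x => le_max_left _ _, ?_⟩
  filter_upwards [hw.ae_eq_mk, hw0] with x h1 h2
  rw [← h1, max_eq_right h2]

theorem exists_bounded_version {μ : Measure (Amb n)} {w : Amb n → ℝ} {B : ℝ} (hw : AEMeasurable w μ)
    (hw0 : ∀ᵐ x ∂μ, 0 ≤ w x) (hB : 0 ≤ B) (hwB : ∀ᵐ x ∂μ, w x ≤ B) :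
    ∃ w' : Amb n → ℝ, Measurable w' ∧ (∀ x, 0 ≤ w' x) ∧ (∀ x, w' x ≤ B) ∧
      ∀ᵐ x ∂μ, w x = w' x := by
  obtain ⟨u, hum, hu0, hu⟩ := exists_nonneg_version hw hw0
  refine ⟨fun x => min B (u x), measurable_const.min hum, fun x => le_min hB (hu0 x),
    fun x => min_le_left _ _, ?_⟩
  filter_upwards [hu, hwB] with x h1 h2
  rw [← h1, min_eq_right h2]

theorem exists_isSuper [SFinite (surf n M)] (hP : Admissible n s cs Cs Λ)
    (hM : NullMeasurableSet M (μHE[n] : Measure (Amb n))) {R d b₀ : ℝ}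
    (hR : 0 < R) (hRR : 4 * R ≤ R₀) (hd : 0 ≤ d) (hb₀ : 0 ≤ b₀) (hΩ : IsOpen Ω)
    (hMΩ : M ∩ ball 0 R₀ ⊆ Ω) (hK : IsTruncatedKernel n s Λ R₀ M Ω K)
    (hJ : IsJumpSpace n s cs Cs Λ R₀ ((surf n M).restrict Ω) (kernelMk hK))
    {b f w : Amb n → ℝ} (hb : ∀ x ∈ M ∩ ball 0 (4 * R), b x ≤ b₀)
    (hf : ∀ x ∈ M ∩ ball 0 (4 * R), -d ≤ f x)
    (hw : IsWeakSupersolution n M (ball 0 (4 * R)) K b f w ∨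
      IsGenPointwiseSupersolution n s M Ω (ball 0 (4 * R)) K b f w)
    (hw0 : ∀ᵐ x ∂((surf n M).restrict Ω), 0 ≤ w x) :
    ∃ w' : Amb n → ℝ, (∀ᵐ x ∂((surf n M).restrict Ω), w x = w' x) ∧
      IsSuper ((surf n M).restrict Ω) (kernelMk hK) R d b₀ w' := by
  rcases hw with hw | hw
  · have hwm : AEMeasurable w (surf n M) :=
      (hw.1 (ball 0 R) isOpen_ball (compact_closure_ball R)
        (closure_ball_subset_closedBall.trans (closedBall_subset_ball (by linarith)))).1
    obtain ⟨w', h1, h2, h3⟩ := exists_nonneg_version (hwm.mono_measure Measure.restrict_le_self) hw0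
    exact ⟨w', h3, isSuper_of_weak hP hM hΩ hR hRR hd hb₀ hMΩ hK hJ hb hf hw h1 h2 h3⟩
  · obtain ⟨B, hB⟩ := hw.2.1
    have hwB : ∀ᵐ x ∂((surf n M).restrict Ω), w x ≤ max 0 B := by
      filter_upwards [ae_restrict_of_ae (ae_mem_surf hM), ae_restrict_mem hΩ.measurableSet]
        with x h1 h2 using ((le_abs_self _).trans (hB x ⟨h1, h2⟩)).trans (le_max_right _ _)
    obtain ⟨w', h1, h2, h3, h4⟩ := exists_bounded_version hw.1 hw0 (le_max_left 0 B) hwB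
    exact ⟨w', h4, isSuper_of_pointwise hP hM hR hRR hd hb₀ hK hJ hb hf hw h1 h2 h3 h4⟩

end NonlocalHarnack

theorem mainTheorem4 (n : ℕ) (hn : 1 ≤ n) (s : ℝ) (hs : 1 / 2 < s) (hs' : s < 1) :
    1 < NonlocalHarnack.theta n s ∧
    ∀ p : ℝ, 0 < p → p < NonlocalHarnack.theta n s →
    ∀ cs Cs Λ bs : ℝ, 0 < cs → cs ≤ Cs → 1 ≤ Λ → 0 ≤ bs →
    ∃ c : ℝ, 0 < c ∧ c ≤ 1 ∧
    ∀ (M Ω : Set (NonlocalHarnack.Amb n)) (R₀ R d : ℝ)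
      (K : NonlocalHarnack.Amb n → NonlocalHarnack.Amb n → ℝ≥0∞)
      (b f w : NonlocalHarnack.Amb n → ℝ),
      NullMeasurableSet M (μHE[n] : Measure (NonlocalHarnack.Amb n)) →
      SigmaFinite (NonlocalHarnack.surf n M) →
      IsOpen Ω →
      0 < R → R < R₀ / 4 → 0 ≤ d →
      (0 : NonlocalHarnack.Amb n) ∈ M → M ∩ ball 0 R₀ ⊆ Ω →
      NonlocalHarnack.HasDensity n cs Cs R₀ M Ω →
      NonlocalHarnack.IsTruncatedKernel n s Λ R₀ M Ω K →
      AEMeasurable b ((NonlocalHarnack.surf n M).restrict (ball 0 (4 * R))) →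
      AEMeasurable f ((NonlocalHarnack.surf n M).restrict (ball 0 (4 * R))) →
      (∃ B : ℝ, ∀ x ∈ M ∩ ball 0 (4 * R), |b x| ≤ B ∧ |f x| ≤ B) →
      (∀ x ∈ M ∩ ball 0 (4 * R), b x ≤ R₀ ^ (-(2 * s)) * bs) →
      (∀ x ∈ M ∩ ball 0 (4 * R), -d ≤ f x) →
      (NonlocalHarnack.IsWeakSupersolution n M (ball 0 (4 * R)) K b f w ∨
        NonlocalHarnack.IsGenPointwiseSupersolution n s M Ω (ball 0 (4 * R)) K b f w) →
      (∀ᵐ x ∂((NonlocalHarnack.surf n M).restrict Ω), 0 ≤ w x) →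
      ENNReal.ofReal c *
          ((⨍⁻ x in ball 0 R, ENNReal.ofReal (w x) ^ p ∂(NonlocalHarnack.surf n M)) ^ (1 / p) +
            ENNReal.ofReal (R ^ (2 * s)) *
              essInf (fun x => ∫⁻ y in (ball 0 R)ᶜ, ENNReal.ofReal (w y) * K x y
                  ∂(NonlocalHarnack.surf n M))
                ((NonlocalHarnack.surf n M).restrict (ball 0 (R / 2)))) ≤
        essInf (fun x => ENNReal.ofReal (w x)) ((NonlocalHarnack.surf n M).restrict (ball 0 R)) +
          ENNReal.ofReal (R ^ (2 * s) * d) := by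
  have hP : ∀ {cs Cs Λ : ℝ}, 0 < cs → cs ≤ Cs → 1 ≤ Λ →
      NonlocalHarnack.Admissible n s cs Cs Λ := fun h1 h2 h3 => ⟨hn, hs, hs', h1, h2, h3⟩
  refine ⟨NonlocalHarnack.one_lt_theta (hP one_pos le_rfl le_rfl), ?_⟩
  intro p hp hpθ cs Cs Λ bs hcs hCs hΛ hbs
  obtain ⟨c, hc0, hc1, hc⟩ := NonlocalHarnack.weak_harnack (hP hcs hCs hΛ) hbs hp hpθ
  refine ⟨c, hc0, hc1, ?_⟩
  intro M Ω R₀ R d K b f w hM hσ hΩ hR hRR₀ hd h0 hMΩ hD hK _ _ _ hb hf hw hw0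
  have hR₀ : 0 < R₀ := by linarith
  have hRR : 4 * R ≤ R₀ := by linarith
  have hJ := NonlocalHarnack.isJumpSpace_surf hM hΩ hR₀ h0 hMΩ hD hK
  have hb₀ : 0 ≤ R₀ ^ (-(2 * s)) * bs := by positivity
  obtain ⟨w', hww', hsup⟩ := NonlocalHarnack.exists_isSuper (hP hcs hCs hΛ) hM hR hRR hd hb₀ hΩ
    hMΩ hK hJ hb hf hw hw0
  -- The bound on `b` is stated at scale `R₀`; since `R < R₀` and the exponent is negative, it
  -- implies the one at scale `R`.
  have hbR : R₀ ^ (-(2 * s)) * bs ≤ bs * R ^ (-(2 * s)) := by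
    rw [mul_comm]
    exact mul_le_mul_of_nonneg_left
      (Real.rpow_le_rpow_of_nonpos hR (by linarith) (by linarith)) hbs
  have key := hc R₀ _ _ R d _ w' inferInstance hJ hsup hd hb₀ hR hRR hbR
  have hball : ∀ r ≤ R₀, ((NonlocalHarnack.surf n M).restrict Ω).restrict (ball 0 r) =
      (NonlocalHarnack.surf n M).restrict (ball 0 r) :=
    fun r hr => NonlocalHarnack.restrict_ball_eq hΩ hMΩ hr
  have hae : ∀ r ≤ R₀, ∀ᵐ x ∂((NonlocalHarnack.surf n M).restrict (ball 0 r)), w x = w' x :=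
    fun r hr => by rw [← hball r hr]; exact ae_restrict_of_ae hww'
  rw [hball R (by linarith), hball (R / 2) (by linarith)] at key
  have e1 : ⨍⁻ x in ball 0 R, ENNReal.ofReal (w x) ^ p ∂(NonlocalHarnack.surf n M) =
      ⨍⁻ x in ball 0 R, ENNReal.ofReal (w' x) ^ p ∂(NonlocalHarnack.surf n M) :=
    laverage_congr ((hae R (by linarith)).mono fun x hx => by simp only [hx])
  have e2 : essInf (fun x => ENNReal.ofReal (w x))
      ((NonlocalHarnack.surf n M).restrict (ball 0 R)) =
      essInf (fun x => ENNReal.ofReal (w' x)) ((NonlocalHarnack.surf n M).restrict (ball 0 R)) :=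
    essInf_congr_ae ((hae R (by linarith)).mono fun x hx => by simp only [hx])
  -- The two tails, one over `M` with `K` and one over `M ∩ Ω` with the measurable version of the
  -- kernel, agree at almost every point of `M ∩ B_{R/2}`, since the kernel does not connect `Ω`
  -- with its complement.
  have e3 := essInf_congr_ae (μ := (NonlocalHarnack.surf n M).restrict (ball 0 (R / 2)))
    (f := fun x => ∫⁻ y in (ball 0 R)ᶜ, ENNReal.ofReal (w y) * K x y ∂(NonlocalHarnack.surf n M))
    (g := fun x => ∫⁻ y in (ball 0 R)ᶜ, ENNReal.ofReal (w' y) * NonlocalHarnack.kernelMk hK x y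
      ∂((NonlocalHarnack.surf n M).restrict Ω)) (by
      rw [← hball (R / 2) (by linarith)]
      exact ae_restrict_of_ae
        (NonlocalHarnack.tail_surf_eq hΩ hK hww' measurableSet_ball.compl))
  rw [e1, e2, e3]
  exact key
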